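/- Let $k_1,k_2,\ldots$ be nonnegative integers with $k_i>0$ for infinitely many $i$. Let $\Lambda$ be the small category with objects $v_1,v_2,\ldots$ generated by edges $\alpha_i$, $\beta_i$ and $\gamma_i^{(j)}$ ($i\ge 1$, $1\le j\le k_i$), each with range $v_i$ and source $v_{i+1}$, subject only to the relations $\alpha_i\beta_{i+1}=\beta_i\alpha_{i+1}$; the product $\mu\nu$ is defined when $s(\mu)=r(\nu)$. (Thus $\Lambda$ is the amalgamation, over the vertices, of the $2$-graph generated by the $\alpha_i,\beta_i$ with the $1$-graph generated by the $\gamma_i^{(j)}$.) Let $\Lambda^*$ be the set of nonempty subsets $x\subseteq\Lambda$ that are hereditary (closed under prefixes) and directed (any two elements of $x$ have a common extension in $x$). All elements of $x\in\Lambda^*$ have the same range, denoted $r(x)$. Give $\Lambda^*$ the topology with base the sets $Z(\lambda)\setminus\bigcup_{i=1}^n Z(\mu_i)$, where $Z(\mu)=\{x\in\Lambda^*:\mu\in x\}$. Let $\partial\Lambda$ be the closure of the set of elements of $\Lambda^*$ that are maximal under inclusion, and let $X=\{x\in\partial\Lambda:r(x)=v_1\}$. For $x \in \Lambda^*$ with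 $r(x)=s(\mu)$, let $\mu x\in\Lambda^*$ be the set of all prefixes of the paths $\mu\nu$, $\nu\in x$. Let $G$ be the groupoid with unit space $G^{(0)}=X$ whose elements are the classes $[\mu,\nu,x]$ of triples with $r(\mu)=r(\nu)=v_1$, $s(\mu)=s(\nu)=r(x)$ and $\mu x,\nu x\in X$, for the equivalence relation generated by $(\mu,\nu,\eta x)\sim(\mu\eta,\nu\eta,x)$. Its range and source maps are $r([\mu,\nu,x])=\mu x$, $s([\mu,\nu,x])=\nu x$, and its operations are given by $[\mu,\nu,x][\nu,\eta,x]=[\mu,\eta,x]$, $[\mu,\nu,x]^{-1}=[\nu,\mu,x]$. Its topology has as base the sets $\{[\mu,\nu,x]\in G:x\in E\}$ with $E\subseteq\{x\in\Lambda^*:r(x)=s(\nu)\}$ compact open. This is an ample (étale, locally compact, Hausdorff) groupoid. Let $C^*(G)$ be its full groupoid $C^*$-algebra, that is, the completion of the convolution algebra $C_c(G)$ in the norm $\|f\|=\sup_\pi\|\pi(f)\|$, the supremum being over all $*$-representations $\pi$ of $C_c(G)$ on Hilbert spaces that are bounded by the $I$-norm. Then: (1) There is a unique Borel probability measure $m$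 on $X=G^{(0)}$ that is invariant, i.e. $m(s(E))=m(r(E))$ for every open bisection $E\subseteq G$. (2) The set of points of $X$ with nontrivial isotropy in $G$ is a single, countably infinite orbit, and it is $m$-null. (3) There is a unique tracial state $\tau$ on $C^*(G)$ (a positive linear functional of norm one with $\tau(ab)=\tau(ba)$ for all $a,b$), and $$\tau(f)=\int_{G^{(0)}}f|_{G^{(0)}}\,dm\qquad\text{for all } f\in C_c(G).$$ -/

import Mathlib

open CategoryTheory MeasureTheory Set Topology
open scoped ENNReal ComplexOrder CompactlySupported

noncomputable section

namespace PathGroupoid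

/-! ## Categories of paths

An arrow `μ : u ⟶ v` of the category is a path with range `u` and source `v`, so that the product
`μν` of two paths, defined when `s(μ) = r(ν)`, is `μ ≫ ν`. -/

/-- A category of paths: a cancellative small category in which no nonunit has an inverse. -/
class CategoryOfPaths (C : Type) [SmallCategory C] : Prop where
  left_cancel : ∀ {u v w : C} (μ : u ⟶ v) (ν ν' : v ⟶ w), μ ≫ ν = μ ≫ ν' → ν = ν'
  right_cancel : ∀ {u v w : C} (μ μ' : u ⟶ v) (ν : v ⟶ w), μ ≫ ν = μ' ≫ ν → μ = μ'
  no_inverse : ∀ {u v : C} (μ : u ⟶ v) (ν : v ⟶ u), μ ≫ ν = 𝟙 u → ν ≫ μ = 𝟙 v →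
    ∃ h : u = v, μ = eqToHom h

/-- The set `uΛ` of all paths with range `u`. -/
abbrev PathsFrom (C : Type) [SmallCategory C] (u : C) : Type := Σ v : C, (u ⟶ v)

section Paths

variable {C : Type} [SmallCategory C]

/-- `μ` is a prefix of `ν`, i.e. `ν ∈ μΛ`. -/
def IsPrefix {u : C} (μ ν : PathsFrom C u) : Prop :=
  ∃ η : μ.1 ⟶ ν.1, μ.2 ≫ η = ν.2

/-- The product `μν` for `ν ∈ s(μ)Λ`. -/
def prepend {u v : C} (μ : u ⟶ v) (ν : PathsFrom C v) : PathsFrom C u := ⟨ν.1, μ ≫ ν.2⟩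

theorem IsPrefix.refl {u : C} (μ : PathsFrom C u) : IsPrefix μ μ := ⟨𝟙 _, by simp⟩

theorem IsPrefix.trans {u : C} {μ ν ξ : PathsFrom C u} (h : IsPrefix μ ν) (h' : IsPrefix ν ξ) :
    IsPrefix μ ξ := by
  obtain ⟨η, hη⟩ := h
  obtain ⟨η', hη'⟩ := h'
  exact ⟨η ≫ η', by rw [← Category.assoc, hη, hη']⟩

theorem IsPrefix.prepend {u v : C} (μ : u ⟶ v) {ν ξ : PathsFrom C v} (h : IsPrefix ν ξ) :
    IsPrefix (prepend μ ν) (prepend μ ξ) := by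
  obtain ⟨η, hη⟩ := h
  exact ⟨η, by simp [PathGroupoid.prepend, ← hη]⟩

theorem IsPrefix.of_prepend [CategoryOfPaths C] {u v : C} (μ : u ⟶ v) {ν ξ : PathsFrom C v}
    (h : IsPrefix (PathGroupoid.prepend μ ν) (PathGroupoid.prepend μ ξ)) : IsPrefix ν ξ := by
  obtain ⟨η, hη⟩ := h
  exact ⟨η, CategoryOfPaths.left_cancel μ _ _ ((Category.assoc μ ν.2 η).symm.trans hη)⟩

theorem prepend_id {u : C} (ν : PathsFrom C u) : prepend (𝟙 u) ν = ν := by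
  simp [prepend]

theorem prepend_comp {u v w : C} (μ : u ⟶ v) (η : v ⟶ w) (ν : PathsFrom C w) :
    prepend (μ ≫ η) ν = prepend μ (prepend η ν) := by
  simp [prepend]

/-- `uΛ*`: the (nonempty) directed hereditary subsets of `Λ` with range `u`. -/
@[ext]
structure PathSpace (C : Type) [SmallCategory C] (u : C) where
  carrier : Set (PathsFrom C u)
  nonempty : carrier.Nonempty
  hereditary : ∀ μ ν, ν ∈ carrier → IsPrefix μ ν → μ ∈ carrier
  directed : ∀ μ ∈ carrier, ∀ ν ∈ carrier, ∃ ξ ∈ carrier, IsPrefix μ ξ ∧ IsPrefix ν ξ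

/-- The cylinder set `Z(μ)`. -/
def cylinder {u : C} (μ : PathsFrom C u) : Set (PathSpace C u) := {x | μ ∈ x.carrier}

/-- The topology with base the sets `Z(λ) \ (Z(μ₁) ∪ ⋯ ∪ Z(μₖ))`. -/
instance (u : C) : TopologicalSpace (PathSpace C u) :=
  TopologicalSpace.generateFrom
    {E | ∃ (l : PathsFrom C u) (F : Set (PathsFrom C u)), F.Finite ∧
      E = cylinder l \ ⋃ m ∈ F, cylinder m}

/-- `x` is a maximal element of `Λ*` with respect to inclusion. -/
def PathSpace.IsMaximal {u : C} (x : PathSpace C u) : Prop :=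
  ∀ y : PathSpace C u, x.carrier ⊆ y.carrier → y.carrier ⊆ x.carrier

/-- `u∂Λ`: the closure of the set of maximal elements of `uΛ*`. -/
def Boundary (C : Type) [SmallCategory C] (u : C) : Type :=
  {x : PathSpace C u // x ∈ closure {y : PathSpace C u | y.IsMaximal}}

instance (u : C) : TopologicalSpace (Boundary C u) := inferInstanceAs (TopologicalSpace {_x // _})

instance (u : C) : MeasurableSpace (Boundary C u) := borel _

instance (u : C) : BorelSpace (Boundary C u) := ⟨rfl⟩

/-- `μx`: the set of all prefixes of the paths `μν` with `ν ∈ x`. -/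
def PathSpace.extend {u v : C} (μ : u ⟶ v) (x : PathSpace C v) : PathSpace C u where
  carrier := {p | ∃ ν ∈ x.carrier, IsPrefix p (prepend μ ν)}
  nonempty := by
    obtain ⟨ν, hν⟩ := x.nonempty
    exact ⟨_, ν, hν, IsPrefix.refl _⟩
  hereditary := by
    rintro p q ⟨ν, hν, h⟩ hp
    exact ⟨ν, hν, hp.trans h⟩
  directed := by
    rintro p ⟨ν, hν, h⟩ q ⟨ν', hν', h'⟩
    obtain ⟨ξ, hξ, h1, h2⟩ := x.directed ν hν ν' hν'
    exact ⟨prepend μ ξ, ⟨ξ, hξ, IsPrefix.refl _⟩, h.trans (h1.prepend μ), h'.trans (h2.prepend μ)⟩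

theorem PathSpace.extend_id {u : C} (x : PathSpace C u) : x.extend (𝟙 u) = x := by
  ext p
  constructor
  · rintro ⟨ν, hν, h⟩
    rw [prepend_id] at h
    exact x.hereditary _ _ hν h
  · intro hp
    exact ⟨p, hp, by rw [prepend_id]; exact IsPrefix.refl _⟩

theorem PathSpace.extend_comp {u v w : C} (μ : u ⟶ v) (η : v ⟶ w) (x : PathSpace C w) :
    x.extend (μ ≫ η) = (x.extend η).extend μ := by
  ext p
  constructor
  · rintro ⟨ν, hν, h⟩
    rw [prepend_comp] at h
    exact ⟨prepend η ν, ⟨ν, hν, IsPrefix.refl _⟩, h⟩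
  · rintro ⟨ξ, ⟨ν, hν, h⟩, h'⟩
    refine ⟨ν, hν, ?_⟩
    rw [prepend_comp]
    exact h'.trans (h.prepend μ)

variable [CategoryOfPaths C]

theorem PathSpace.extend_injective {u v : C} (μ : u ⟶ v) {x y : PathSpace C v}
    (h : x.extend μ = y.extend μ) : x = y := by
  have key : ∀ x y : PathSpace C v, x.extend μ = y.extend μ → x.carrier ⊆ y.carrier := by
    intro x y h ν hν
    have h1 : prepend μ ν ∈ (x.extend μ).carrier := ⟨ν, hν, IsPrefix.refl _⟩
    rw [h] at h1
    obtain ⟨ξ, hξ, h2⟩ := h1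
    exact y.hereditary _ _ hξ h2.of_prepend
  exact PathSpace.ext (Subset.antisymm (key x y h) (key y x h.symm))

/-- If a path `l` belongs to `x` then `x = ly` for some `y`. -/
theorem PathSpace.exists_eq_extend {u w : C} (x : PathSpace C u) (l : u ⟶ w)
    (hl : (⟨w, l⟩ : PathsFrom C u) ∈ x.carrier) : ∃ y : PathSpace C w, x = y.extend l := by
  refine ⟨⟨{ν | prepend l ν ∈ x.carrier}, ⟨⟨w, 𝟙 w⟩, by simpa [prepend] using hl⟩, ?_, ?_⟩, ?_⟩
  · intro p q hq hp
    exact x.hereditary _ _ hq (hp.prepend l)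
  · intro p hp q hq
    obtain ⟨ξ, hξ, h1, h2⟩ := x.directed _ hp _ hq
    obtain ⟨η, hη⟩ := h1
    have e : prepend l (⟨ξ.1, p.2 ≫ η⟩ : PathsFrom C w) = ξ := by
      exact Sigma.ext rfl (heq_of_eq ((Category.assoc l p.2 η).symm.trans hη))
    rw [← e] at hξ h2
    exact ⟨⟨ξ.1, p.2 ≫ η⟩, hξ, ⟨η, rfl⟩, h2.of_prepend⟩
  · ext p
    constructor
    · intro hp
      obtain ⟨ξ, hξ, h1, ⟨η, hη⟩⟩ := x.directed _ hp _ hl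
      have e : prepend l (⟨ξ.1, η⟩ : PathsFrom C w) = ξ := by
        obtain ⟨ξ1, ξ2⟩ := ξ
        simp only [prepend] at hη ⊢
        rw [hη]
      refine ⟨⟨ξ.1, η⟩, ?_, ?_⟩
      · change prepend l (⟨ξ.1, η⟩ : PathsFrom C w) ∈ x.carrier
        rw [e]; exact hξ
      · rw [e]; exact h1
    · rintro ⟨ν, hν, h⟩
      exact x.hereditary _ _ hν h

/-- If `μx = μ'x'` then `x = ηy`, `x' = η'y` and `μη = μ'η'` for some `η`, `η'`, `y`. -/
theorem PathSpace.exists_common {u v v' : C} (μ : u ⟶ v) (μ' : u ⟶ v') (x : PathSpace C v)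
    (x' : PathSpace C v') (h : x.extend μ = x'.extend μ') :
    ∃ (w : C) (η : v ⟶ w) (η' : v' ⟶ w) (y : PathSpace C w),
      x = y.extend η ∧ x' = y.extend η' ∧ μ ≫ η = μ' ≫ η' := by
  have mem : ∀ {v : C} (μ : u ⟶ v) (x : PathSpace C v),
      (⟨v, μ⟩ : PathsFrom C u) ∈ (x.extend μ).carrier := by
    intro v μ x
    obtain ⟨ν, hν⟩ := x.nonempty
    exact ⟨ν, hν, ν.2, rfl⟩
  have h1 := mem μ x
  have h2 := mem μ' x'
  rw [← h] at h2
  obtain ⟨ξ, hξ, ⟨η, hη⟩, ⟨η', hη'⟩⟩ := (x.extend μ).directed _ h1 _ h2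
  obtain ⟨w, l⟩ := ξ
  simp only at η hη η' hη'
  obtain ⟨y, hy⟩ := (x.extend μ).exists_eq_extend l hξ
  refine ⟨w, η, η', y, ?_, ?_, hη.trans hη'.symm⟩
  · apply PathSpace.extend_injective μ
    rw [← PathSpace.extend_comp, hη, hy]
  · apply PathSpace.extend_injective μ'
    rw [← PathSpace.extend_comp, hη', ← h, hy]

end Paths

/-! ## The groupoid of a category of paths, with all paths of range `u` -/

section Germs

variable {C : Type} [SmallCategory C]

/-- Triples `(μ, ν, x)` with `r(μ) = r(ν) = u` and `s(μ) = s(ν) = r(x)`. -/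
structure Triple (C : Type) [SmallCategory C] (u : C) where
  src : C
  left : u ⟶ src
  right : u ⟶ src
  pt : PathSpace C src

/-- `(μ, ν, ηx) ∼ (μη, νη, x)`. -/
inductive Triple.Step {u : C} : Triple C u → Triple C u → Prop
  | mk {v w : C} (μ ν : u ⟶ v) (η : v ⟶ w) (x : PathSpace C w) :
      Triple.Step ⟨v, μ, ν, x.extend η⟩ ⟨w, μ ≫ η, ν ≫ η, x⟩

/-- The classes `[μ, ν, x]` for the equivalence relation generated by `Triple.Step`. -/
def Germ (C : Type) [SmallCategory C] (u : C) : Type := Quot (Triple.Step (C := C) (u := u))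

/-- The class `[μ, ν, x]`. -/
def Germ.mk {u v : C} (μ ν : u ⟶ v) (x : PathSpace C v) : Germ C u := Quot.mk _ ⟨v, μ, ν, x⟩

/-- `r([μ, ν, x]) = μx`. -/
def Germ.r {u : C} : Germ C u → PathSpace C u :=
  Quot.lift (fun t => t.pt.extend t.left) (by
    rintro _ _ ⟨μ, ν, η, x⟩
    exact (PathSpace.extend_comp μ η x).symm)

/-- `s([μ, ν, x]) = νx`. -/
def Germ.s {u : C} : Germ C u → PathSpace C u :=
  Quot.lift (fun t => t.pt.extend t.right) (by
    rintro _ _ ⟨μ, ν, η, x⟩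
    exact (PathSpace.extend_comp ν η x).symm)

/-- `[μ, ν, x]⁻¹ = [ν, μ, x]`. -/
def Germ.inv {u : C} : Germ C u → Germ C u :=
  Quot.lift (fun t => Germ.mk t.right t.left t.pt) (by
    rintro _ _ ⟨μ, ν, η, x⟩
    exact Quot.sound (Triple.Step.mk ν μ η x))

/-- The unit at `x`. -/
def Germ.unit {u : C} (x : PathSpace C u) : Germ C u := Germ.mk (𝟙 u) (𝟙 u) x

/-- The product: `[μ, ν, x] · [ν, η, x] = [μ, η, x]`. -/
def Germ.IsProduct {u : C} (g h p : Germ C u) : Prop :=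
  ∃ (v : C) (μ ν η : u ⟶ v) (x : PathSpace C v),
    g = Germ.mk μ ν x ∧ h = Germ.mk ν η x ∧ p = Germ.mk μ η x

/-- The topology with base the sets `[μ, ν, E]` with `E` compact open. -/
instance (u : C) : TopologicalSpace (Germ C u) :=
  TopologicalSpace.generateFrom
    {S | ∃ (v : C) (μ ν : u ⟶ v) (E : Set (PathSpace C v)), IsCompact E ∧ IsOpen E ∧
      S = Germ.mk μ ν '' E}

theorem Germ.mk_extend {u v w : C} (μ ν : u ⟶ v) (η : v ⟶ w) (x : PathSpace C w) :
    Germ.mk μ ν (x.extend η) = Germ.mk (μ ≫ η) (ν ≫ η) x :=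
  Quot.sound (Triple.Step.mk μ ν η x)

theorem Germ.r_mk {u v : C} (μ ν : u ⟶ v) (x : PathSpace C v) :
    (Germ.mk μ ν x).r = x.extend μ := rfl

theorem Germ.s_mk {u v : C} (μ ν : u ⟶ v) (x : PathSpace C v) :
    (Germ.mk μ ν x).s = x.extend ν := rfl

theorem Germ.inv_mk {u v : C} (μ ν : u ⟶ v) (x : PathSpace C v) :
    (Germ.mk μ ν x).inv = Germ.mk ν μ x := rfl

theorem Germ.exists_mk {u : C} (g : Germ C u) :
    ∃ (v : C) (μ ν : u ⟶ v) (x : PathSpace C v), g = Germ.mk μ ν x := by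
  obtain ⟨⟨v, μ, ν, x⟩, rfl⟩ := Quot.exists_rep g
  exact ⟨v, μ, ν, x, rfl⟩

theorem Germ.IsProduct.r_eq {u : C} {g h p : Germ C u} (hp : Germ.IsProduct g h p) :
    p.r = g.r := by
  obtain ⟨v, μ, ν, η, x, rfl, rfl, rfl⟩ := hp
  rfl

theorem Germ.IsProduct.s_eq {u : C} {g h p : Germ C u} (hp : Germ.IsProduct g h p) :
    p.s = h.s := by
  obtain ⟨v, μ, ν, η, x, rfl, rfl, rfl⟩ := hp
  rfl

theorem Germ.unit_extend {u v : C} (μ : u ⟶ v) (x : PathSpace C v) :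
    Germ.unit (x.extend μ) = Germ.mk μ μ x := by
  rw [Germ.unit, Germ.mk_extend, Category.id_comp]

theorem Germ.isProduct_unit_left {u : C} (g : Germ C u) : Germ.IsProduct (Germ.unit g.r) g g := by
  obtain ⟨v, μ, ν, x, rfl⟩ := g.exists_mk
  exact ⟨v, μ, μ, ν, x, by rw [Germ.r_mk, Germ.unit_extend], rfl, rfl⟩

theorem Germ.isProduct_unit_right {u : C} (g : Germ C u) :
    Germ.IsProduct g (Germ.unit g.s) g := by
  obtain ⟨v, μ, ν, x, rfl⟩ := g.exists_mk
  exact ⟨v, μ, ν, ν, x, rfl, by rw [Germ.s_mk, Germ.unit_extend], rfl⟩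

theorem Germ.isProduct_inv_left {u : C} (g : Germ C u) :
    Germ.IsProduct g.inv g (Germ.unit g.s) := by
  obtain ⟨v, μ, ν, x, rfl⟩ := g.exists_mk
  exact ⟨v, ν, μ, ν, x, rfl, rfl, by rw [Germ.s_mk, Germ.unit_extend]⟩

theorem Germ.isProduct_inv_right {u : C} (g : Germ C u) :
    Germ.IsProduct g g.inv (Germ.unit g.r) := by
  obtain ⟨v, μ, ν, x, rfl⟩ := g.exists_mk
  exact ⟨v, μ, ν, μ, x, rfl, rfl, by rw [Germ.r_mk, Germ.unit_extend]⟩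

theorem Germ.inv_r {u : C} (g : Germ C u) : g.inv.r = g.s := by
  obtain ⟨v, μ, ν, x, rfl⟩ := g.exists_mk
  rfl

theorem Germ.inv_s {u : C} (g : Germ C u) : g.inv.s = g.r := by
  obtain ⟨v, μ, ν, x, rfl⟩ := g.exists_mk
  rfl

/-- Two triples have a common refinement. -/
def Triple.Common {u : C} (t t' : Triple C u) : Prop :=
  ∃ (w : C) (δ : t.src ⟶ w) (δ' : t'.src ⟶ w) (z : PathSpace C w),
    t.pt = z.extend δ ∧ t'.pt = z.extend δ' ∧ t.left ≫ δ = t'.left ≫ δ' ∧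
      t.right ≫ δ = t'.right ≫ δ'

variable [CategoryOfPaths C]

theorem Triple.Common.trans {u : C} {t t' t'' : Triple C u} (h : t.Common t')
    (h' : t'.Common t'') : t.Common t'' := by
  obtain ⟨w, δ, δ', z, h1, h2, h3, h4⟩ := h
  obtain ⟨w', ε, ε', z', k1, k2, k3, k4⟩ := h'
  obtain ⟨a, κ, κ', y, e1, e2, e3⟩ := PathSpace.exists_common δ' ε z z' (h2.symm.trans k1)
  refine ⟨a, δ ≫ κ, ε' ≫ κ', y, ?_, ?_, ?_, ?_⟩
  · rw [PathSpace.extend_comp, ← e1, h1]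
  · rw [PathSpace.extend_comp, ← e2, k2]
  · rw [← Category.assoc, h3, Category.assoc, e3, ← Category.assoc, k3, Category.assoc]
  · rw [← Category.assoc, h4, Category.assoc, e3, ← Category.assoc, k4, Category.assoc]

theorem Germ.mk_eq_mk_iff {u v v' : C} (μ ν : u ⟶ v) (x : PathSpace C v) (μ' ν' : u ⟶ v')
    (x' : PathSpace C v') : Germ.mk μ ν x = Germ.mk μ' ν' x' ↔
      ∃ (w : C) (δ : v ⟶ w) (δ' : v' ⟶ w) (z : PathSpace C w),
        x = z.extend δ ∧ x' = z.extend δ' ∧ μ ≫ δ = μ' ≫ δ' ∧ ν ≫ δ = ν' ≫ δ' := by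
  constructor
  · intro h
    have h' := Quot.eqvGen_exact h
    have key : ∀ {t t' : Triple C u}, Relation.EqvGen Triple.Step t t' → t.Common t' := by
      intro t t' hh
      induction hh with
      | rel _ _ hs =>
        obtain ⟨μ, ν, η, x⟩ := hs
        exact ⟨_, η, 𝟙 _, x, rfl, (PathSpace.extend_id x).symm, by simp, by simp⟩
      | refl t =>
        exact ⟨_, 𝟙 _, 𝟙 _, t.pt, (PathSpace.extend_id _).symm, (PathSpace.extend_id _).symm,
          rfl, rfl⟩
      | symm _ _ _ ih =>
        obtain ⟨w, δ, δ', z, h1, h2, h3, h4⟩ := ih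
        exact ⟨w, δ', δ, z, h2, h1, h3.symm, h4.symm⟩
      | trans _ _ _ _ _ ih1 ih2 => exact ih1.trans ih2
    exact key h'
  · rintro ⟨w, δ, δ', z, rfl, rfl, h3, h4⟩
    rw [Germ.mk_extend, Germ.mk_extend, h3, h4]

theorem Germ.exists_product {u : C} (g h : Germ C u) (e : g.s = h.r) :
    ∃ p, Germ.IsProduct g h p := by
  obtain ⟨v, μ, ν, x, rfl⟩ := g.exists_mk
  obtain ⟨v', ξ, η, y, rfl⟩ := h.exists_mk
  obtain ⟨w, δ, ε, z, rfl, rfl, h3⟩ := PathSpace.exists_common ν ξ x y e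
  refine ⟨Germ.mk (μ ≫ δ) (η ≫ ε) z, w, μ ≫ δ, ν ≫ δ, η ≫ ε, z, ?_, ?_, rfl⟩
  · rw [Germ.mk_extend]
  · rw [Germ.mk_extend, h3]

theorem Germ.IsProduct.unique {u : C} {g h p p' : Germ C u} (hp : Germ.IsProduct g h p)
    (hp' : Germ.IsProduct g h p') : p = p' := by
  obtain ⟨v, μ, ν, η, x, rfl, rfl, rfl⟩ := hp
  obtain ⟨v', μ', ν', η', x', e1, e2, rfl⟩ := hp'
  obtain ⟨w, δ, δ', z, a1, a2, a3, a4⟩ := (Germ.mk_eq_mk_iff _ _ _ _ _ _).1 e1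
  obtain ⟨w', ε, ε', z', b1, b2, b3, b4⟩ := (Germ.mk_eq_mk_iff _ _ _ _ _ _).1 e2
  obtain ⟨a, κ, κ', y, c1, c2, c3⟩ := PathSpace.exists_common δ ε z z' (a1.symm.trans b1)
  have c4 : δ' ≫ κ = ε' ≫ κ' := by
    apply CategoryOfPaths.left_cancel ν'
    rw [← Category.assoc, ← a4, Category.assoc, c3, ← Category.assoc, b3, Category.assoc]
  refine (Germ.mk_eq_mk_iff _ _ _ _ _ _).2 ⟨a, δ ≫ κ, δ' ≫ κ, y, ?_, ?_, ?_, ?_⟩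
  · rw [PathSpace.extend_comp, ← c1, a1]
  · rw [PathSpace.extend_comp, ← c1, a2]
  · rw [← Category.assoc, a3, Category.assoc]
  · rw [c3, c4, ← Category.assoc, b4, Category.assoc]

/-- The product of composable germs. -/
def Germ.mul {u : C} (g h : Germ C u) (e : g.s = h.r) : Germ C u :=
  (Germ.exists_product g h e).choose

theorem Germ.isProduct_mul {u : C} (g h : Germ C u) (e : g.s = h.r) :
    Germ.IsProduct g h (g.mul h e) := (Germ.exists_product g h e).choose_spec

theorem Germ.mul_eq {u : C} {g h p : Germ C u} (e : g.s = h.r) (hp : Germ.IsProduct g h p) :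
    g.mul h e = p := (g.isProduct_mul h e).unique hp

theorem Germ.mul_assoc {u : C} (g h k : Germ C u) (e1 : g.s = h.r) (e2 : (g.mul h e1).s = k.r)
    (e3 : h.s = k.r) (e4 : g.s = (h.mul k e3).r) :
    (g.mul h e1).mul k e2 = g.mul (h.mul k e3) e4 := by
  obtain ⟨v, μ, ν, η, x, a1, a2, a3⟩ := g.isProduct_mul h e1
  obtain ⟨v', ν', η', θ, y, b1, b2, b3⟩ := h.isProduct_mul k e3
  obtain ⟨w, δ, ε, z, rfl, rfl, c3, c4⟩ := (Germ.mk_eq_mk_iff _ _ _ _ _ _).1 (a2.symm.trans b1)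
  have hp : Germ.IsProduct (g.mul h e1) k (Germ.mk (μ ≫ δ) (θ ≫ ε) z) :=
    ⟨w, μ ≫ δ, η ≫ δ, θ ≫ ε, z, by rw [a3, Germ.mk_extend], by rw [b2, Germ.mk_extend, c4], rfl⟩
  have hq : Germ.IsProduct g (h.mul k e3) (Germ.mk (μ ≫ δ) (θ ≫ ε) z) :=
    ⟨w, μ ≫ δ, ν ≫ δ, θ ≫ ε, z, by rw [a1, Germ.mk_extend], by rw [b3, Germ.mk_extend, c3], rfl⟩
  rw [Germ.mul_eq e2 hp, Germ.mul_eq e4 hq]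

/-- The groupoid `G(Λ)|_{u∂Λ}`: an arrow `x ⟶ y` is a class `[μ, ν, z]` with range `μz = x` and
source `νz = y`, and the product `gh` is `g ≫ h`. -/
instance (u : C) : Groupoid (Boundary C u) where
  Hom x y := {g : Germ C u // g.r = x.1 ∧ g.s = y.1}
  id x := ⟨Germ.unit x.1, PathSpace.extend_id _, PathSpace.extend_id _⟩
  comp g h := ⟨g.1.mul h.1 (g.2.2.trans h.2.1.symm),
    (g.1.isProduct_mul h.1 _).r_eq.trans g.2.1, (g.1.isProduct_mul h.1 _).s_eq.trans h.2.2⟩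
  id_comp {x _} g := by
    have h := g.1.isProduct_unit_left
    rw [g.2.1] at h
    have e : (Germ.unit x.1).s = g.1.r := (PathSpace.extend_id x.1).trans g.2.1.symm
    exact Subtype.ext (Germ.mul_eq e h)
  comp_id {_ y} g := by
    have h := g.1.isProduct_unit_right
    rw [g.2.2] at h
    have e : g.1.s = (Germ.unit y.1).r := g.2.2.trans (PathSpace.extend_id y.1).symm
    exact Subtype.ext (Germ.mul_eq e h)
  assoc g h k := Subtype.ext (Germ.mul_assoc g.1 h.1 k.1 (g.2.2.trans h.2.1.symm)
    ((Germ.isProduct_mul _ _ _).s_eq.trans (h.2.2.trans k.2.1.symm)) (h.2.2.trans k.2.1.symm)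
    ((g.2.2.trans h.2.1.symm).trans (Germ.isProduct_mul _ _ _).r_eq.symm))
  inv g := ⟨g.1.inv, g.1.inv_r.trans g.2.2, g.1.inv_s.trans g.2.1⟩
  inv_comp g := by
    have h := g.1.isProduct_inv_left
    rw [g.2.2] at h
    exact Subtype.ext (Germ.mul_eq g.1.inv_s h)
  comp_inv g := by
    have h := g.1.isProduct_inv_right
    rw [g.2.1] at h
    exact Subtype.ext (Germ.mul_eq g.1.inv_r.symm h)

/-- The germ underlying an arrow. -/
def germOf {u : C} {x y : Boundary C u} (g : x ⟶ y) : Germ C u := Subtype.val g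

end Germs

/-! ## Topological groupoids and their C*-algebras -/

/-- The set of arrows of a groupoid with unit space `X`; `r` is the range and `s` the source. -/
structure Arr (X : Type) [Groupoid.{0} X] where
  r : X
  s : X
  hom : r ⟶ s

/-- The arrows of `G(Λ)|_{u∂Λ}` carry the subspace topology from the space of germs. -/
instance {C : Type} [SmallCategory C] [CategoryOfPaths C] (u : C) :
    TopologicalSpace (Arr (Boundary C u)) :=
  TopologicalSpace.induced (fun g => germOf g.hom) inferInstance

section GroupoidAlgebra

variable {X : Type} [Groupoid.{0} X]

/-- The unit of the groupoid at the point `x`. -/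
def unitArr (x : X) : Arr X := ⟨x, x, 𝟙 x⟩

/-- Convolution: `(f ⋆ g)(γ) = ∑ f(a) g(a⁻¹γ)`, the sum over all arrows `a` with the same range
as `γ`. -/
def convolution (f g : Arr X → ℂ) (γ : Arr X) : ℂ :=
  ∑' a : (Σ z : X, (γ.r ⟶ z)), f ⟨γ.r, a.1, a.2⟩ * g ⟨a.1, γ.s, Groupoid.inv a.2 ≫ γ.hom⟩

/-- Involution: `f*(γ)` is the complex conjugate of `f(γ⁻¹)`. -/
def involution (f : Arr X → ℂ) (γ : Arr X) : ℂ :=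
  starRingEnd ℂ (f ⟨γ.s, γ.r, Groupoid.inv γ.hom⟩)

/-- The `I`-norm of a function on an étale groupoid. -/
def iNorm (f : Arr X → ℂ) : ℝ :=
  max (⨆ x : X, ∑' a : (Σ z : X, (x ⟶ z)), ‖f ⟨x, a.1, a.2⟩‖)
    (⨆ x : X, ∑' a : (Σ z : X, (z ⟶ x)), ‖f ⟨a.1, x, a.2⟩‖)

variable (X) [TopologicalSpace (Arr X)]

/-- A `*`-representation of the convolution algebra `C_c(G)` of a (locally compact, Hausdorff,
étale) groupoid on a Hilbert space, bounded by the `I`-norm. (For such a groupoid `C_c(G)` is closed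
under convolution and involution.) -/
structure BoundedRep : Type 1 where
  H : Type
  [normed : NormedAddCommGroup H]
  [inner : InnerProductSpace ℂ H]
  [complete : CompleteSpace H]
  toLin : C_c(Arr X, ℂ) →ₗ[ℂ] (H →L[ℂ] H)
  map_convolution : ∀ f g h : C_c(Arr X, ℂ), (⇑h = convolution f g) →
    toLin h = toLin f * toLin g
  map_involution : ∀ f h : C_c(Arr X, ℂ), (⇑h = involution f) → toLin h = star (toLin f)
  norm_le : ∀ f : C_c(Arr X, ℂ), ‖toLin f‖ ≤ iNorm f

attribute [instance] BoundedRep.normed BoundedRep.inner BoundedRep.complete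

/-- The C*-algebra of all bounded families of operators indexed by the representations, with the
pointwise operations and the supremum norm. -/
def RepProduct : Type 1 := lp (fun π : BoundedRep X => (π.H →L[ℂ] π.H)) ∞

instance : NonUnitalCStarAlgebra (RepProduct X) :=
  inferInstanceAs (NonUnitalCStarAlgebra (lp (fun π : BoundedRep X => (π.H →L[ℂ] π.H)) ∞))

variable {X}

/-- The universal representation `f ↦ (π(f))_π`; its norm is the full norm
`sup {‖π(f)‖ : π a representation}`. -/
def universalRep (f : C_c(Arr X, ℂ)) : RepProduct X :=
  ⟨fun π => π.toLin f, memℓp_infty ⟨iNorm f, by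
    rintro _ ⟨π, rfl⟩
    exact π.norm_le f⟩⟩

variable (X)

/-- The closed *-subalgebra generated by the image of `C_c(G)` under the universal
representation. -/
def fullCStarSubalgebra : NonUnitalStarSubalgebra ℂ (RepProduct X) :=
  (NonUnitalStarAlgebra.adjoin ℂ (Set.range (universalRep (X := X)))).topologicalClosure

/-- The full groupoid C*-algebra `C*(G)`. -/
def FullCStar : Type 1 := fullCStarSubalgebra X

instance : NonUnitalCStarAlgebra (FullCStar X) :=
  letI : IsClosed ((fullCStarSubalgebra X : Set (RepProduct X))) :=
    NonUnitalStarSubalgebra.isClosed_topologicalClosure _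
  NonUnitalStarSubalgebra.nonUnitalCStarAlgebra (fullCStarSubalgebra X)

variable {X}

/-- The canonical map `C_c(G) → C*(G)`. -/
def toFullCStar (f : C_c(Arr X, ℂ)) : FullCStar X :=
  ⟨universalRep f, NonUnitalStarSubalgebra.le_topologicalClosure _
    (NonUnitalStarAlgebra.subset_adjoin ℂ _ ⟨f, rfl⟩)⟩

/-- A measure on the unit space is invariant if `μ(s(E)) = μ(r(E))` for every open bisection `E`. -/
def IsInvariant [MeasurableSpace X] (m : Measure X) : Prop :=
  ∀ E : Set (Arr X), IsOpen E → E.InjOn Arr.r → E.InjOn Arr.s →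
    m (Arr.s '' E) = m (Arr.r '' E)

end GroupoidAlgebra

/-- The set of units with nontrivial isotropy. -/
def nontrivialIsotropy (X : Type) [Groupoid.{0} X] : Set X := {x | ∃ g : x ⟶ x, g ≠ 𝟙 x}

/-- The orbit of a unit. -/
def groupoidOrbit {X : Type} [Groupoid.{0} X] (x : X) : Set X := {y | Nonempty (x ⟶ y)}

/-- A tracial state: a positive linear functional of norm one with `τ(ab) = τ(ba)`. -/
structure IsTracialState {A : Type*} [NonUnitalCStarAlgebra A] (τ : A →L[ℂ] ℂ) : Prop where
  nonneg : ∀ a : A, 0 ≤ τ (star a * a)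
  norm_eq_one : ‖τ‖ = 1
  tracial : ∀ a b : A, τ (a * b) = τ (b * a)

/-! ## The category of paths `Λ`

Vertices and edges are numbered from `0`: the vertex `i` is `v_{i+1}`, the edges from `i + 1` to `i`
are `α_{i+1}`, `β_{i+1}` and `γ_{i+1}^{(j+1)}` for `j < k i`, and `k i` is `k_{i+1}`. -/

/-- The types of edges. -/
inductive Letter
  | α : Letter
  | β : Letter
  | γ (j : ℕ) : Letter

/-- The relation `αβ = βα`. -/
inductive LetterRel : FreeMonoid Letter → FreeMonoid Letter → Prop
  | comm : LetterRel (FreeMonoid.of Letter.α * FreeMonoid.of Letter.β)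
      (FreeMonoid.of Letter.β * FreeMonoid.of Letter.α)

/-- Words modulo the congruence generated by `αβ = βα`. -/
abbrev WordMonoid : Type := PresentedMonoid LetterRel

/-- The class of a word. -/
def wordClass (l : List Letter) : WordMonoid := PresentedMonoid.mk LetterRel (FreeMonoid.ofList l)

/-- A word is a path of edges starting at the vertex `i` if its letter `γ j` in position `p`
satisfies `j < k (i + p)`. -/
def ValidWord (k : ℕ → ℕ) (i : ℕ) (l : List Letter) : Prop :=
  ∀ (p j : ℕ), l[p]? = some (Letter.γ j) → j < k (i + p)

/-- The vertices of `Λ`. -/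
structure Vertex (k : ℕ → ℕ) where
  index : ℕ

theorem wordClass_append (l l' : List Letter) :
    wordClass (l ++ l') = wordClass l * wordClass l' := by
  simp [wordClass, FreeMonoid.ofList_append]

theorem wordClass_nil : wordClass [] = 1 := by
  simp [wordClass]

theorem wordClass_cons (a : Letter) (l : List Letter) :
    wordClass (a :: l) = PresentedMonoid.of LetterRel a * wordClass l := by
  rw [show a :: l = [a] ++ l from rfl, wordClass_append]
  rfl

theorem exists_wordClass (m : WordMonoid) : ∃ l, wordClass l = m := by
  obtain ⟨w, rfl⟩ := PresentedMonoid.surjective_mk m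
  exact ⟨w.toList, by simp [wordClass]⟩

/-- The category `Λ`, the amalgamation of the `2`-graph with edges `αᵢ`, `βᵢ` and commuting squares
`αᵢβᵢ₊₁ = βᵢαᵢ₊₁` and the `1`-graph with edges `γᵢ^{(j)}`: the paths with range `u` and source `v`
are the classes of words that are paths of edges from `v` to `u`. -/
instance (k : ℕ → ℕ) : SmallCategory (Vertex k) where
  Hom u v := {m : WordMonoid // ∃ l : List Letter,
    ValidWord k u.index l ∧ u.index + l.length = v.index ∧ wordClass l = m}
  id u := ⟨1, [], by simp [ValidWord], by simp, wordClass_nil⟩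
  comp {u v w} a b := ⟨a.1 * b.1, by
    obtain ⟨_, l, h1, h2, rfl⟩ := a
    obtain ⟨_, l', h1', h2', rfl⟩ := b
    refine ⟨l ++ l', ?_, ?_, wordClass_append l l'⟩
    · intro p j h
      rcases lt_or_ge p l.length with hp | hp
      · rw [List.getElem?_append_left hp] at h
        exact h1 p j h
      · rw [List.getElem?_append_right hp] at h
        have := h1' _ j h
        rwa [← h2, add_assoc, Nat.add_sub_cancel' hp] at this
    · rw [List.length_append, ← add_assoc, h2, h2']⟩
  id_comp a := Subtype.ext (one_mul _)
  comp_id a := Subtype.ext (mul_one _)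
  assoc a b c := Subtype.ext (mul_assoc _ _ _)

/-- The length of (the class of) a word. -/
def wordLength : WordMonoid →* Multiplicative ℕ :=
  PresentedMonoid.lift (fun _ => Multiplicative.ofAdd 1) (by rintro _ _ ⟨⟩; rfl)

theorem wordLength_wordClass (l : List Letter) :
    wordLength (wordClass l) = Multiplicative.ofAdd l.length := by
  induction l with
  | nil => rw [wordClass_nil, map_one]; rfl
  | cons a l ih =>
    rw [wordClass_cons, map_mul, ih, wordLength, PresentedMonoid.lift_of, List.length_cons,
      add_comm, ofAdd_add]

/-- Normal forms `α^a β^b γ_{j₁} α^{a₁} β^{b₁} γ_{j₂} ⋯`. -/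
abbrev NormalForm : Type := (ℕ × ℕ) × List (ℕ × (ℕ × ℕ))

/-- Left multiplication of a normal form by a letter. -/
def letterAct : Letter → Function.End NormalForm
  | Letter.α => fun n => ((n.1.1 + 1, n.1.2), n.2)
  | Letter.β => fun n => ((n.1.1, n.1.2 + 1), n.2)
  | Letter.γ j => fun n => ((0, 0), (j, n.1) :: n.2)

/-- The action of words on normal forms. -/
def wordAct : WordMonoid →* Function.End NormalForm :=
  PresentedMonoid.lift letterAct (by rintro _ _ ⟨⟩; rfl)

theorem letterAct_injective (a : Letter) : Function.Injective (letterAct a) := by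
  rintro ⟨⟨a1, b1⟩, L⟩ ⟨⟨a2, b2⟩, L'⟩ h
  cases a <;> simp_all [letterAct]

theorem wordAct_injective (m : WordMonoid) : Function.Injective (wordAct m) := by
  obtain ⟨l, rfl⟩ := exists_wordClass m
  induction l with
  | nil => rw [wordClass_nil, map_one]; exact Function.injective_id
  | cons a l ih =>
    rw [wordClass_cons, map_mul, wordAct, PresentedMonoid.lift_of]
    exact (letterAct_injective a).comp ih

/-- The element given by a normal form. -/
def ofNormalForm (n : NormalForm) : WordMonoid :=
  PresentedMonoid.of LetterRel Letter.α ^ n.1.1 * PresentedMonoid.of LetterRel Letter.β ^ n.1.2 *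
    (n.2.map fun t => PresentedMonoid.of LetterRel (Letter.γ t.1) *
      (PresentedMonoid.of LetterRel Letter.α ^ t.2.1 *
        PresentedMonoid.of LetterRel Letter.β ^ t.2.2)).prod

theorem letter_commute : Commute (PresentedMonoid.of LetterRel Letter.α)
    (PresentedMonoid.of LetterRel Letter.β) :=
  Quotient.sound (ConGen.Rel.of _ _ LetterRel.comm)

theorem ofNormalForm_letterAct (a : Letter) (n : NormalForm) :
    ofNormalForm (letterAct a n) = PresentedMonoid.of LetterRel a * ofNormalForm n := by
  cases a with
  | α => simp [ofNormalForm, letterAct, pow_succ', mul_assoc]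
  | β =>
    simp only [ofNormalForm, letterAct, pow_succ', ← mul_assoc]
    rw [(letter_commute.symm.pow_right n.1.1).eq]
  | γ j => simp [ofNormalForm, letterAct, mul_assoc]

theorem ofNormalForm_wordAct (m : WordMonoid) (n : NormalForm) :
    ofNormalForm (wordAct m n) = m * ofNormalForm n := by
  obtain ⟨l, rfl⟩ := exists_wordClass m
  induction l with
  | nil => rw [wordClass_nil, map_one, one_mul]; rfl
  | cons a l ih =>
    rw [wordClass_cons, map_mul, mul_assoc, ← ih, ← ofNormalForm_letterAct]
    rfl

theorem wordMonoid_left_cancel (m p q : WordMonoid) (h : m * p = m * q) : p = q := by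
  have key : ∀ m : WordMonoid, ofNormalForm (wordAct m ((0, 0), [])) = m := by
    intro m
    rw [ofNormalForm_wordAct]
    simp [ofNormalForm]
  have h1 : wordAct (m * p) ((0, 0), []) = wordAct (m * q) ((0, 0), []) := by rw [h]
  rw [map_mul, map_mul] at h1
  have h2 := wordAct_injective m h1
  rw [← key p, ← key q, h2]

/-- Reversal of words. -/
def wordReverse : WordMonoid →* WordMonoidᵐᵒᵖ :=
  PresentedMonoid.lift (fun a => MulOpposite.op (PresentedMonoid.of LetterRel a)) (by
    rintro _ _ ⟨⟩
    simp only [map_mul, FreeMonoid.lift_eval_of, ← MulOpposite.op_mul]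
    rw [letter_commute.eq])

theorem wordReverse_wordReverse (m : WordMonoid) :
    (wordReverse (wordReverse m).unop).unop = m := by
  obtain ⟨l, rfl⟩ := exists_wordClass m
  induction l with
  | nil => simp [wordClass_nil]
  | cons a l ih =>
    rw [wordClass_cons, map_mul, MulOpposite.unop_mul, map_mul, MulOpposite.unop_mul, ih]
    rfl

theorem wordMonoid_right_cancel (p q m : WordMonoid) (h : p * m = q * m) : p = q := by
  have h1 := congrArg (fun t => (wordReverse t).unop) h
  simp only [map_mul, MulOpposite.unop_mul] at h1
  rw [← wordReverse_wordReverse p, ← wordReverse_wordReverse q, wordMonoid_left_cancel _ _ _ h1]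

instance (k : ℕ → ℕ) : CategoryOfPaths (Vertex k) where
  left_cancel μ ν ν' h := Subtype.ext (wordMonoid_left_cancel _ _ _ (congrArg Subtype.val h))
  right_cancel μ μ' ν h := Subtype.ext (wordMonoid_right_cancel _ _ _ (congrArg Subtype.val h))
  no_inverse := by
    rintro ⟨i⟩ ⟨j⟩ ⟨_, l, h1, h2, rfl⟩ ⟨_, l', h1', h2', rfl⟩ _ _
    simp only at h2 h2'
    have hl : l = [] := List.eq_nil_of_length_eq_zero (by omega)
    subst hl
    obtain rfl : i = j := by simpa using h2
    exact ⟨rfl, Subtype.ext wordClass_nil⟩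

/-- The unit space `X = v₁∂Λ` of the groupoid `G = G(Λ)|_X`. -/
abbrev UnitSpace (k : ℕ → ℕ) : Type := Boundary (Vertex k) ⟨0⟩

end PathGroupoid

end

open PathGroupoid

/-!
The argument describes both the invariant measures and the tracial states by the numbers `q n`
which they assign to the cylinder sets `Z(μ)` of the paths `μ` of length `n`.

**The recursion.** A point of the boundary which begins with `μ` also begins with `μα`, with `μβ` or
with exactly one of the paths `μγ`, and it begins with both `μα` and `μβ` if and only if it begins
with `μαβ = μβα` (`matUnit_self_eq`). Hence, whenever the value at `Z(μ)` depends only on the length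
of `μ`, these values satisfy `q n + q (n + 2) = (2 + k n) q (n + 1)` (`isWeight_of_linear`). A
solution with `q 0 = 0` has convex absolute values, so it grows linearly unless it vanishes; a
bounded solution is therefore a multiple of any other bounded one (`IsWeight.eq_mul`). Since
`k n` is positive infinitely often, an antitone nonnegative solution tends to zero
(`tendsto_zero_of_recursion`).

**Existence.** For each `w` with `k w > 0` consider the points `λγα^∞β^∞`, where `λ` runs over all
paths from `w` to `v₁`. The unit arrows at these points give vector states of the regular
representations (`unitState`), so functionals on the full C*-algebra. As an edge `γ` separates what
precedes it from what follows it, `λγα^∞β^∞` begins with a path `μ` not longer than `λ` exactly if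
`μ` is a prefix of `λ`, and by left cancellation the number of such `λ` depends only on the length
of `μ`. A limit of the averages of these states along an ultrafilter is a state (`limitTrace`) which
vanishes on the off-diagonal matrix units `e(μ, ν)` and whose value at `e(μ, μ)` depends only on the
length of `μ`. As the matrix units span a dense subspace (`dense_span_matElt`), this suffices for it
to be a trace (`map_mul_comm_of_diagonal`). The Riesz–Markov–Kakutani theorem represents its
restriction to the functions on the unit space by a measure (`limitTrace_toFullCStar`), which is
invariant as every open bisection is a disjoint union of countably many sets `[μ, ν, F]`
(`isInvariant_of_bdCylinder`).

**Uniqueness.** An invariant measure gives the same mass to `Z(μ)` and `Z(ν)` if `μ` and `ν` have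
the same length, so the recursion determines it on the cylinder sets, which form a π-system
generating the Borel sets (`eq_traceMeasure`). In the same way a tracial state is determined on the
elements `e(μ, μ)`. If `μ ≠ ν`, then `τ(e(μ, ν)) = τ(e(ν, ν) e(μ, ν))`, which is zero or equal to
`τ(e(νη, νη'))` for the least common extension `νη = μη'`, with `η ≠ η'` of positive length.
Iterating, the value is attained on matrix units of arbitrarily long paths; by the Cauchy–Schwarz
inequality it is bounded by the weights `q n`, which tend to zero, so it vanishes
(`IsTracialState.matElt_of_ne`).

**Isotropy.** If `μz = νz` with `μ ≠ ν`, then `z` contains no path with an edge `γ`, as paths of the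
same length which end in `γ` and have a common extension are equal; and if the number of edges `α`
or `β` in the paths in `z` were bounded, then cancellation would give `μ = ν`. So `z = α^∞β^∞`
(`eq_gammaFree_of_extend_eq`), and conversely `[α, β, α^∞β^∞]` is nontrivial isotropy at `α^∞β^∞`.
The points with nontrivial isotropy thus form the orbit of `α^∞β^∞`; it is countable, and it is null
because each point lies in cylinder sets of arbitrarily small measure.
-/


noncomputable section

namespace PathGroupoid

section

/-! ### Divisibility in the monoid of words -/

/-- The class of a one-letter word. -/
abbrev letter (a : Letter) : WordMonoid := PresentedMonoid.of LetterRel a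

theorem wordMonoid_induction {P : WordMonoid → Prop} (one : P 1)
    (mul : ∀ a m, P m → P (letter a * m)) (m : WordMonoid) : P m := by
  obtain ⟨l, rfl⟩ := exists_wordClass m
  induction l with
  | nil => rwa [wordClass_nil]
  | cons a l ih => rw [wordClass_cons]; exact mul a _ ih

/-- The normal form of an element. -/
def normalForm (m : WordMonoid) : NormalForm := wordAct m ((0, 0), [])

theorem normalForm_letter_mul (a : Letter) (m : WordMonoid) :
    normalForm (letter a * m) = letterAct a (normalForm m) := by
  rw [normalForm, map_mul, wordAct, PresentedMonoid.lift_of]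
  rfl

theorem ofNormalForm_normalForm (m : WordMonoid) : ofNormalForm (normalForm m) = m := by
  rw [normalForm, ofNormalForm_wordAct]
  simp [ofNormalForm]

theorem eq_letter_mul {m : WordMonoid} {a : Letter} {n : NormalForm}
    (h : normalForm m = letterAct a n) : m = letter a * ofNormalForm n := by
  rw [← ofNormalForm_normalForm m, h, ofNormalForm_letterAct]

theorem letter_swap (m : WordMonoid) :
    letter .β * (letter .α * m) = letter .α * (letter .β * m) := by
  rw [← mul_assoc, ← mul_assoc, letter_commute.eq]

/-- Two distinct letters with a common right multiple are `α` and `β`, and every common multiple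
is a multiple of their product. -/
theorem letter_mul_eq_letter_mul {a b : Letter} (hab : a ≠ b) {x y : WordMonoid}
    (h : letter a * x = letter b * y) :
    ((a = .α ∧ b = .β) ∨ (a = .β ∧ b = .α)) ∧ ∃ z, x = letter b * z ∧ y = letter a * z := by
  have h' := congrArg normalForm h
  rw [normalForm_letter_mul, normalForm_letter_mul] at h'
  rcases hx : normalForm x with ⟨⟨p, q⟩, L⟩
  rcases hy : normalForm y with ⟨⟨p', q'⟩, L'⟩
  rw [hx, hy] at h'
  cases a <;> cases b <;> simp [letterAct] at h' hab
  · obtain ⟨⟨h1, h2⟩, rfl⟩ := h'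
    subst h1 h2
    exact ⟨Or.inl ⟨rfl, rfl⟩, ofNormalForm ((p, q'), L), eq_letter_mul (by rw [hx]; rfl),
      eq_letter_mul (by rw [hy]; rfl)⟩
  · obtain ⟨⟨h1, h2⟩, rfl⟩ := h'
    subst h1 h2
    exact ⟨Or.inr ⟨rfl, rfl⟩, ofNormalForm ((p', q), L), eq_letter_mul (by rw [hx]; rfl),
      eq_letter_mul (by rw [hy]; rfl)⟩
  · exact absurd h'.1 (fun h => hab h.1)

theorem swap_of_ne {a b : Letter} (h : (a = .α ∧ b = .β) ∨ (a = .β ∧ b = .α)) (m : WordMonoid) :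
    letter a * (letter b * m) = letter b * (letter a * m) := by
  rcases h with ⟨rfl, rfl⟩ | ⟨rfl, rfl⟩
  · exact (letter_swap m).symm
  · exact letter_swap m

/-- `l` is a least common right multiple of `m` and `n`. -/
structure IsLcm (m n l : WordMonoid) : Prop where
  left : m ∣ l
  right : n ∣ l
  least : ∀ c, m ∣ c → n ∣ c → l ∣ c

theorem exists_isLcm_letter (a : Letter) (n : WordMonoid) :
    ∀ c, letter a ∣ c → n ∣ c → ∃ l, IsLcm (letter a) n l := by
  induction n using wordMonoid_induction with
  | one => exact fun _ _ _ => ⟨letter a, dvd_rfl, one_dvd _, fun _ h _ => h⟩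
  | mul b n ih =>
    rintro c ⟨p, rfl⟩ ⟨q, hq⟩
    by_cases hab : a = b
    · subst hab
      exact ⟨letter a * n, Dvd.intro _ rfl, dvd_rfl, fun _ _ h => h⟩
    · rw [mul_assoc] at hq
      obtain ⟨hs, z, -, hz⟩ := letter_mul_eq_letter_mul hab hq
      obtain ⟨l, ⟨s, hl1⟩, hl2, hl3⟩ := ih (n * q) ⟨z, hz⟩ ⟨q, rfl⟩
      refine ⟨letter b * l, ?_, mul_dvd_mul_left _ hl2, ?_⟩
      · rw [hl1, ← swap_of_ne hs]
        exact Dvd.intro _ rfl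
      · rintro _ ⟨p', rfl⟩ ⟨q', hq'⟩
        rw [mul_assoc] at hq'
        obtain ⟨-, z', -, hz'⟩ := letter_mul_eq_letter_mul hab hq'
        rw [hq']
        exact mul_dvd_mul_left _ (hl3 _ ⟨z', hz'⟩ ⟨q', rfl⟩)

theorem exists_isLcm (m : WordMonoid) :
    ∀ n c, m ∣ c → n ∣ c → ∃ l, IsLcm m n l := by
  induction m using wordMonoid_induction with
  | one => exact fun n _ _ _ => ⟨n, one_dvd _, dvd_rfl, fun _ _ h => h⟩
  | mul a m ih =>
    intro n c hm hn
    obtain ⟨_, ⟨n', rfl⟩, h2, h3⟩ := exists_isLcm_letter a n c (dvd_of_mul_right_dvd hm) hn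
    have cancel : ∀ c, letter a * m ∣ c → n ∣ c → ∃ c', c = letter a * c' ∧ m ∣ c' ∧ n' ∣ c' := by
      rintro _ ⟨q, rfl⟩ h
      obtain ⟨s, hs⟩ := h3 _ (Dvd.intro (m * q) (mul_assoc _ _ _).symm) h
      rw [mul_assoc, mul_assoc] at hs
      exact ⟨m * q, mul_assoc _ _ _, Dvd.intro _ rfl, s, wordMonoid_left_cancel _ _ _ hs⟩
    obtain ⟨c', -, k1, k2⟩ := cancel c hm hn
    obtain ⟨l, j1, j2, j3⟩ := ih n' c' k1 k2
    refine ⟨letter a * l, mul_dvd_mul_left _ j1, h2.trans (mul_dvd_mul_left _ j2), ?_⟩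
    intro d hd hd'
    obtain ⟨d', rfl, e1, e2⟩ := cancel d hd hd'
    exact mul_dvd_mul_left _ (j3 _ e1 e2)

theorem letter_dvd_mul_gamma {a : Letter} {j : ℕ} {r : WordMonoid} (l : WordMonoid) :
    letter a ∣ l * (letter (.γ j) * r) → letter a ∣ l ∨ (l = 1 ∧ a = .γ j) := by
  induction l using wordMonoid_induction with
  | one =>
    rintro ⟨p, hp⟩
    right
    refine ⟨rfl, ?_⟩
    by_contra hne
    rw [one_mul] at hp
    rcases (letter_mul_eq_letter_mul hne hp.symm).1 with h | h <;> simp at h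
  | mul b l ih =>
    rintro ⟨p, hp⟩
    left
    by_cases hab : a = b
    · subst hab
      exact Dvd.intro _ rfl
    · rw [mul_assoc] at hp
      obtain ⟨hs, z, -, hz⟩ := letter_mul_eq_letter_mul hab hp.symm
      rcases ih ⟨z, hz⟩ with ⟨s, rfl⟩ | ⟨-, rfl⟩
      · rw [← swap_of_ne hs]
        exact Dvd.intro _ rfl
      · simp at hs

/-- The letter `γ j` separates what precedes it from what follows it. -/
theorem dvd_mul_gamma {j : ℕ} {r : WordMonoid} (m : WordMonoid) :
    ∀ l, m ∣ l * (letter (.γ j) * r) → m ∣ l ∨ l * letter (.γ j) ∣ m := by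
  induction m using wordMonoid_induction with
  | one => exact fun _ _ => Or.inl (one_dvd _)
  | mul a m ih =>
    intro l h
    rcases letter_dvd_mul_gamma l (dvd_of_mul_right_dvd h) with ⟨s, rfl⟩ | ⟨rfl, rfl⟩
    · obtain ⟨q, hq⟩ := h
      rw [mul_assoc, mul_assoc] at hq
      rcases ih s ⟨q, wordMonoid_left_cancel _ _ _ hq⟩ with h | h
      · exact Or.inl (mul_dvd_mul_left _ h)
      · right
        rw [mul_assoc]
        exact mul_dvd_mul_left _ h
    · right
      rw [one_mul]
      exact Dvd.intro _ rfl

/-- The sum of the weights of the letters of an element, where the letter `a` has weight `c a`. It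
does not change under `αβ = βα`. -/
def weight (c : Letter → ℕ) (m : WordMonoid) : ℕ :=
  (PresentedMonoid.lift (rels := LetterRel) (fun a => Multiplicative.ofAdd (c a))
    (by rintro _ _ ⟨⟩; simp [mul_comm]) m).toAdd

@[simp] theorem weight_one (c : Letter → ℕ) : weight c 1 = 0 := by
  simp [weight]

@[simp] theorem weight_mul (c : Letter → ℕ) (m n : WordMonoid) :
    weight c (m * n) = weight c m + weight c n := by
  simp [weight]

@[simp] theorem weight_letter (c : Letter → ℕ) (a : Letter) : weight c (letter a) = c a := by
  rw [weight, PresentedMonoid.lift_of]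
  rfl

/-- The number of letters of an element. -/
def len (m : WordMonoid) : ℕ := weight (fun _ => 1) m

@[simp] theorem len_one : len 1 = 0 := weight_one _

@[simp] theorem len_mul (m n : WordMonoid) : len (m * n) = len m + len n := weight_mul _ _ _

@[simp] theorem len_letter (a : Letter) : len (letter a) = 1 := weight_letter _ _

/-- The number of occurrences of `α`. -/
abbrev countα (m : WordMonoid) : ℕ :=
  weight (fun a => match a with | .α => 1 | _ => 0) m

/-- The number of occurrences of `β`. -/
abbrev countβ (m : WordMonoid) : ℕ :=
  weight (fun a => match a with | .β => 1 | _ => 0) m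

/-- The number of occurrences of the letters `γ j`. -/
abbrev countγ (m : WordMonoid) : ℕ :=
  weight (fun a => match a with | .γ _ => 1 | _ => 0) m

theorem len_wordClass (l : List Letter) : len (wordClass l) = l.length := by
  induction l with
  | nil => simp [wordClass_nil]
  | cons a l ih => rw [wordClass_cons, len_mul, ih, len_letter, List.length_cons, add_comm]

theorem eq_one_of_len {m : WordMonoid} (h : len m = 0) : m = 1 := by
  induction m using wordMonoid_induction with
  | one => rfl
  | mul a m _ => simp at h

theorem weight_dvd (c : Letter → ℕ) {m n : WordMonoid} (h : m ∣ n) : weight c m ≤ weight c n := by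
  obtain ⟨q, rfl⟩ := h
  simp

theorem eq_of_dvd_of_len {m n : WordMonoid} (h : m ∣ n) (h' : len n ≤ len m) : m = n := by
  obtain ⟨q, rfl⟩ := h
  rw [len_mul] at h'
  rw [eq_one_of_len (m := q) (by omega), mul_one]

/-- An element without letters `γ j` is determined by its numbers of letters `α` and `β`. -/
theorem eq_pow_mul_pow {m : WordMonoid} (h : countγ m = 0) :
    m = letter .α ^ countα m * letter .β ^ countβ m := by
  induction m using wordMonoid_induction with
  | one => simp
  | mul a m ih =>
    cases a with
    | α =>
      simp only [weight_mul, weight_letter, zero_add] at h ⊢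
      nth_rw 1 [ih h]
      rw [pow_add, pow_one, mul_assoc]
    | β =>
      simp only [weight_mul, weight_letter, zero_add] at h ⊢
      nth_rw 1 [ih h]
      rw [pow_add, pow_one, ← mul_assoc, ← mul_assoc, (letter_commute.symm.pow_right _).eq]
    | γ j => simp at h

theorem weight_pow (c : Letter → ℕ) (m : WordMonoid) (n : ℕ) :
    weight c (m ^ n) = n * weight c m := by
  induction n with
  | zero => simp
  | succ n ih => rw [pow_succ, weight_mul, ih]; ring

theorem exists_letter_mul {m : WordMonoid} (h : m ≠ 1) : ∃ a n, m = letter a * n := by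
  induction m using wordMonoid_induction with
  | one => exact absurd rfl h
  | mul a m _ => exact ⟨a, m, rfl⟩

theorem exists_mul_of_le_len (m : WordMonoid) :
    ∀ n ≤ len m, ∃ p q, m = p * q ∧ len p = n := by
  induction m using wordMonoid_induction with
  | one => exact fun n hn => ⟨1, 1, by simp, by simp at hn ⊢; omega⟩
  | mul a m ih =>
    intro n hn
    rcases n with - | n
    · exact ⟨1, letter a * m, by simp, by simp⟩
    · rw [len_mul, len_letter] at hn
      obtain ⟨p, q, rfl, h⟩ := ih n (by omega)
      exact ⟨letter a * p, q, (mul_assoc _ _ _).symm, by simp [h, add_comm]⟩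

/-! ### Valid words and the paths of `Λ` -/

/-- The letter is an edge with range the vertex `i`. -/
def ValidLetter (k : ℕ → ℕ) (i : ℕ) : Letter → Prop
  | .γ j => j < k i
  | _ => True

/-- The action of letters on predicates of vertices. -/
def validLetterAct (k : ℕ → ℕ) (a : Letter) : Function.End (ℕ → Prop) :=
  fun P i => ValidLetter k i a ∧ P (i + 1)

/-- The action of words on predicates of vertices, which is well defined on classes of words:
the result holds at `i` if the word is a path starting at `i` and the predicate holds at its end. -/
def validAct (k : ℕ → ℕ) : WordMonoid →* Function.End (ℕ → Prop) :=
  PresentedMonoid.lift (validLetterAct k) (by rintro _ _ ⟨⟩; rfl)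

/-- The element `m` is a path of edges starting at the vertex `i`. -/
def Valid (k : ℕ → ℕ) (i : ℕ) (m : WordMonoid) : Prop := validAct k m (fun _ => True) i

variable {k : ℕ → ℕ}

theorem validAct_letter_mul (a : Letter) (m : WordMonoid) (P : ℕ → Prop) (i : ℕ) :
    validAct k (letter a * m) P i ↔ ValidLetter k i a ∧ validAct k m P (i + 1) := by
  rw [map_mul, validAct, PresentedMonoid.lift_of]
  rfl

theorem valid_one (i : ℕ) : Valid k i 1 := by
  rw [Valid, map_one]
  trivial

theorem valid_letter_mul {a : Letter} {m : WordMonoid} {i : ℕ} :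
    Valid k i (letter a * m) ↔ ValidLetter k i a ∧ Valid k (i + 1) m :=
  validAct_letter_mul _ _ _ _

theorem valid_letter {a : Letter} {i : ℕ} : Valid k i (letter a) ↔ ValidLetter k i a := by
  rw [← mul_one (letter a), valid_letter_mul]
  simp [valid_one]

theorem valid_mul (m : WordMonoid) {n : WordMonoid} : ∀ {i : ℕ},
    Valid k i (m * n) ↔ Valid k i m ∧ Valid k (i + len m) n := by
  induction m using wordMonoid_induction with
  | one => simp [valid_one]
  | mul a m ih =>
    intro i
    rw [mul_assoc, valid_letter_mul, ih, valid_letter_mul, and_assoc, len_mul, len_letter,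
      add_assoc]

theorem validWord_iff (l : List Letter) : ∀ i, ValidWord k i l ↔ Valid k i (wordClass l) := by
  induction l with
  | nil => intro i; simp [wordClass_nil, valid_one, ValidWord]
  | cons a l ih =>
    intro i
    rw [wordClass_cons, valid_letter_mul, ← ih]
    constructor
    · intro h
      refine ⟨?_, fun p j hp => ?_⟩
      · cases a with
        | γ j => exact h 0 j (by simp)
        | _ => trivial
      · have := h (p + 1) j (by simpa using hp)
        rwa [add_assoc, add_comm 1 p]
    · rintro ⟨h1, h2⟩ p j hp
      rcases p with - | p
      · simp only [List.length_cons, Nat.zero_lt_succ, getElem?_pos, List.getElem_cons_zero,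
          Option.some.injEq] at hp
        subst hp
        exact h1
      · have := h2 p j (by simpa using hp)
        rwa [add_assoc, add_comm 1 p] at this

/-- The path with range `u` and source `v` given by a valid element. -/
def homMk {u v : Vertex k} (m : WordMonoid) (h : Valid k u.index m)
    (h' : u.index + len m = v.index) : u ⟶ v :=
  ⟨m, by
    obtain ⟨l, rfl⟩ := exists_wordClass m
    exact ⟨l, (validWord_iff l _).2 h, by rwa [len_wordClass] at h', rfl⟩⟩

theorem hom_valid {u v : Vertex k} (μ : u ⟶ v) : Valid k u.index μ.1 := by
  obtain ⟨_, l, h1, h2, rfl⟩ := μ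
  exact (validWord_iff l _).1 h1

theorem hom_len {u v : Vertex k} (μ : u ⟶ v) : u.index + len μ.1 = v.index := by
  obtain ⟨_, l, h1, h2, rfl⟩ := μ
  rwa [len_wordClass]

theorem hom_ext {u v : Vertex k} {μ ν : u ⟶ v} (h : μ.1 = ν.1) : μ = ν := Subtype.ext h

@[simp] theorem comp_val {u v w : Vertex k} (μ : u ⟶ v) (ν : v ⟶ w) :
    (μ ≫ ν).1 = μ.1 * ν.1 := rfl

@[simp] theorem id_val (u : Vertex k) : (𝟙 u : u ⟶ u).1 = 1 := rfl

@[simp] theorem homMk_val {u v : Vertex k} (m : WordMonoid) (h : Valid k u.index m)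
    (h' : u.index + len m = v.index) : (homMk m h h' : u ⟶ v).1 = m := rfl

/-- The element of the monoid of words underlying a path. -/
def val {u : Vertex k} (p : PathsFrom (Vertex k) u) : WordMonoid := p.2.1

theorem val_injective {u : Vertex k} : Function.Injective (val : PathsFrom (Vertex k) u → _) := by
  rintro ⟨⟨i⟩, μ⟩ ⟨⟨j⟩, ν⟩ h
  have h1 := hom_len μ
  have h2 := hom_len ν
  change μ.1 = ν.1 at h
  rw [h, h2] at h1
  obtain rfl : j = i := h1
  exact Sigma.ext rfl (heq_of_eq (hom_ext h))

theorem val_len {u : Vertex k} (p : PathsFrom (Vertex k) u) :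
    u.index + len (val p) = p.1.index := hom_len p.2

theorem val_valid {u : Vertex k} (p : PathsFrom (Vertex k) u) : Valid k u.index (val p) :=
  hom_valid p.2

@[simp] theorem val_mk {u v : Vertex k} (μ : u ⟶ v) :
    val (⟨v, μ⟩ : PathsFrom (Vertex k) u) = μ.1 := rfl

@[simp] theorem val_prepend {u v : Vertex k} (μ : u ⟶ v) (p : PathsFrom (Vertex k) v) :
    val (prepend μ p) = μ.1 * val p := rfl

/-- The path given by a valid element. -/
def pathMk (u : Vertex k) (m : WordMonoid) (h : Valid k u.index m) : PathsFrom (Vertex k) u :=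
  ⟨⟨u.index + len m⟩, homMk m h rfl⟩

@[simp] theorem val_pathMk (u : Vertex k) (m : WordMonoid) (h : Valid k u.index m) :
    val (pathMk u m h) = m := rfl

theorem isPrefix_iff {u : Vertex k} {p q : PathsFrom (Vertex k) u} :
    IsPrefix p q ↔ val p ∣ val q := by
  constructor
  · rintro ⟨η, h⟩
    exact ⟨η.1, by rw [val, ← h]; rfl⟩
  · rintro ⟨n, h⟩
    have hv := val_valid q
    have hl := val_len q
    have hl' := val_len p
    rw [h, valid_mul] at hv
    rw [h, len_mul] at hl
    exact ⟨homMk n (by rw [← hl']; exact hv.2) (by omega), hom_ext h.symm⟩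

/-- Every divisor of a path is a path. -/
theorem exists_path_of_dvd {u : Vertex k} {m : WordMonoid} (p : PathsFrom (Vertex k) u)
    (h : m ∣ val p) : ∃ q : PathsFrom (Vertex k) u, val q = m ∧ IsPrefix q p := by
  have hv := val_valid p
  obtain ⟨n, hn⟩ := h
  rw [hn, valid_mul] at hv
  exact ⟨pathMk u m hv.1, rfl, isPrefix_iff.2 ⟨n, hn⟩⟩

/-- Two paths with a common extension have a least common extension. -/
theorem exists_least_extension {u : Vertex k} {p q r : PathsFrom (Vertex k) u}
    (hp : IsPrefix p r) (hq : IsPrefix q r) :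
    ∃ l, IsPrefix p l ∧ IsPrefix q l ∧ ∀ c, IsPrefix p c → IsPrefix q c → IsPrefix l c := by
  rw [isPrefix_iff] at hp hq
  obtain ⟨l, h1, h2, h3⟩ := exists_isLcm _ _ _ hp hq
  obtain ⟨l, rfl, -⟩ := exists_path_of_dvd r (h3 _ hp hq)
  refine ⟨l, isPrefix_iff.2 h1, isPrefix_iff.2 h2, fun c hc hc' => ?_⟩
  rw [isPrefix_iff] at *
  exact h3 _ hc hc'

instance finite_hom (u v : Vertex k) : Finite (u ⟶ v) := by
  obtain ⟨i⟩ := u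
  obtain ⟨j⟩ := v
  by_cases hij : i ≤ j
  swap
  · have : IsEmpty ((⟨i⟩ : Vertex k) ⟶ ⟨j⟩) := ⟨fun μ => by
      have := hom_len μ
      simp only at this
      omega⟩
    infer_instance
  obtain ⟨n, rfl⟩ := Nat.exists_eq_add_of_le hij
  clear hij
  suffices h : ∀ i, {m | Valid k i m ∧ len m = n}.Finite by
    have := (h i).to_subtype
    refine Finite.of_injective (fun μ : (⟨i⟩ : Vertex k) ⟶ ⟨i + n⟩ =>
      (⟨μ.1, hom_valid μ, by have := hom_len μ; simp only at this; omega⟩ :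
        {m | Valid k i m ∧ len m = n})) ?_
    intro μ ν h
    exact hom_ext (congrArg (fun t => t.1) h)
  induction n with
  | zero =>
    intro i
    refine (Set.finite_singleton 1).subset ?_
    rintro m ⟨-, hm⟩
    exact eq_one_of_len hm
  | succ n ih =>
    intro i
    have hfin : ({.α, .β} ∪ Letter.γ '' Set.Iio (k i)).Finite :=
      ((Set.finite_singleton _).insert _).union ((Set.finite_Iio _).image _)
    refine (hfin.image2 (fun a m => letter a * m) (ih (i + 1))).subset ?_
    rintro m ⟨hm, hm'⟩
    obtain ⟨a, m, rfl⟩ := exists_letter_mul (m := m) (by rintro rfl; simp at hm')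
    rw [valid_letter_mul] at hm
    refine ⟨a, ?_, m, ⟨hm.2, by rw [len_mul, len_letter] at hm'; omega⟩, rfl⟩
    cases a with
    | γ j => exact Or.inr ⟨j, hm.1, rfl⟩
    | _ => simp

instance countable_vertex : Countable (Vertex k) :=
  (Function.LeftInverse.injective (f := Vertex.index) (g := fun i => (⟨i⟩ : Vertex k))
    fun _ => rfl).countable

end

section

/-! ### The topology of the space of directed hereditary sets -/

section General

variable {C : Type} [SmallCategory C] {u v : C}

theorem id_mem (x : PathSpace C u) : (⟨u, 𝟙 u⟩ : PathsFrom C u) ∈ x.carrier := by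
  obtain ⟨p, hp⟩ := x.nonempty
  exact x.hereditary _ _ hp ⟨p.2, Category.id_comp _⟩

theorem cylinder_id : cylinder (⟨u, 𝟙 u⟩ : PathsFrom C u) = univ :=
  eq_univ_of_forall id_mem

theorem isClopen_cylinder (p : PathsFrom C u) : IsClopen (cylinder p) := by
  constructor
  · rw [← isOpen_compl_iff]
    exact TopologicalSpace.isOpen_generateFrom_of_mem
      ⟨⟨u, 𝟙 u⟩, {p}, finite_singleton _, by simp [cylinder_id, compl_eq_univ_sdiff]⟩
  · exact TopologicalSpace.isOpen_generateFrom_of_mem ⟨p, ∅, finite_empty, by simp⟩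

theorem continuous_of_isClopen_preimage {Y : Type*} [TopologicalSpace Y] {f : Y → PathSpace C u}
    (h : ∀ p, IsClopen (f ⁻¹' cylinder p)) : Continuous f := by
  refine continuous_generateFrom_iff.2 ?_
  rintro _ ⟨l, F, hF, rfl⟩
  rw [preimage_sdiff, preimage_iUnion₂]
  exact (h l).isOpen.sdiff (hF.isClosed_biUnion fun m _ => (h m).isClosed)

/-- The sets `Z(p) \ (Z(q₁) ∪ ⋯ ∪ Z(qₙ))` are a base. -/
theorem exists_basic_nhd {x : PathSpace C u} {U : Set (PathSpace C u)} (hU : IsOpen U)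
    (hx : x ∈ U) : ∃ p ∈ x.carrier, ∃ F : Set (PathsFrom C u), F.Finite ∧
      (∀ q ∈ F, q ∉ x.carrier) ∧
      ∀ y : PathSpace C u, p ∈ y.carrier → (∀ q ∈ F, q ∉ y.carrier) → y ∈ U := by
  induction hU with
  | basic s hs =>
    obtain ⟨l, F, hF, rfl⟩ := hs
    refine ⟨l, hx.1, F, hF, fun q hq h => hx.2 (mem_biUnion hq h), fun y h1 h2 => ⟨h1, ?_⟩⟩
    simp only [mem_iUnion, not_exists]
    exact h2
  | univ => exact ⟨_, id_mem x, ∅, finite_empty, by simp, fun _ _ _ => trivial⟩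
  | inter s t _ _ ih1 ih2 =>
    obtain ⟨p, hp, F, hF, h1, h2⟩ := ih1 hx.1
    obtain ⟨p', hp', F', hF', h1', h2'⟩ := ih2 hx.2
    obtain ⟨q, hq, hpq, hpq'⟩ := x.directed _ hp _ hp'
    refine ⟨q, hq, F ∪ F', hF.union hF', ?_, fun y hy hy' => ⟨?_, ?_⟩⟩
    · rintro r (hr | hr)
      · exact h1 r hr
      · exact h1' r hr
    · exact h2 y (y.hereditary _ _ hy hpq) fun r hr => hy' r (Or.inl hr)
    · exact h2' y (y.hereditary _ _ hy hpq') fun r hr => hy' r (Or.inr hr)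
  | sUnion S _ ih =>
    obtain ⟨s, hs, hxs⟩ := hx
    obtain ⟨p, hp, F, hF, h1, h2⟩ := ih s hs hxs
    exact ⟨p, hp, F, hF, h1, fun y hy hy' => ⟨s, hs, h2 y hy hy'⟩⟩

theorem mem_extend_self (μ : u ⟶ v) (x : PathSpace C v) :
    (⟨v, μ⟩ : PathsFrom C u) ∈ (x.extend μ).carrier :=
  ⟨_, id_mem x, 𝟙 _, by simp [prepend]⟩

theorem extend_mono (μ : u ⟶ v) {x y : PathSpace C v} (h : x.carrier ⊆ y.carrier) :
    (x.extend μ).carrier ⊆ (y.extend μ).carrier := by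
  rintro p ⟨ν, hν, hp⟩
  exact ⟨ν, h hν, hp⟩

/-- The set of prefixes of a path. -/
def principal (p : PathsFrom C u) : PathSpace C u where
  carrier := {q | IsPrefix q p}
  nonempty := ⟨p, IsPrefix.refl _⟩
  hereditary _ _ h h' := h'.trans h
  directed _ h _ h' := ⟨p, IsPrefix.refl _, h, h'⟩

variable [CategoryOfPaths C]

theorem prepend_mem_extend {μ : u ⟶ v} {x : PathSpace C v} {p : PathsFrom C v} :
    prepend μ p ∈ (x.extend μ).carrier ↔ p ∈ x.carrier :=
  ⟨fun ⟨_, hν, h⟩ => x.hereditary _ _ hν h.of_prepend, fun h => ⟨p, h, IsPrefix.refl _⟩⟩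

theorem range_extend (μ : u ⟶ v) :
    range (fun x : PathSpace C v => x.extend μ) = cylinder ⟨v, μ⟩ := by
  ext x
  constructor
  · rintro ⟨y, rfl⟩
    exact mem_extend_self μ y
  · intro h
    obtain ⟨y, rfl⟩ := x.exists_eq_extend μ h
    exact ⟨y, rfl⟩

theorem isMaximal_extend (μ : u ⟶ v) {x : PathSpace C v} (hx : x.IsMaximal) :
    (x.extend μ).IsMaximal := by
  intro y hy
  obtain ⟨y, rfl⟩ := y.exists_eq_extend μ (hy (mem_extend_self μ x))
  refine extend_mono μ (hx y fun p hp => ?_)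
  exact prepend_mem_extend.1 (hy (prepend_mem_extend.2 hp))

end General

variable {k : ℕ → ℕ} {u v : Vertex k}

/-- The indicator function of a directed hereditary set, as a point of a Cantor cube. -/
def indicatorCode (x : PathSpace (Vertex k) u) : PathsFrom (Vertex k) u → Bool :=
  open Classical in fun p => decide (p ∈ x.carrier)

theorem indicatorCode_eq_true {x : PathSpace (Vertex k) u} {p : PathsFrom (Vertex k) u} :
    indicatorCode x p = true ↔ p ∈ x.carrier := by
  simp [indicatorCode]

/-- Directedness of a hereditary set is a closed condition because two paths with a common extension
have a least common one. -/
theorem isClosedEmbedding_indicatorCode :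
    IsClosedEmbedding (indicatorCode : PathSpace (Vertex k) u → _) := by
  have hinj : Function.Injective (indicatorCode : PathSpace (Vertex k) u → _) := by
    intro x y h
    ext p
    rw [← indicatorCode_eq_true, h, indicatorCode_eq_true]
  have hpre : ∀ p : PathsFrom (Vertex k) u,
      (indicatorCode : PathSpace (Vertex k) u → _) ⁻¹' {f | f p = true} = cylinder p := by
    intro p
    ext x
    exact indicatorCode_eq_true
  have hcl : ∀ p : PathsFrom (Vertex k) u, IsClopen {f : PathsFrom (Vertex k) u → Bool | f p} :=
    fun p => (isClopen_discrete {true}).preimage (continuous_apply p)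
  refine ⟨⟨⟨le_antisymm ?_ ?_⟩, hinj⟩, ?_⟩
  · rw [← continuous_iff_le_induced]
    refine continuous_pi fun p => continuous_bool_rng true |>.2 ?_
    have : (fun x : PathSpace (Vertex k) u => indicatorCode x p) ⁻¹' {true} = cylinder p := hpre p
    rw [this]
    exact isClopen_cylinder p
  · let _ : TopologicalSpace (PathSpace (Vertex k) u) := .induced indicatorCode inferInstance
    refine le_generateFrom ?_
    have h : ∀ p : PathsFrom (Vertex k) u, IsClopen (cylinder p) := by
      intro p
      rw [← hpre p]
      exact (hcl p).preimage continuous_induced_dom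
    rintro _ ⟨l, F, hF, rfl⟩
    exact (h l).isOpen.sdiff (hF.isClosed_biUnion fun m _ => (h m).isClosed)
  · have : range (indicatorCode : PathSpace (Vertex k) u → _) = {f | f ⟨u, 𝟙 u⟩ = true} ∩
        ((⋂ (p) (q) (_ : IsPrefix p q), {f | f q = true}ᶜ ∪ {f | f p = true}) ∩
        ⋂ (p) (q), ({f | f p = true}ᶜ ∪ {f | f q = true}ᶜ) ∪
          {f | ∃ l, (IsPrefix p l ∧ IsPrefix q l ∧ ∀ c, IsPrefix p c → IsPrefix q c → IsPrefix l c)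
            ∧ f l = true}) := by
      ext f
      simp only [mem_range, mem_inter_iff, mem_ofPred_eq, mem_iInter, mem_union, mem_compl_iff]
      constructor
      · rintro ⟨x, rfl⟩
        simp only [indicatorCode_eq_true]
        refine ⟨id_mem x, fun p q h => ?_, fun p q => ?_⟩
        · by_cases hq : q ∈ x.carrier
          · exact Or.inr (x.hereditary _ _ hq h)
          · exact Or.inl hq
        · by_cases hp : p ∈ x.carrier
          · by_cases hq : q ∈ x.carrier
            · obtain ⟨c, hc, h1, h2⟩ := x.directed _ hp _ hq
              obtain ⟨l, h3, h4, h5⟩ := exists_least_extension h1 h2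
              exact Or.inr ⟨l, ⟨h3, h4, h5⟩, x.hereditary _ _ hc (h5 _ h1 h2)⟩
            · exact Or.inl (Or.inr hq)
          · exact Or.inl (Or.inl hp)
      · rintro ⟨h1, h2, h3⟩
        refine ⟨⟨{p | f p = true}, ⟨_, h1⟩, fun p q hq h => ?_, fun p hp q hq => ?_⟩, ?_⟩
        · exact (h2 p q h).resolve_left (not_not.2 hq)
        · rcases h3 p q with (h | h) | ⟨l, ⟨h4, h5, -⟩, hl⟩
          · exact absurd hp h
          · exact absurd hq h
          · exact ⟨l, hl, h4, h5⟩
        · funext p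
          rw [Bool.eq_iff_iff, indicatorCode_eq_true]
          rfl
    rw [this]
    refine (hcl _).isClosed.inter (IsClosed.inter ?_ ?_)
    · exact isClosed_iInter fun p => isClosed_iInter fun q => isClosed_iInter fun _ =>
        (hcl q).compl.isClosed.union (hcl p).isClosed
    · refine isClosed_iInter fun p => isClosed_iInter fun q =>
        ((hcl p).compl.isClosed.union (hcl q).compl.isClosed).union ?_
      by_cases h : ∃ c, IsPrefix p c ∧ IsPrefix q c
      · obtain ⟨c, h1, h2⟩ := h
        obtain ⟨l, h3, h4, h5⟩ := exists_least_extension h1 h2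
        convert (hcl l).isClosed using 1
        ext f
        constructor
        · rintro ⟨l', ⟨k1, k2, k3⟩, hl⟩
          have e : l' = l := val_injective <| eq_of_dvd_of_len
            (isPrefix_iff.1 (k3 _ h3 h4)) (weight_dvd _ (isPrefix_iff.1 (h5 _ k1 k2)))
          rwa [← e]
        · exact fun hl => ⟨l, ⟨h3, h4, h5⟩, hl⟩
      · convert isClosed_empty using 1
        refine eq_empty_of_forall_notMem ?_
        rintro f ⟨l, ⟨k1, k2, -⟩, -⟩
        exact h ⟨l, k1, k2⟩

instance compactSpace_pathSpace : CompactSpace (PathSpace (Vertex k) u) :=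
  isClosedEmbedding_indicatorCode.compactSpace

instance t2Space_pathSpace : T2Space (PathSpace (Vertex k) u) :=
  isClosedEmbedding_indicatorCode.isEmbedding.t2Space

instance secondCountable_pathSpace : SecondCountableTopology (PathSpace (Vertex k) u) :=
  isClosedEmbedding_indicatorCode.isEmbedding.secondCountableTopology

/-- The preimage of a cylinder set under `x ↦ μx` is a cylinder set or empty. -/
theorem preimage_extend_cylinder (μ : u ⟶ v) (p : PathsFrom (Vertex k) u) :
    (∃ q, (fun x : PathSpace (Vertex k) v => x.extend μ) ⁻¹' cylinder p = cylinder q) ∨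
      (fun x : PathSpace (Vertex k) v => x.extend μ) ⁻¹' cylinder p = ∅ := by
  by_cases h : ∃ c, IsPrefix ⟨v, μ⟩ c ∧ IsPrefix p c
  · left
    obtain ⟨c, h1, h2⟩ := h
    obtain ⟨⟨w, l⟩, ⟨(η : v ⟶ w), (hη : μ ≫ η = l)⟩, h4, h5⟩ := exists_least_extension h1 h2
    subst hη
    refine ⟨⟨w, η⟩, ?_⟩
    ext x
    constructor
    · intro hx
      obtain ⟨c, hc, k1, k2⟩ := (x.extend μ).directed _ (mem_extend_self μ x) _ hx
      have := (x.extend μ).hereditary _ _ hc (h5 _ k1 k2)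
      exact prepend_mem_extend.1 this
    · intro hx
      exact (x.extend μ).hereditary _ _ (prepend_mem_extend.2 hx) h4
  · right
    refine eq_empty_of_forall_notMem fun x hx => h ?_
    obtain ⟨c, hc, k1, k2⟩ := (x.extend μ).directed _ (mem_extend_self μ x) _ hx
    exact ⟨c, k1, k2⟩

theorem continuous_extend (μ : u ⟶ v) :
    Continuous (fun x : PathSpace (Vertex k) v => x.extend μ) := by
  refine continuous_of_isClopen_preimage fun p => ?_
  rcases preimage_extend_cylinder μ p with ⟨q, hq⟩ | hq
  · rw [hq]
    exact isClopen_cylinder q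
  · rw [hq]
    exact isClopen_empty

theorem isOpenEmbedding_extend (μ : u ⟶ v) :
    IsOpenEmbedding (fun x : PathSpace (Vertex k) v => x.extend μ) := by
  refine ⟨((continuous_extend μ).isClosedEmbedding fun x y h =>
    PathSpace.extend_injective μ h).isEmbedding, ?_⟩
  rw [range_extend]
  exact (isClopen_cylinder _).isOpen

/-! ### The boundary -/

/-- A directed hereditary set which contains paths of every length. -/
def IsUnbounded (x : PathSpace (Vertex k) u) : Prop :=
  ∀ n, ∃ p ∈ x.carrier, n ≤ len (val p)

/-- Every path in an unbounded set has extensions of any length in the set. -/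
theorem IsUnbounded.exists_extension {x : PathSpace (Vertex k) u} (hx : IsUnbounded x)
    {p : PathsFrom (Vertex k) u} (hp : p ∈ x.carrier) {n : ℕ} (hn : len (val p) ≤ n) :
    ∃ q ∈ x.carrier, IsPrefix p q ∧ len (val q) = n := by
  obtain ⟨c, hc, hc'⟩ := hx n
  obtain ⟨d, hd, h1, h2⟩ := x.directed _ hp _ hc
  have h3 := hc'.trans (weight_dvd _ (isPrefix_iff.1 h2))
  obtain ⟨r, hr⟩ := isPrefix_iff.1 h1
  have h4 : len (val d) = len (val p) + len r := by rw [hr, len_mul]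
  obtain ⟨a, b, rfl, hab⟩ := exists_mul_of_le_len r (n - len (val p)) (by
    change n ≤ len (val d) at h3
    omega)
  obtain ⟨q, hq, hq'⟩ := exists_path_of_dvd (m := val p * a) d
    ⟨b, by rw [hr, mul_assoc]⟩
  refine ⟨q, x.hereditary _ _ hd hq', isPrefix_iff.2 ⟨a, hq⟩, ?_⟩
  rw [hq, len_mul, hab]
  omega

theorem finite_paths_len (n : ℕ) : {p : PathsFrom (Vertex k) u | len (val p) = n}.Finite := by
  have : {p : PathsFrom (Vertex k) u | len (val p) = n} ⊆
      range (fun μ : u ⟶ ⟨u.index + n⟩ => (⟨_, μ⟩ : PathsFrom (Vertex k) u)) := by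
    rintro p rfl
    exact ⟨homMk (val p) (val_valid p) rfl, val_injective rfl⟩
  exact (finite_range _).subset this

theorem isClosed_isUnbounded : IsClosed {x : PathSpace (Vertex k) u | IsUnbounded x} := by
  have : {x : PathSpace (Vertex k) u | IsUnbounded x} =
      ⋂ n, ⋃ p ∈ {p : PathsFrom (Vertex k) u | len (val p) = n}, cylinder p := by
    ext x
    simp only [mem_ofPred_eq, mem_iInter, mem_iUnion]
    constructor
    · intro hx n
      obtain ⟨p, hp, -, hn⟩ := hx.exists_extension (id_mem x) (n := n) (by simp [val])
      exact ⟨p, hn, hp⟩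
    · intro hx n
      obtain ⟨p, hn, hp⟩ := hx n
      exact ⟨p, hp, hn.ge⟩
  rw [this]
  exact isClosed_iInter fun n => (finite_paths_len n).isClosed_biUnion fun p _ =>
    (isClopen_cylinder p).isClosed

theorem isUnbounded_of_isMaximal {x : PathSpace (Vertex k) u} (hx : x.IsMaximal) :
    IsUnbounded x := by
  by_contra h
  simp only [IsUnbounded, not_forall, not_exists, not_and, not_le] at h
  obtain ⟨n, hn⟩ := h
  have hfin : (range fun p : x.carrier => len (val p.1)).Finite :=
    (Set.finite_Iio n).subset (by rintro _ ⟨p, rfl⟩; exact hn p.1 p.2)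
  have : Nonempty x.carrier := x.nonempty.to_subtype
  obtain ⟨_, ⟨p, rfl⟩, hp⟩ := hfin.exists_maximal (range_nonempty _)
  have hp' : ∀ q ∈ x.carrier, len (val q) ≤ len (val p.1) := fun q hq => by
    by_contra hlt
    exact hlt (hp ⟨⟨q, hq⟩, rfl⟩ (le_of_not_ge hlt))
  have hv : Valid k u.index (val p.1 * letter .α) :=
    (valid_mul _).2 ⟨val_valid _, valid_letter.2 trivial⟩
  have h1 := hx (principal (pathMk u _ hv)) fun q hq => by
    obtain ⟨d, hd, h1, h2⟩ := x.directed _ p.2 _ hq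
    have e := eq_of_dvd_of_len (isPrefix_iff.1 h1) (hp' d hd)
    rw [isPrefix_iff, ← e] at h2
    exact isPrefix_iff.2 (h2.trans ⟨_, rfl⟩)
  have h2 := hp' _ (h1 (IsPrefix.refl _))
  simp at h2

/-- Paths without edges `γ` are valid. -/
theorem valid_of_countγ {m : WordMonoid} : ∀ {i : ℕ}, countγ m = 0 → Valid k i m := by
  induction m using wordMonoid_induction with
  | one => exact fun _ => valid_one _
  | mul a m ih =>
    intro i h
    rw [valid_letter_mul]
    cases a with
    | γ j => simp at h
    | _ => exact ⟨trivial, ih (by simpa using h)⟩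

theorem pow_mul_pow_dvd {a b a' b' : ℕ} (ha : a ≤ a') (hb : b ≤ b') :
    letter .α ^ a * letter .β ^ b ∣ letter .α ^ a' * letter .β ^ b' := by
  obtain ⟨c, rfl⟩ := Nat.exists_eq_add_of_le ha
  obtain ⟨d, rfl⟩ := Nat.exists_eq_add_of_le hb
  refine ⟨letter .α ^ c * letter .β ^ d, ?_⟩
  rw [pow_add, pow_add, mul_assoc, mul_assoc, ← mul_assoc (letter .β ^ b),
    (letter_commute.symm.pow_pow b c).eq, mul_assoc]

/-- The set `α^∞β^∞` of all paths with range `u` without edges `γ`. -/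
def gammaFree (u : Vertex k) : PathSpace (Vertex k) u where
  carrier := {p | countγ (val p) = 0}
  nonempty := ⟨⟨u, 𝟙 u⟩, by simp⟩
  hereditary p q hq h := Nat.eq_zero_of_le_zero
    ((weight_dvd _ (isPrefix_iff.1 h)).trans (le_of_eq hq))
  directed p hp q hq := by
    have h : ∀ a b, countγ (letter .α ^ a * letter .β ^ b) = 0 := by simp [weight_pow]
    refine ⟨pathMk u (letter .α ^ max (countα (val p)) (countα (val q)) *
      letter .β ^ max (countβ (val p)) (countβ (val q))) (valid_of_countγ (h _ _)), h _ _, ?_, ?_⟩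
    · exact isPrefix_iff.2 ((dvd_of_eq (eq_pow_mul_pow hp)).trans
        (pow_mul_pow_dvd (le_max_left _ _) (le_max_left _ _)))
    · exact isPrefix_iff.2 ((dvd_of_eq (eq_pow_mul_pow hq)).trans
        (pow_mul_pow_dvd (le_max_right _ _) (le_max_right _ _)))

theorem exists_gamma {m : WordMonoid} (h : countγ m ≠ 0) :
    ∃ l j r, m = l * (letter (.γ j) * r) := by
  induction m using wordMonoid_induction with
  | one => simp at h
  | mul a m ih =>
    cases a with
    | γ j => exact ⟨1, j, m, by simp⟩
    | _ =>
      obtain ⟨l, j, r, rfl⟩ := ih (by simpa using h)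
      exact ⟨_, j, r, (mul_assoc _ _ _).symm⟩

/-- Of two elements of a directed set, of which one ends in `γ`, the shorter one is a prefix of
the longer one. -/
theorem isPrefix_gamma {x : PathSpace (Vertex k) u} {p q : PathsFrom (Vertex k) u}
    (hp : p ∈ x.carrier) (hq : q ∈ x.carrier) {l : WordMonoid} {j : ℕ}
    (hl : val p = l * letter (.γ j)) :
    val q ∣ l ∨ val p ∣ val q := by
  obtain ⟨c, hc, h1, h2⟩ := x.directed _ hp _ hq
  rw [isPrefix_iff] at h1 h2
  obtain ⟨r, hr⟩ := h1
  rw [hr, hl, mul_assoc] at h2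
  rw [hl]
  exact dvd_mul_gamma _ _ h2

theorem isMaximal_gammaFree (u : Vertex k) : (gammaFree u).IsMaximal := by
  intro y hy p hp
  by_contra hc
  obtain ⟨l, j, r, h⟩ := exists_gamma hc
  obtain ⟨q, hq, hqp⟩ := exists_path_of_dvd (m := l * letter (.γ j)) p
    ⟨r, by rw [h, mul_assoc]⟩
  have hα : countγ (letter .α ^ (len l + 1)) = 0 := by simp [weight_pow]
  have h1 : pathMk u _ (valid_of_countγ hα) ∈ y.carrier := hy hα
  rcases isPrefix_gamma (y.hereditary _ _ hp hqp) h1 hq with h2 | h2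
  · have := weight_dvd (fun _ => 1) h2
    rw [val_pathMk, weight_pow, weight_letter] at this
    change _ ≤ len l at this
    omega
  · have := weight_dvd (fun a => match a with | .γ _ => 1 | _ => 0) h2
    rw [val_pathMk, hq] at this
    simp [weight_pow] at this

end

section

variable {k : ℕ → ℕ} {u v w : Vertex k}

/-- The map `x ↦ μx` is an open embedding which preserves and reflects maximality, so it preserves
and reflects membership in the boundary. -/
theorem extend_mem_closure_iff (μ : u ⟶ v) {x : PathSpace (Vertex k) v} :
    x.extend μ ∈ closure {y : PathSpace (Vertex k) u | y.IsMaximal} ↔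
      x ∈ closure {y : PathSpace (Vertex k) v | y.IsMaximal} := by
  rw [← mem_preimage (f := fun x : PathSpace (Vertex k) v => x.extend μ),
    (isOpenEmbedding_extend μ).isOpenMap.preimage_closure_eq_closure_preimage
    (continuous_extend μ)]
  have : (fun x : PathSpace (Vertex k) v => x.extend μ) ⁻¹' {y | y.IsMaximal} =
      {y | y.IsMaximal} := by
    ext y
    refine ⟨fun h z hz p hp => ?_, isMaximal_extend μ⟩
    exact prepend_mem_extend.1 (h _ (extend_mono μ hz) (prepend_mem_extend.2 hp))
  rw [this]

instance compactSpace_boundary : CompactSpace (Boundary (Vertex k) u) :=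
  isCompact_iff_compactSpace.1 isClosed_closure.isCompact

instance t2Space_boundary : T2Space (Boundary (Vertex k) u) :=
  inferInstanceAs (T2Space {_x // _})

instance secondCountable_boundary : SecondCountableTopology (Boundary (Vertex k) u) :=
  inferInstanceAs (SecondCountableTopology {_x // _})

theorem isUnbounded_boundary (x : Boundary (Vertex k) u) : IsUnbounded x.1 :=
  closure_minimal (fun _ hy => isUnbounded_of_isMaximal hy) isClosed_isUnbounded x.2

/-- The map `x ↦ μx` of boundaries. -/
def bdExtend (μ : u ⟶ v) (x : Boundary (Vertex k) v) : Boundary (Vertex k) u :=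
  ⟨x.1.extend μ, (extend_mem_closure_iff μ).2 x.2⟩

/-- The trace of the cylinder set `Z(p)` on the boundary. -/
def bdCylinder (p : PathsFrom (Vertex k) u) : Set (Boundary (Vertex k) u) :=
  {x | p ∈ x.1.carrier}

theorem continuous_boundary_val : Continuous (Subtype.val : Boundary (Vertex k) u → _) :=
  continuous_subtype_val

theorem isClopen_bdCylinder (p : PathsFrom (Vertex k) u) : IsClopen (bdCylinder p) :=
  (isClopen_cylinder p).preimage continuous_boundary_val

theorem bdExtend_injective (μ : u ⟶ v) : Function.Injective (bdExtend μ) := fun _ _ h =>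
  Subtype.ext (PathSpace.extend_injective μ (congrArg Subtype.val h))

theorem bdExtend_comp (μ : u ⟶ v) (ν : v ⟶ w) (x : Boundary (Vertex k) w) :
    bdExtend (μ ≫ ν) x = bdExtend μ (bdExtend ν x) :=
  Subtype.ext (PathSpace.extend_comp _ _ _)

theorem exists_eq_bdExtend {x : Boundary (Vertex k) u} {μ : u ⟶ v} (h : x ∈ bdCylinder ⟨v, μ⟩) :
    ∃ y, x = bdExtend μ y := by
  obtain ⟨y, hy⟩ := x.1.exists_eq_extend μ h
  exact ⟨⟨y, (extend_mem_closure_iff μ).1 (hy ▸ x.2)⟩, Subtype.ext hy⟩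

theorem bdExtend_mem (μ : u ⟶ v) (y : Boundary (Vertex k) v) :
    bdExtend μ y ∈ bdCylinder ⟨v, μ⟩ := mem_extend_self _ _

theorem range_bdExtend (μ : u ⟶ v) : range (bdExtend μ) = bdCylinder ⟨v, μ⟩ := by
  ext x
  constructor
  · rintro ⟨y, rfl⟩
    exact bdExtend_mem μ y
  · intro h
    obtain ⟨y, rfl⟩ := exists_eq_bdExtend h
    exact ⟨y, rfl⟩

theorem bdExtend_image_bdCylinder (μ : u ⟶ v) (η : v ⟶ w) :
    bdExtend μ '' bdCylinder ⟨w, η⟩ = bdCylinder ⟨w, μ ≫ η⟩ := by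
  rw [← range_bdExtend, ← range_bdExtend, ← range_comp]
  congr 1
  funext x
  exact (bdExtend_comp _ _ _).symm

theorem exists_common_bdExtend {v' : Vertex k} {μ : u ⟶ v} {μ' : u ⟶ v'}
    {x : Boundary (Vertex k) v} {x' : Boundary (Vertex k) v'} (h : bdExtend μ x = bdExtend μ' x') :
    ∃ (w : Vertex k) (η : v ⟶ w) (η' : v' ⟶ w) (y : Boundary (Vertex k) w),
      x = bdExtend η y ∧ x' = bdExtend η' y ∧ μ ≫ η = μ' ≫ η' := by
  obtain ⟨w, η, η', y, h1, h2, h3⟩ := PathSpace.exists_common _ _ _ _ (congrArg Subtype.val h)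
  exact ⟨w, η, η', ⟨y, (extend_mem_closure_iff η).1 (h1 ▸ x.2)⟩, Subtype.ext h1, Subtype.ext h2, h3⟩

theorem isOpenEmbedding_bdExtend (μ : u ⟶ v) : IsOpenEmbedding (bdExtend μ) := by
  have hc : Continuous (bdExtend μ) :=
    ((continuous_extend μ).comp continuous_boundary_val).subtype_mk _
  refine ⟨(hc.isClosedEmbedding (bdExtend_injective μ)).isEmbedding, ?_⟩
  rw [range_bdExtend]
  exact (isClopen_bdCylinder _).isOpen

/-! ### The space of arrows -/

/-- The class `[μ, ν, z]` as a morphism of the groupoid. -/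
def mkHom (μ ν : u ⟶ v) (z : Boundary (Vertex k) v) : bdExtend μ z ⟶ bdExtend ν z :=
  ⟨Germ.mk μ ν z.1, rfl, rfl⟩

/-- The arrow `[μ, ν, z]`. -/
def mkArr (μ ν : u ⟶ v) (z : Boundary (Vertex k) v) : Arr (Boundary (Vertex k) u) :=
  ⟨bdExtend μ z, bdExtend ν z, mkHom μ ν z⟩

theorem arr_ext {a b : Arr (Boundary (Vertex k) u)} (h : germOf a.hom = germOf b.hom) : a = b := by
  obtain ⟨x, y, g, hr, hs⟩ := a
  obtain ⟨x', y', g', hr', hs'⟩ := b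
  obtain rfl : g = g' := h
  obtain rfl : x = x' := Subtype.ext (hr.symm.trans hr')
  obtain rfl : y = y' := Subtype.ext (hs.symm.trans hs')
  rfl

theorem exists_mkArr (a : Arr (Boundary (Vertex k) u)) :
    ∃ (v : Vertex k) (μ ν : u ⟶ v) (z : Boundary (Vertex k) v), a = mkArr μ ν z := by
  obtain ⟨v, μ, ν, z, h⟩ := (germOf a.hom).exists_mk
  have hr : z.extend μ = a.r.1 := by
    rw [← Germ.r_mk μ ν z, ← h]
    exact a.hom.2.1
  exact ⟨v, μ, ν, ⟨z, (extend_mem_closure_iff μ).1 (hr ▸ a.r.2)⟩, arr_ext h⟩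

theorem mkArr_eq_iff {v' : Vertex k} {μ ν : u ⟶ v} {μ' ν' : u ⟶ v'} {z : Boundary (Vertex k) v}
    {z' : Boundary (Vertex k) v'} : mkArr μ ν z = mkArr μ' ν' z' ↔
      ∃ (w : Vertex k) (δ : v ⟶ w) (δ' : v' ⟶ w) (y : Boundary (Vertex k) w),
        z = bdExtend δ y ∧ z' = bdExtend δ' y ∧ μ ≫ δ = μ' ≫ δ' ∧ ν ≫ δ = ν' ≫ δ' := by
  constructor
  · intro h
    have h' : Germ.mk μ ν z.1 = Germ.mk μ' ν' z'.1 :=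
      congrArg (fun a : Arr (Boundary (Vertex k) u) => germOf a.hom) h
    obtain ⟨w, δ, δ', y, h1, h2, h3, h4⟩ := (Germ.mk_eq_mk_iff _ _ _ _ _ _).1 h'
    exact ⟨w, δ, δ', ⟨y, (extend_mem_closure_iff δ).1 (h1 ▸ z.2)⟩, Subtype.ext h1,
      Subtype.ext h2, h3, h4⟩
  · rintro ⟨w, δ, δ', y, rfl, rfl, h3, h4⟩
    exact arr_ext ((Germ.mk_eq_mk_iff _ _ _ _ _ _).2 ⟨w, δ, δ', y.1, rfl, rfl, h3, h4⟩)

theorem mkArr_extend (μ ν : u ⟶ v) (η : v ⟶ w) (z : Boundary (Vertex k) w) :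
    mkArr μ ν (bdExtend η z) = mkArr (μ ≫ η) (ν ≫ η) z :=
  arr_ext (Germ.mk_extend _ _ _ _)

theorem mkArr_injective (μ ν : u ⟶ v) : Function.Injective (mkArr μ ν) := fun _ _ h =>
  bdExtend_injective μ (congrArg Arr.r h)

theorem unitArr_eq_mkArr (x : Boundary (Vertex k) u) : unitArr x = mkArr (𝟙 u) (𝟙 u) x :=
  arr_ext rfl

theorem unitArr_bdExtend (μ : u ⟶ v) (z : Boundary (Vertex k) v) :
    unitArr (bdExtend μ z) = mkArr μ μ z := by
  rw [unitArr_eq_mkArr, mkArr_extend, Category.id_comp]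

/-- A set `[μ, ν, ∂]` with `μ ≠ ν` contains no unit. -/
theorem unitArr_ne_mkArr {μ ν : u ⟶ v} (h : μ ≠ ν) (x : Boundary (Vertex k) u)
    (z : Boundary (Vertex k) v) : unitArr x ≠ mkArr μ ν z := by
  rw [unitArr_eq_mkArr]
  intro h'
  obtain ⟨w, δ, δ', y, -, -, h3, h4⟩ := mkArr_eq_iff.1 h'
  exact h (CategoryOfPaths.right_cancel _ _ _ (h3.symm.trans h4))

/-- The sets `[μ, ν, ∂]` and `[μ, ν', ∂]` are disjoint by cancellation. -/
theorem disjoint_range_mkArr {μ ν ν' : u ⟶ v} (h : ν ≠ ν') :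
    Disjoint (range (mkArr μ ν)) (range (mkArr μ ν')) := by
  rw [Set.disjoint_left]
  rintro _ ⟨z, rfl⟩ ⟨z', h'⟩
  obtain ⟨w, δ, δ', y, -, -, h3, h4⟩ := mkArr_eq_iff.1 h'
  obtain rfl := CategoryOfPaths.left_cancel _ _ _ h3
  exact h (CategoryOfPaths.right_cancel _ _ _ h4).symm

theorem mkArr_image (μ ν : u ⟶ v) (E : Set (PathSpace (Vertex k) v)) :
    mkArr μ ν '' (Subtype.val ⁻¹' E) = (fun a => germOf a.hom) ⁻¹' (Germ.mk μ ν '' E) := by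
  ext a
  constructor
  · rintro ⟨z, hz, rfl⟩
    exact ⟨z.1, hz, rfl⟩
  · rintro ⟨z, hz, h⟩
    have hr : z.extend μ = a.r.1 := by
      rw [← Germ.r_mk μ ν z, h]
      exact a.hom.2.1
    exact ⟨⟨z, (extend_mem_closure_iff μ).1 (hr ▸ a.r.2)⟩, hz, arr_ext h⟩

theorem continuous_mkArr (μ ν : u ⟶ v) : Continuous (mkArr μ ν) := by
  refine continuous_induced_rng.2 (continuous_generateFrom_iff.2 ?_)
  rintro _ ⟨v', μ', ν', E, -, hE, rfl⟩
  have : (fun z : PathSpace (Vertex k) v => Germ.mk μ ν z) ⁻¹' (Germ.mk μ' ν' '' E) =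
      ⋃ (w : Vertex k) (δ : v ⟶ w) (δ' : v' ⟶ w) (_ : μ ≫ δ = μ' ≫ δ' ∧ ν ≫ δ = ν' ≫ δ'),
        (fun y => y.extend δ) '' ((fun y : PathSpace (Vertex k) w => y.extend δ') ⁻¹' E) := by
    ext z
    simp only [mem_preimage, mem_image, mem_iUnion]
    constructor
    · rintro ⟨z', hz', h⟩
      obtain ⟨w, δ', δ, y, h1, h2, h3, h4⟩ := (Germ.mk_eq_mk_iff _ _ _ _ _ _).1 h
      exact ⟨w, δ, δ', ⟨h3.symm, h4.symm⟩, y, h1 ▸ hz', h2.symm⟩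
    · rintro ⟨w, δ, δ', ⟨h1, h2⟩, y, hy, rfl⟩
      exact ⟨_, hy, (Germ.mk_eq_mk_iff _ _ _ _ _ _).2 ⟨w, δ', δ, y, rfl, rfl, h1.symm, h2.symm⟩⟩
  have hopen : IsOpen ((fun z : PathSpace (Vertex k) v => Germ.mk μ ν z) ⁻¹'
      (Germ.mk μ' ν' '' E)) := by
    rw [this]
    exact isOpen_iUnion fun w => isOpen_iUnion fun δ => isOpen_iUnion fun δ' =>
      isOpen_iUnion fun _ =>
        (isOpenEmbedding_extend δ).isOpenMap _ (hE.preimage (continuous_extend δ'))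
  exact hopen.preimage continuous_boundary_val

theorem isOpenMap_mkArr (μ ν : u ⟶ v) : IsOpenMap (mkArr μ ν) := by
  intro U hU
  obtain ⟨V, hV, rfl⟩ := isOpen_induced_iff.1 hU
  rw [isOpen_iff_mem_nhds]
  rintro _ ⟨z, hz, rfl⟩
  obtain ⟨p, hp, F, hF, h1, h2⟩ := exists_basic_nhd hV hz
  have hE : IsClopen (cylinder p \ ⋃ q ∈ F, cylinder q) :=
    (isClopen_cylinder p).diff (hF.isClopen_biUnion fun q _ => isClopen_cylinder q)
  have hE' : IsOpen (mkArr μ ν '' (Subtype.val ⁻¹' (cylinder p \ ⋃ q ∈ F, cylinder q))) := by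
    rw [mkArr_image]
    exact isOpen_induced (TopologicalSpace.isOpen_generateFrom_of_mem
      ⟨v, μ, ν, _, hE.isClosed.isCompact, hE.isOpen, rfl⟩)
  refine Filter.mem_of_superset (hE'.mem_nhds (mem_image_of_mem _ ⟨hp, ?_⟩)) (image_mono ?_)
  · simp only [mem_iUnion, not_exists]
    exact h1
  · rintro y ⟨hy, hy'⟩
    simp only [mem_iUnion, not_exists] at hy'
    exact h2 y.1 hy hy'

theorem isOpenEmbedding_mkArr (μ ν : u ⟶ v) : IsOpenEmbedding (mkArr μ ν) :=
  .of_continuous_injective_isOpenMap (continuous_mkArr μ ν) (mkArr_injective μ ν)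
    (isOpenMap_mkArr μ ν)

theorem continuous_of_comp_mkArr {Y : Type*} [TopologicalSpace Y]
    {f : Arr (Boundary (Vertex k) u) → Y}
    (h : ∀ (v : Vertex k) (μ ν : u ⟶ v), Continuous (f ∘ mkArr μ ν)) : Continuous f := by
  rw [continuous_iff_continuousAt]
  intro a
  obtain ⟨v, μ, ν, z, rfl⟩ := exists_mkArr a
  exact (isOpenEmbedding_mkArr μ ν).continuousAt_iff.1 (h v μ ν).continuousAt

theorem continuous_r : Continuous (Arr.r : Arr (Boundary (Vertex k) u) → _) :=
  continuous_of_comp_mkArr fun _ μ _ => (isOpenEmbedding_bdExtend μ).continuous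

theorem continuous_s : Continuous (Arr.s : Arr (Boundary (Vertex k) u) → _) :=
  continuous_of_comp_mkArr fun _ _ ν => (isOpenEmbedding_bdExtend ν).continuous

theorem continuous_unitArr : Continuous (unitArr : Boundary (Vertex k) u → _) := by
  convert continuous_mkArr (𝟙 u) (𝟙 u) using 1
  funext x
  exact unitArr_eq_mkArr x

/-- The groupoid is Hausdorff: two arrows with the same range and source are separated by the
open sets `[μ, ν, ∂]` and `[μ, ν', ∂]`. -/
instance t2Space_arr : T2Space (Arr (Boundary (Vertex k) u)) := by
  refine ⟨fun a b hab => ?_⟩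
  by_cases hr : a.r = b.r
  swap
  · exact separated_by_continuous continuous_r hr
  by_cases hs : a.s = b.s
  swap
  · exact separated_by_continuous continuous_s hs
  obtain ⟨v, μ, ν, z, rfl⟩ := exists_mkArr a
  obtain ⟨v', μ', ν', z', rfl⟩ := exists_mkArr b
  obtain ⟨w, δ, δ', y, rfl, rfl, h3⟩ := exists_common_bdExtend hr
  rw [mkArr_extend, mkArr_extend, ← h3] at hab ⊢
  have hne : ν ≫ δ ≠ ν' ≫ δ' := fun h => hab (by rw [h])
  exact ⟨_, _, (isOpenEmbedding_mkArr _ _).isOpen_range, (isOpenEmbedding_mkArr _ _).isOpen_range,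
    ⟨y, rfl⟩, ⟨y, rfl⟩, disjoint_range_mkArr hne⟩

theorem isClopen_range_mkArr (μ ν : u ⟶ v) : IsClopen (range (mkArr μ ν)) :=
  ⟨(isCompact_range (continuous_mkArr μ ν)).isClosed, (isOpenEmbedding_mkArr μ ν).isOpen_range⟩

end

section

variable {k : ℕ → ℕ} {u v w : Vertex k}

/-! ### Functions supported on a basic bisection -/

theorem hasCompactSupport_extend (μ ν : u ⟶ v) (φ : Boundary (Vertex k) v → ℂ) :
    HasCompactSupport (Function.extend (mkArr μ ν) φ 0) := by
  refine HasCompactSupport.intro (isCompact_range (continuous_mkArr μ ν)) fun a ha => ?_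
  exact Function.extend_apply' _ _ _ (by simpa using ha)

theorem continuous_extend_zero (μ ν : u ⟶ v) (φ : C(Boundary (Vertex k) v, ℂ)) :
    Continuous (Function.extend (mkArr μ ν) φ 0) := by
  rw [continuous_iff_continuousAt]
  intro a
  by_cases ha : a ∈ range (mkArr μ ν)
  · obtain ⟨z, rfl⟩ := ha
    rw [← (isOpenEmbedding_mkArr μ ν).continuousAt_iff,
      Function.extend_comp (mkArr_injective μ ν)]
    exact φ.continuous.continuousAt
  · refine (continuousAt_const (y := (0 : ℂ))).congr ?_
    filter_upwards [(isClopen_range_mkArr μ ν).compl.isOpen.mem_nhds ha] with b hb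
    rw [Function.extend_apply' _ _ _ (by simpa using hb)]
    rfl

/-- The function on the set of arrows `[μ, ν, z]` given by `φ(z)`, extended by zero. -/
def push (μ ν : u ⟶ v) (φ : C(Boundary (Vertex k) v, ℂ)) : C_c(Arr (Boundary (Vertex k) u), ℂ) where
  toFun := Function.extend (mkArr μ ν) φ 0
  continuous_toFun := continuous_extend_zero μ ν φ
  hasCompactSupport' := hasCompactSupport_extend μ ν φ

theorem push_mkArr (μ ν : u ⟶ v) (φ : C(Boundary (Vertex k) v, ℂ)) (z : Boundary (Vertex k) v) :
    push μ ν φ (mkArr μ ν z) = φ z :=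
  (mkArr_injective μ ν).extend_apply _ _ _

theorem push_of_notMem (μ ν : u ⟶ v) (φ : C(Boundary (Vertex k) v, ℂ))
    {a : Arr (Boundary (Vertex k) u)} (ha : a ∉ range (mkArr μ ν)) : push μ ν φ a = 0 :=
  Function.extend_apply' _ _ _ (by simpa using ha)

/-- The indicator function of the set of arrows `[μ, ν, z]`. -/
def matUnit (μ ν : u ⟶ v) : C_c(Arr (Boundary (Vertex k) u), ℂ) := push μ ν 1

theorem matUnit_of_mem {μ ν : u ⟶ v} {a : Arr (Boundary (Vertex k) u)}
    (h : a ∈ range (mkArr μ ν)) : matUnit μ ν a = 1 := by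
  obtain ⟨z, rfl⟩ := h
  exact push_mkArr _ _ _ _

theorem matUnit_of_notMem {μ ν : u ⟶ v} {a : Arr (Boundary (Vertex k) u)}
    (h : a ∉ range (mkArr μ ν)) : matUnit μ ν a = 0 := push_of_notMem _ _ _ h

theorem matUnit_congr {v' : Vertex k} {μ ν : u ⟶ v} {μ' ν' : u ⟶ v'}
    {a b : Arr (Boundary (Vertex k) u)} (h : a ∈ range (mkArr μ ν) ↔ b ∈ range (mkArr μ' ν')) :
    matUnit μ ν a = matUnit μ' ν' b := by
  by_cases ha : a ∈ range (mkArr μ ν)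
  · rw [matUnit_of_mem ha, matUnit_of_mem (h.1 ha)]
  · rw [matUnit_of_notMem ha, matUnit_of_notMem (fun hb => ha (h.2 hb))]

theorem matUnit_self_unitArr {μ : u ⟶ v} {x : Boundary (Vertex k) u} (h : x ∈ bdCylinder ⟨v, μ⟩) :
    matUnit μ μ (unitArr x) = 1 := by
  obtain ⟨y, rfl⟩ := exists_eq_bdExtend h
  exact matUnit_of_mem ⟨y, (unitArr_bdExtend μ y).symm⟩

theorem matUnit_self_unitArr_of_notMem {μ : u ⟶ v} {x : Boundary (Vertex k) u}
    (h : x ∉ bdCylinder ⟨v, μ⟩) : matUnit μ μ (unitArr x) = 0 := by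
  refine matUnit_of_notMem ?_
  rintro ⟨y, hy⟩
  obtain rfl : bdExtend μ y = x := congrArg Arr.r hy
  exact h (bdExtend_mem μ y)

theorem matUnit_unitArr_of_ne {μ ν : u ⟶ v} (h : μ ≠ ν) (x : Boundary (Vertex k) u) :
    matUnit μ ν (unitArr x) = 0 :=
  matUnit_of_notMem fun ⟨z, hz⟩ => unitArr_ne_mkArr h x z hz.symm

/-! ### Convolution products of indicator functions -/

/-- The paths `ν ≫ η = ν' ≫ η'` form a least common extension of `ν` and `ν'`. -/
structure IsLeastSquare {v' : Vertex k} (ν : u ⟶ v) (ν' : u ⟶ v') (η : v ⟶ w) (η' : v' ⟶ w) :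
    Prop where
  comm : ν ≫ η = ν' ≫ η'
  least : ∀ {w' : Vertex k} (δ : v ⟶ w') (δ' : v' ⟶ w'), ν ≫ δ = ν' ≫ δ' →
    ∃ ω : w ⟶ w', δ = η ≫ ω ∧ δ' = η' ≫ ω

theorem exists_isLeastSquare {v' w' : Vertex k} {ν : u ⟶ v} {ν' : u ⟶ v'} {δ : v ⟶ w'}
    {δ' : v' ⟶ w'} (h : ν ≫ δ = ν' ≫ δ') :
    ∃ (w : Vertex k) (η : v ⟶ w) (η' : v' ⟶ w), IsLeastSquare ν ν' η η' := by
  obtain ⟨⟨w, l⟩, ⟨(η : v ⟶ w), (hη : ν ≫ η = l)⟩, ⟨(η' : v' ⟶ w), (hη' : ν' ≫ η' = l)⟩, h5⟩ :=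
    exists_least_extension (p := ⟨v, ν⟩) (q := ⟨v', ν'⟩) (r := ⟨w', ν ≫ δ⟩)
      ⟨δ, rfl⟩ ⟨δ', h.symm⟩
  refine ⟨w, η, η', hη.trans hη'.symm, fun {w''} ε ε' h => ?_⟩
  obtain ⟨(ω : w ⟶ w''), (hω : l ≫ ω = ν ≫ ε)⟩ := h5 ⟨w'', ν ≫ ε⟩ ⟨ε, rfl⟩ ⟨ε', h.symm⟩
  refine ⟨ω, CategoryOfPaths.left_cancel ν _ _ ?_, CategoryOfPaths.left_cancel ν' _ _ ?_⟩
  · rw [← Category.assoc, hη, hω]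
  · rw [← Category.assoc, hη', hω, h]

theorem germOf_comp {x y z : Boundary (Vertex k) u} (g : x ⟶ y) (h : y ⟶ z) {p : Germ (Vertex k) u}
    (hp : Germ.IsProduct (germOf g) (germOf h) p) : germOf (g ≫ h) = p :=
  Germ.mul_eq (g.2.2.trans h.2.1.symm) hp

theorem comp_eq_mkArr {x y z : Boundary (Vertex k) u} {g : x ⟶ y} {h : y ⟶ z} {μ ν κ : u ⟶ v}
    {t : Boundary (Vertex k) v} (hg : (⟨x, y, g⟩ : Arr _) = mkArr μ ν t)
    (hh : (⟨y, z, h⟩ : Arr _) = mkArr ν κ t) : (⟨x, z, g ≫ h⟩ : Arr _) = mkArr μ κ t := by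
  refine arr_ext (germOf_comp g h ⟨v, μ, ν, κ, t.1, ?_, ?_, rfl⟩)
  · exact congrArg (fun a : Arr (Boundary (Vertex k) u) => germOf a.hom) hg
  · exact congrArg (fun a : Arr (Boundary (Vertex k) u) => germOf a.hom) hh

theorem inv_eq_mkArr {x y : Boundary (Vertex k) u} {g : x ⟶ y} {μ ν : u ⟶ v}
    {t : Boundary (Vertex k) v} (hg : (⟨x, y, g⟩ : Arr _) = mkArr μ ν t) :
    (⟨y, x, Groupoid.inv g⟩ : Arr _) = mkArr ν μ t := by
  have h : germOf g = Germ.mk μ ν t.1 :=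
    congrArg (fun a : Arr (Boundary (Vertex k) u) => germOf a.hom) hg
  refine arr_ext ?_
  change (germOf g).inv = _
  rw [h]
  rfl

theorem involution_matUnit (μ ν : u ⟶ v) :
    ⇑(matUnit ν μ) = involution (matUnit μ ν : Arr (Boundary (Vertex k) u) → ℂ) := by
  funext a
  obtain ⟨x, y, g⟩ := a
  have h : (⟨x, y, g⟩ : Arr (Boundary (Vertex k) u)) ∈ range (mkArr ν μ) ↔
      (⟨y, x, Groupoid.inv g⟩ : Arr (Boundary (Vertex k) u)) ∈ range (mkArr μ ν) := by
    constructor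
    · rintro ⟨t, ht⟩
      exact ⟨t, (inv_eq_mkArr ht.symm).symm⟩
    · rintro ⟨t, ht⟩
      have := inv_eq_mkArr ht.symm
      rw [show Groupoid.inv (Groupoid.inv g) = g by simp] at this
      exact ⟨t, this.symm⟩
  rw [involution]
  by_cases ha : (⟨x, y, g⟩ : Arr (Boundary (Vertex k) u)) ∈ range (mkArr ν μ)
  · rw [matUnit_of_mem ha, matUnit_of_mem (h.1 ha), map_one]
  · rw [matUnit_of_notMem ha, matUnit_of_notMem (fun hb => ha (h.2 hb)), map_zero]

/-- The sum in the convolution has at most one nonzero term, as `μ` and the range determine the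
arrow `[μ, ν, z]`. -/
theorem convolution_matUnit_apply {v' : Vertex k} (μ ν : u ⟶ v) (ν' κ : u ⟶ v')
    (z : Boundary (Vertex k) v) {y : Boundary (Vertex k) u} (g : bdExtend μ z ⟶ y) :
    convolution (matUnit μ ν : Arr (Boundary (Vertex k) u) → ℂ) (matUnit ν' κ) ⟨_, y, g⟩ =
      matUnit ν' κ ⟨bdExtend ν z, y, Groupoid.inv (mkHom μ ν z) ≫ g⟩ := by
  rw [convolution, tsum_eq_single ⟨bdExtend ν z, mkHom μ ν z⟩]
  · have : matUnit μ ν (⟨bdExtend μ z, bdExtend ν z, mkHom μ ν z⟩ : Arr _) = 1 :=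
      matUnit_of_mem ⟨z, rfl⟩
    rw [this, one_mul]
  · rintro ⟨t, (a : bdExtend μ z ⟶ t)⟩ hne
    have : (⟨bdExtend μ z, t, a⟩ : Arr (Boundary (Vertex k) u)) ∉ range (mkArr μ ν) := by
      rintro ⟨z', hz'⟩
      obtain rfl : z' = z := bdExtend_injective μ (congrArg Arr.r hz')
      apply hne
      obtain rfl : bdExtend ν z' = t := congrArg Arr.s hz'
      have h : a = mkHom μ ν z' := Subtype.ext
        (congrArg (fun a : Arr (Boundary (Vertex k) u) => germOf a.hom) hz').symm
      rw [h]
    rw [matUnit_of_notMem this, zero_mul]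

theorem convolution_matUnit_apply_of_notMem {v' : Vertex k} (μ ν : u ⟶ v) (ν' κ : u ⟶ v')
    {a : Arr (Boundary (Vertex k) u)} (ha : a.r ∉ range (bdExtend μ)) :
    convolution (matUnit μ ν : Arr (Boundary (Vertex k) u) → ℂ) (matUnit ν' κ) a = 0 := by
  rw [convolution]
  convert tsum_zero with b
  rw [matUnit_of_notMem, zero_mul]
  rintro ⟨z', hz'⟩
  exact ha ⟨z', congrArg Arr.r hz'⟩

/-- The product of `e(μ, ν)` and `e(ν', κ)` is `e(μη, κη')` if `νη = ν'η'` is the least common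
extension of `ν` and `ν'`. -/
theorem convolution_matUnit {v' : Vertex k} (μ : u ⟶ v) {ν : u ⟶ v} {ν' : u ⟶ v'} (κ : u ⟶ v')
    {η : v ⟶ w} {η' : v' ⟶ w} (h : IsLeastSquare ν ν' η η') :
    ⇑(matUnit (μ ≫ η) (κ ≫ η')) =
      convolution (matUnit μ ν : Arr (Boundary (Vertex k) u) → ℂ) (matUnit ν' κ) := by
  funext a
  by_cases ha : a.r ∈ range (bdExtend μ)
  · obtain ⟨x, y, g⟩ := a
    obtain ⟨z, rfl⟩ := ha
    rw [convolution_matUnit_apply]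
    refine matUnit_congr ⟨?_, ?_⟩
    · rintro ⟨t, ht⟩
      have hr := congrArg Arr.r ht
      change bdExtend (μ ≫ η) t = bdExtend μ z at hr
      rw [bdExtend_comp] at hr
      obtain rfl := bdExtend_injective μ hr
      refine ⟨bdExtend η' t, ?_⟩
      rw [mkArr_extend, ← h.comm]
      refine (comp_eq_mkArr (inv_eq_mkArr ?_) ht.symm).symm
      exact mkArr_extend μ ν η t
    · rintro ⟨t, ht⟩
      obtain ⟨w', δ', δ, s, rfl, rfl, h3⟩ :=
        exists_common_bdExtend (μ := ν') (μ' := ν) (congrArg Arr.r ht)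
      obtain ⟨ω, rfl, rfl⟩ := h.least _ _ h3.symm
      refine ⟨bdExtend ω s, ?_⟩
      rw [mkArr_extend, Category.assoc, Category.assoc]
      rw [mkArr_extend, h3] at ht
      have h1 : (⟨bdExtend μ (bdExtend (η ≫ ω) s), bdExtend ν (bdExtend (η ≫ ω) s),
          mkHom μ ν (bdExtend (η ≫ ω) s)⟩ : Arr _) = mkArr (μ ≫ η ≫ ω) (ν ≫ η ≫ ω) s :=
        mkArr_extend μ ν (η ≫ ω) s
      have := comp_eq_mkArr h1 ht.symm
      rw [← this]
      simp
  · rw [convolution_matUnit_apply_of_notMem _ _ _ _ ha, matUnit_of_notMem]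
    rintro ⟨t, rfl⟩
    exact ha ⟨bdExtend η t, (bdExtend_comp _ _ _).symm⟩

theorem convolution_matUnit_eq_zero {v' : Vertex k} (μ : u ⟶ v) {ν : u ⟶ v} {ν' : u ⟶ v'}
    (κ : u ⟶ v') (h : ∀ (w : Vertex k) (η : v ⟶ w) (η' : v' ⟶ w), ν ≫ η ≠ ν' ≫ η') :
    ⇑(0 : C_c(Arr (Boundary (Vertex k) u), ℂ)) =
      convolution (matUnit μ ν : Arr (Boundary (Vertex k) u) → ℂ) (matUnit ν' κ) := by
  funext a
  by_cases ha : a.r ∈ range (bdExtend μ)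
  · obtain ⟨x, y, g⟩ := a
    obtain ⟨z, rfl⟩ := ha
    rw [convolution_matUnit_apply, matUnit_of_notMem]
    · rfl
    · rintro ⟨t, ht⟩
      obtain ⟨w', δ', δ, s, -, -, h3⟩ :=
        exists_common_bdExtend (μ := ν') (μ' := ν) (congrArg Arr.r ht)
      exact h _ _ _ h3.symm
  · rw [convolution_matUnit_apply_of_notMem _ _ _ _ ha]
    rfl

theorem isLeastSquare_self (ν : u ⟶ v) : IsLeastSquare ν ν (𝟙 v) (𝟙 v) :=
  ⟨rfl, fun δ δ' h => ⟨δ, by simp, by simp [CategoryOfPaths.left_cancel _ _ _ h]⟩⟩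

/-! ### The relation between the indicator functions of cylinder sets -/

/-- The edge with range `v` given by a letter. -/
def edge (v : Vertex k) (a : Letter) (h : ValidLetter k v.index a) :
    v ⟶ (⟨v.index + 1⟩ : Vertex k) :=
  homMk (letter a) (valid_letter.2 h) (by simp)

theorem mem_bdExtend_comp {μ : u ⟶ v} {η : v ⟶ w} {y : Boundary (Vertex k) v} :
    bdExtend μ y ∈ bdCylinder ⟨w, μ ≫ η⟩ ↔ y ∈ bdCylinder ⟨w, η⟩ :=
  prepend_mem_extend (μ := μ) (p := ⟨w, η⟩)

/-- The edge `α` with range `v`. -/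
def edgeα (v : Vertex k) : v ⟶ (⟨v.index + 1⟩ : Vertex k) := edge v .α trivial

/-- The edge `β` with range `v`. -/
def edgeβ (v : Vertex k) : v ⟶ (⟨v.index + 1⟩ : Vertex k) := edge v .β trivial

/-- The edge `γ j` with range `v`. -/
def edgeγ (v : Vertex k) (j : Fin (k v.index)) : v ⟶ (⟨v.index + 1⟩ : Vertex k) :=
  edge v (.γ j) j.2

/-- The product `αβ` of edges with range `v`. -/
def edgeαβ (v : Vertex k) : v ⟶ (⟨v.index + 2⟩ : Vertex k) :=
  homMk (letter .α * letter .β) (valid_of_countγ (by simp)) (by simp)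

theorem mem_edgeαβ {y : Boundary (Vertex k) v} : y ∈ bdCylinder ⟨_, edgeαβ v⟩ ↔
    y ∈ bdCylinder ⟨_, edgeα v⟩ ∧ y ∈ bdCylinder ⟨_, edgeβ v⟩ := by
  constructor
  · intro h
    refine ⟨y.1.hereditary _ _ h (isPrefix_iff.2 ⟨letter .β, rfl⟩),
      y.1.hereditary _ _ h (isPrefix_iff.2 ⟨letter .α, ?_⟩)⟩
    exact letter_commute.eq
  · rintro ⟨h1, h2⟩
    obtain ⟨c, hc, h1, h2⟩ := y.1.directed _ h1 _ h2
    refine y.1.hereditary _ _ hc (isPrefix_iff.2 ?_)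
    obtain ⟨p, hp⟩ := isPrefix_iff.1 h1
    obtain ⟨q, hq⟩ := isPrefix_iff.1 h2
    change val c = letter .α * p at hp
    change val c = letter .β * q at hq
    obtain ⟨-, z, rfl, -⟩ := letter_mul_eq_letter_mul (by simp) (hp.symm.trans hq)
    exact ⟨z, by rw [hp, ← mul_assoc]; rfl⟩

theorem exists_edge_mem (y : Boundary (Vertex k) v) :
    ∃ (a : Letter) (h : ValidLetter k v.index a), y ∈ bdCylinder ⟨_, edge v a h⟩ := by
  obtain ⟨p, hp, -, hn⟩ := (isUnbounded_boundary y).exists_extension (id_mem y.1) (n := 1)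
    (by simp)
  obtain ⟨a, m, hm⟩ := exists_letter_mul (m := val p) (by intro h; simp [h] at hn)
  have hv := val_valid p
  rw [hm, valid_letter_mul] at hv
  exact ⟨a, hv.1, y.1.hereditary _ _ hp (isPrefix_iff.2 ⟨m, hm⟩)⟩

theorem edge_eq_of_gamma_mem {y : Boundary (Vertex k) v} {j : ℕ} {h : ValidLetter k v.index (.γ j)}
    (hy : y ∈ bdCylinder ⟨_, edge v (.γ j) h⟩) {a : Letter} {h' : ValidLetter k v.index a}
    (hy' : y ∈ bdCylinder ⟨_, edge v a h'⟩) : a = .γ j := by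
  rcases isPrefix_gamma hy hy' (l := 1) (one_mul _).symm with h | h
  · have := weight_dvd (fun _ => 1) h
    change len (letter a) ≤ len 1 at this
    simp at this
  · by_contra hne
    obtain ⟨q, hq⟩ := h
    have hq : letter a * 1 = letter (.γ j) * q := by rw [mul_one]; exact hq
    rcases (letter_mul_eq_letter_mul hne hq).1 with h | h <;> simp at h

/-- Every point of the boundary begins with an edge, and with two different edges only if it
begins with `αβ = βα`. -/
theorem matUnit_self_eq (μ : u ⟶ v) :
    matUnit μ μ = matUnit (μ ≫ edgeα v) (μ ≫ edgeα v) +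
      matUnit (μ ≫ edgeβ v) (μ ≫ edgeβ v) -
      matUnit (μ ≫ edgeαβ v) (μ ≫ edgeαβ v) +
      ∑ j : Fin (k v.index), matUnit (μ ≫ edgeγ v j) (μ ≫ edgeγ v j) := by
  ext a
  simp only [CompactlySupportedContinuousMap.coe_add, CompactlySupportedContinuousMap.coe_sub,
    CompactlySupportedContinuousMap.coe_sum, Pi.add_apply, Pi.sub_apply, Finset.sum_apply]
  have hnot : ∀ {w : Vertex k} (η : v ⟶ w), a ∉ range (mkArr μ μ) →
      matUnit (μ ≫ η) (μ ≫ η) a = 0 := by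
    intro w η ha
    refine matUnit_of_notMem ?_
    rintro ⟨t, rfl⟩
    exact ha ⟨bdExtend η t, mkArr_extend _ _ _ _⟩
  by_cases ha : a ∈ range (mkArr μ μ)
  swap
  · rw [matUnit_of_notMem ha, hnot _ ha, hnot _ ha, hnot _ ha]
    simp [hnot _ ha]
  obtain ⟨y, rfl⟩ := ha
  rw [← unitArr_bdExtend]
  have hmem : ∀ {w : Vertex k} (η : v ⟶ w), y ∈ bdCylinder ⟨w, η⟩ →
      matUnit (μ ≫ η) (μ ≫ η) (unitArr (bdExtend μ y)) = 1 :=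
    fun η h => matUnit_self_unitArr (mem_bdExtend_comp.2 h)
  have hmem' : ∀ {w : Vertex k} (η : v ⟶ w), y ∉ bdCylinder ⟨w, η⟩ →
      matUnit (μ ≫ η) (μ ≫ η) (unitArr (bdExtend μ y)) = 0 :=
    fun η h => matUnit_self_unitArr_of_notMem fun h' => h (mem_bdExtend_comp.1 h')
  rw [matUnit_self_unitArr (bdExtend_mem μ y)]
  obtain ⟨a, h, hy⟩ := exists_edge_mem y
  by_cases hγ : ∃ (j : ℕ) (h : ValidLetter k v.index (.γ j)), y ∈ bdCylinder ⟨_, edge v (.γ j) h⟩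
  · obtain ⟨j, h, hy⟩ := hγ
    have hne : ∀ (a : Letter) (h' : ValidLetter k v.index a), a ≠ .γ j →
        y ∉ bdCylinder ⟨_, edge v a h'⟩ := fun a h' hne hy' => hne (edge_eq_of_gamma_mem hy hy')
    rw [hmem' (edgeα v) (hne .α trivial (by simp)), hmem' (edgeβ v) (hne .β trivial (by simp)),
      hmem' (edgeαβ v) (fun h => hne .α trivial (by simp) (mem_edgeαβ.1 h).1),
      Finset.sum_eq_single ⟨j, h⟩, hmem (edgeγ v ⟨j, h⟩) hy]
    · simp
    · intro i _ hi
      exact hmem' (edgeγ v i) (hne (.γ i) i.2 fun e => hi (Fin.ext (by simpa using e)))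
    · simp
  · rw [Finset.sum_eq_zero fun j _ => hmem' (edgeγ v j) fun h => hγ ⟨j, _, h⟩]
    by_cases hα : y ∈ bdCylinder ⟨_, edgeα v⟩ <;>
      by_cases hβ : y ∈ bdCylinder ⟨_, edgeβ v⟩
    · rw [hmem _ hα, hmem _ hβ, hmem _ (mem_edgeαβ.2 ⟨hα, hβ⟩)]
      simp
    · rw [hmem _ hα, hmem' _ hβ, hmem' (edgeαβ v) (fun h => hβ (mem_edgeαβ.1 h).2)]
      simp
    · rw [hmem' _ hα, hmem _ hβ, hmem' (edgeαβ v) (fun h => hα (mem_edgeαβ.1 h).1)]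
      simp
    · cases a with
      | α => exact absurd hy hα
      | β => exact absurd hy hβ
      | γ j => exact absurd ⟨j, h, hy⟩ hγ

end

section

variable {k : ℕ → ℕ} {u v w : Vertex k}

/-! ### Decomposition of compactly supported functions and the `I`-norm -/

theorem push_add (μ ν : u ⟶ v) (φ ψ : C(Boundary (Vertex k) v, ℂ)) :
    push μ ν (φ + ψ) = push μ ν φ + push μ ν ψ := by
  ext a
  by_cases ha : a ∈ range (mkArr μ ν)
  · obtain ⟨z, rfl⟩ := ha
    simp [push_mkArr]
  · simp [push_of_notMem _ _ _ ha]

theorem push_smul (μ ν : u ⟶ v) (c : ℂ) (φ : C(Boundary (Vertex k) v, ℂ)) :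
    push μ ν (c • φ) = c • push μ ν φ := by
  ext a
  by_cases ha : a ∈ range (mkArr μ ν)
  · obtain ⟨z, rfl⟩ := ha
    simp [push_mkArr]
  · simp [push_of_notMem _ _ _ ha]

/-- Every compactly supported continuous function on the set of arrows is a finite sum of functions
supported on the compact open bisections `[μ, ν, ∂]`. -/
theorem cc_induction {P : C_c(Arr (Boundary (Vertex k) u), ℂ) → Prop} (zero : P 0)
    (add : ∀ f g, P f → P g → P (f + g))
    (push : ∀ (v : Vertex k) (μ ν : u ⟶ v) (φ : C(Boundary (Vertex k) v, ℂ)), P (push μ ν φ))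
    (f : C_c(Arr (Boundary (Vertex k) u), ℂ)) : P f := by
  let B : (Σ v : Vertex k, (u ⟶ v) × (u ⟶ v)) → Set (Arr (Boundary (Vertex k) u)) :=
    fun i => range (mkArr i.2.1 i.2.2)
  obtain ⟨t, ht⟩ := f.hasCompactSupport.isCompact.elim_finite_subcover B
    (fun i => (isClopen_range_mkArr _ _).isOpen) fun a _ => by
      obtain ⟨v, μ, ν, z, rfl⟩ := exists_mkArr a
      exact mem_iUnion.2 ⟨⟨v, μ, ν⟩, z, rfl⟩
  have hsub : ∀ a, f a ≠ 0 → ∃ i ∈ t, a ∈ B i := fun a ha => by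
    simpa using ht (subset_tsupport _ ha)
  clear ht
  classical
  induction t using Finset.induction_on generalizing f with
  | empty =>
    convert zero
    ext a
    by_contra ha
    obtain ⟨i, hi, -⟩ := hsub a ha
    simp at hi
  | insert i t hi ih =>
    let φ : C(Boundary (Vertex k) i.1, ℂ) :=
      f.toContinuousMap.comp ⟨mkArr i.2.1 i.2.2, continuous_mkArr _ _⟩
    have h : f = PathGroupoid.push i.2.1 i.2.2 φ + (f - PathGroupoid.push i.2.1 i.2.2 φ) := by abel
    rw [h]
    refine add _ _ (push _ _ _ _) (ih _ fun a ha => ?_)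
    by_cases hai : a ∈ B i
    · obtain ⟨z, rfl⟩ := hai
      rw [CompactlySupportedContinuousMap.sub_apply, push_mkArr] at ha
      exact absurd (sub_self _) ha
    · rw [CompactlySupportedContinuousMap.sub_apply, push_of_notMem _ _ _ hai, sub_zero] at ha
      obtain ⟨j, hj, hj'⟩ := hsub a ha
      rcases Finset.mem_insert.1 hj with rfl | hj
      · exact absurd hj' hai
      · exact ⟨j, hj, hj'⟩

/-- The arrows with a given range. -/
abbrev ArrowsFrom (x : Boundary (Vertex k) u) : Type := Σ z : Boundary (Vertex k) u, (x ⟶ z)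

/-- The arrows with a given source. -/
abbrev ArrowsTo (x : Boundary (Vertex k) u) : Type := Σ z : Boundary (Vertex k) u, (z ⟶ x)

theorem subsingleton_push_from (μ ν : u ⟶ v) (φ : C(Boundary (Vertex k) v, ℂ))
    (x : Boundary (Vertex k) u) :
    {a : ArrowsFrom x | push μ ν φ ⟨x, a.1, a.2⟩ ≠ 0}.Subsingleton := by
  rintro ⟨z, a⟩ ha ⟨z', a'⟩ ha'
  have h1 := not_imp_comm.1 (push_of_notMem μ ν φ) ha
  have h2 := not_imp_comm.1 (push_of_notMem μ ν φ) ha'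
  obtain ⟨t, ht⟩ := h1
  obtain ⟨t', ht'⟩ := h2
  obtain rfl := bdExtend_injective μ ((congrArg Arr.r ht).trans (congrArg Arr.r ht').symm)
  have := ht.symm.trans ht'
  obtain rfl : z = z' := congrArg Arr.s this
  rw [show a = a' from Subtype.ext
    (congrArg (fun a : Arr (Boundary (Vertex k) u) => germOf a.hom) this)]

theorem subsingleton_push_to (μ ν : u ⟶ v) (φ : C(Boundary (Vertex k) v, ℂ))
    (x : Boundary (Vertex k) u) :
    {a : ArrowsTo x | push μ ν φ ⟨a.1, x, a.2⟩ ≠ 0}.Subsingleton := by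
  rintro ⟨z, a⟩ ha ⟨z', a'⟩ ha'
  have h1 := not_imp_comm.1 (push_of_notMem μ ν φ) ha
  have h2 := not_imp_comm.1 (push_of_notMem μ ν φ) ha'
  obtain ⟨t, ht⟩ := h1
  obtain ⟨t', ht'⟩ := h2
  obtain rfl := bdExtend_injective ν ((congrArg Arr.s ht).trans (congrArg Arr.s ht').symm)
  have := ht.symm.trans ht'
  obtain rfl : z = z' := congrArg Arr.r this
  rw [show a = a' from Subtype.ext
    (congrArg (fun a : Arr (Boundary (Vertex k) u) => germOf a.hom) this)]

theorem tsum_norm_le_of_subsingleton {ι : Type*} {f : ι → ℂ} {C : ℝ}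
    (h : {a | f a ≠ 0}.Subsingleton) (hC : 0 ≤ C) (hf : ∀ a, ‖f a‖ ≤ C) : ∑' a, ‖f a‖ ≤ C := by
  by_cases hex : ∃ a, f a ≠ 0
  · obtain ⟨a, ha⟩ := hex
    rw [tsum_eq_single a]
    · exact hf a
    · intro b hb
      by_contra hne
      exact hb (h (fun h0 => hne (by rw [h0, norm_zero])) ha)
  · push Not at hex
    simp [hex, hC]

theorem norm_push_le (μ ν : u ⟶ v) (φ : C(Boundary (Vertex k) v, ℂ))
    (a : Arr (Boundary (Vertex k) u)) : ‖push μ ν φ a‖ ≤ ‖φ‖ := by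
  by_cases ha : a ∈ range (mkArr μ ν)
  · obtain ⟨z, rfl⟩ := ha
    rw [push_mkArr]
    exact φ.norm_coe_le_norm z
  · rw [push_of_notMem _ _ _ ha, norm_zero]
    exact norm_nonneg _

theorem iNorm_push_le (μ ν : u ⟶ v) (φ : C(Boundary (Vertex k) v, ℂ)) :
    iNorm (push μ ν φ) ≤ ‖φ‖ :=
  max_le
    (Real.iSup_le (fun x => tsum_norm_le_of_subsingleton (subsingleton_push_from μ ν φ x)
      (norm_nonneg _) fun _ => norm_push_le _ _ _ _) (norm_nonneg _))
    (Real.iSup_le (fun x => tsum_norm_le_of_subsingleton (subsingleton_push_to μ ν φ x)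
      (norm_nonneg _) fun _ => norm_push_le _ _ _ _) (norm_nonneg _))

theorem iNorm_nonneg (f : Arr (Boundary (Vertex k) u) → ℂ) : 0 ≤ iNorm f :=
  le_max_of_le_left (Real.iSup_nonneg fun _ => tsum_nonneg fun _ => norm_nonneg _)

theorem exists_bound_of_add {J : Type*} {ι : J → Type*} {f g : ∀ x, ι x → ℂ}
    (hf : ∃ C, ∀ x, {a | f x a ≠ 0}.Finite ∧ ∑' a, ‖f x a‖ ≤ C)
    (hg : ∃ C, ∀ x, {a | g x a ≠ 0}.Finite ∧ ∑' a, ‖g x a‖ ≤ C) :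
    ∃ C, ∀ x, {a | f x a + g x a ≠ 0}.Finite ∧ ∑' a, ‖f x a + g x a‖ ≤ C := by
  obtain ⟨C, hC⟩ := hf
  obtain ⟨D, hD⟩ := hg
  have hsum : ∀ {x} (h : ι x → ℂ), {a | h a ≠ 0}.Finite → Summable fun a => ‖h a‖ := fun h hh =>
    summable_of_hasFiniteSupport (hh.subset fun a ha => by simpa using ha)
  refine ⟨C + D, fun x => ?_⟩
  have hfin : {a | f x a + g x a ≠ 0}.Finite := by
    refine ((hC x).1.union (hD x).1).subset fun a ha => ?_
    by_contra h
    simp only [mem_union, mem_ofPred_eq, not_or, not_not] at h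
    exact ha (by rw [h.1, h.2, add_zero])
  refine ⟨hfin, ?_⟩
  calc ∑' a, ‖f x a + g x a‖ ≤ ∑' a, (‖f x a‖ + ‖g x a‖) :=
        (hsum _ hfin).tsum_le_tsum (fun a => norm_add_le _ _)
          ((hsum _ (hC x).1).add (hsum _ (hD x).1))
    _ = ∑' a, ‖f x a‖ + ∑' a, ‖g x a‖ := (hsum _ (hC x).1).tsum_add (hsum _ (hD x).1)
    _ ≤ C + D := add_le_add (hC x).2 (hD x).2

theorem exists_bound_from (f : C_c(Arr (Boundary (Vertex k) u), ℂ)) :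
    ∃ C, ∀ x : Boundary (Vertex k) u, {a : ArrowsFrom x | f ⟨x, a.1, a.2⟩ ≠ 0}.Finite ∧
      ∑' a : ArrowsFrom x, ‖f ⟨x, a.1, a.2⟩‖ ≤ C := by
  induction f using cc_induction with
  | zero => exact ⟨0, fun x => by simp⟩
  | add f g hf hg =>
    exact exists_bound_of_add (f := fun x (a : ArrowsFrom x) => f ⟨x, a.1, a.2⟩)
      (g := fun x (a : ArrowsFrom x) => g ⟨x, a.1, a.2⟩) hf hg
  | push v μ ν φ => exact ⟨‖φ‖, fun x => ⟨(subsingleton_push_from μ ν φ x).finite,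
      tsum_norm_le_of_subsingleton (subsingleton_push_from μ ν φ x) (norm_nonneg _)
        fun _ => norm_push_le _ _ _ _⟩⟩

theorem exists_bound_to (f : C_c(Arr (Boundary (Vertex k) u), ℂ)) :
    ∃ C, ∀ x : Boundary (Vertex k) u, {a : ArrowsTo x | f ⟨a.1, x, a.2⟩ ≠ 0}.Finite ∧
      ∑' a : ArrowsTo x, ‖f ⟨a.1, x, a.2⟩‖ ≤ C := by
  induction f using cc_induction with
  | zero => exact ⟨0, fun x => by simp⟩
  | add f g hf hg =>
    exact exists_bound_of_add (f := fun x (a : ArrowsTo x) => f ⟨a.1, x, a.2⟩)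
      (g := fun x (a : ArrowsTo x) => g ⟨a.1, x, a.2⟩) hf hg
  | push v μ ν φ => exact ⟨‖φ‖, fun x => ⟨(subsingleton_push_to μ ν φ x).finite,
      tsum_norm_le_of_subsingleton (subsingleton_push_to μ ν φ x) (norm_nonneg _)
        fun _ => norm_push_le _ _ _ _⟩⟩

theorem tsum_from_le_iNorm (f : C_c(Arr (Boundary (Vertex k) u), ℂ)) (x : Boundary (Vertex k) u) :
    ∑' a : ArrowsFrom x, ‖f ⟨x, a.1, a.2⟩‖ ≤ iNorm f := by
  obtain ⟨C, hC⟩ := exists_bound_from f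
  exact (le_ciSup (f := fun x => ∑' a : ArrowsFrom x, ‖f ⟨x, a.1, a.2⟩‖)
    ⟨C, by rintro _ ⟨x, rfl⟩; exact (hC x).2⟩ x).trans (le_max_left _ _)

theorem tsum_to_le_iNorm (f : C_c(Arr (Boundary (Vertex k) u), ℂ)) (x : Boundary (Vertex k) u) :
    ∑' a : ArrowsTo x, ‖f ⟨a.1, x, a.2⟩‖ ≤ iNorm f := by
  obtain ⟨C, hC⟩ := exists_bound_to f
  exact (le_ciSup (f := fun x => ∑' a : ArrowsTo x, ‖f ⟨a.1, x, a.2⟩‖)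
    ⟨C, by rintro _ ⟨x, rfl⟩; exact (hC x).2⟩ x).trans (le_max_right _ _)

theorem finite_from (f : C_c(Arr (Boundary (Vertex k) u), ℂ)) (x : Boundary (Vertex k) u) :
    {a : ArrowsFrom x | f ⟨x, a.1, a.2⟩ ≠ 0}.Finite :=
  ((exists_bound_from f).choose_spec x).1

theorem finite_to (f : C_c(Arr (Boundary (Vertex k) u), ℂ)) (x : Boundary (Vertex k) u) :
    {a : ArrowsTo x | f ⟨a.1, x, a.2⟩ ≠ 0}.Finite :=
  ((exists_bound_to f).choose_spec x).1

end

section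

variable {k : ℕ → ℕ} {u v w : Vertex k}

/-! ### The canonical map to the full C*-algebra -/

section General

variable {X : Type} [Groupoid.{0} X] [TopologicalSpace (Arr X)]

theorem universalRep_add (f g : C_c(Arr X, ℂ)) :
    universalRep (f + g) = universalRep f + universalRep g :=
  lp.ext (funext fun π => map_add π.toLin f g)

theorem universalRep_smul (c : ℂ) (f : C_c(Arr X, ℂ)) :
    universalRep (c • f) = c • universalRep f :=
  lp.ext (funext fun π => map_smul π.toLin c f)

theorem universalRep_mul {f g h : C_c(Arr X, ℂ)} (e : ⇑h = convolution f g) :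
    universalRep f * universalRep g = universalRep h :=
  lp.ext (funext fun π => (π.map_convolution f g h e).symm)

theorem universalRep_star {f h : C_c(Arr X, ℂ)} (e : ⇑h = involution f) :
    star (universalRep f) = universalRep h :=
  lp.ext (funext fun π => (π.map_involution f h e).symm)

theorem norm_universalRep_le {f : C_c(Arr X, ℂ)} (h : 0 ≤ iNorm f) :
    ‖universalRep f‖ ≤ iNorm f :=
  lp.norm_le_of_forall_le (f := universalRep f) h fun π => π.norm_le f

/-- The canonical map to the full C*-algebra as a linear map. -/
def toFullCStarₗ (X : Type) [Groupoid.{0} X] [TopologicalSpace (Arr X)] :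
    C_c(Arr X, ℂ) →ₗ[ℂ] FullCStar X where
  toFun := toFullCStar
  map_add' f g := Subtype.ext (universalRep_add f g)
  map_smul' c f := Subtype.ext (universalRep_smul c f)

theorem toFullCStar_mul {f g h : C_c(Arr X, ℂ)} (e : ⇑h = convolution f g) :
    toFullCStar f * toFullCStar g = toFullCStar h :=
  Subtype.ext (universalRep_mul e)

theorem toFullCStar_star {f h : C_c(Arr X, ℂ)} (e : ⇑h = involution f) :
    star (toFullCStar f) = toFullCStar h :=
  Subtype.ext (universalRep_star e)

end General

/-! ### Density of the span of the indicator functions -/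

/-- The indicator function of a cylinder set. -/
def cylIndicator (p : PathsFrom (Vertex k) v) : C(Boundary (Vertex k) v, ℂ) where
  toFun := (bdCylinder p).indicator 1
  continuous_toFun := continuous_one.indicator (by simp [(isClopen_bdCylinder p).frontier_eq])

theorem cylIndicator_mul (p q : PathsFrom (Vertex k) v) :
    (∃ l, cylIndicator p * cylIndicator q = cylIndicator l) ∨
      cylIndicator p * cylIndicator q = 0 := by
  have hmul : ∀ x : Boundary (Vertex k) v, (cylIndicator p * cylIndicator q) x =
      (bdCylinder p ∩ bdCylinder q).indicator 1 x := fun x => by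
    change (bdCylinder p).indicator (1 : Boundary (Vertex k) v → ℂ) x *
      (bdCylinder q).indicator (1 : Boundary (Vertex k) v → ℂ) x = _
    by_cases hp : x ∈ bdCylinder p <;> by_cases hq : x ∈ bdCylinder q <;> simp [hp, hq]
  by_cases h : ∃ c, IsPrefix p c ∧ IsPrefix q c
  · obtain ⟨c, h1, h2⟩ := h
    obtain ⟨l, h3, h4, h5⟩ := exists_least_extension h1 h2
    left
    refine ⟨l, ContinuousMap.ext fun x => ?_⟩
    rw [hmul]
    change _ = (bdCylinder l).indicator 1 x
    congr 1
    ext x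
    constructor
    · rintro ⟨hp, hq⟩
      obtain ⟨d, hd, k1, k2⟩ := x.1.directed _ hp _ hq
      exact x.1.hereditary _ _ hd (h5 _ k1 k2)
    · intro hx
      exact ⟨x.1.hereditary _ _ hx h3, x.1.hereditary _ _ hx h4⟩
  · right
    refine ContinuousMap.ext fun x => ?_
    rw [hmul, indicator_of_notMem]
    · rfl
    · rintro ⟨hp, hq⟩
      obtain ⟨d, hd, k1, k2⟩ := x.1.directed _ hp _ hq
      exact h ⟨d, k1, k2⟩

theorem cylIndicator_id : cylIndicator (⟨v, 𝟙 v⟩ : PathsFrom (Vertex k) v) = 1 := by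
  refine ContinuousMap.ext fun x => ?_
  have h : x ∈ bdCylinder ⟨v, 𝟙 v⟩ := id_mem x.1
  exact indicator_of_mem h _

theorem star_cylIndicator (p : PathsFrom (Vertex k) v) :
    star (cylIndicator p) = cylIndicator p := by
  refine ContinuousMap.ext fun x => ?_
  change star ((bdCylinder p).indicator 1 x) = (bdCylinder p).indicator 1 x
  by_cases h : x ∈ bdCylinder p <;> simp [h]

/-- The span of the indicator functions of cylinder sets. -/
def cylSpan (v : Vertex k) : Submodule ℂ C(Boundary (Vertex k) v, ℂ) :=
  Submodule.span ℂ (range cylIndicator)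

theorem mul_mem_cylSpan {φ ψ : C(Boundary (Vertex k) v, ℂ)} (hφ : φ ∈ cylSpan v)
    (hψ : ψ ∈ cylSpan v) : φ * ψ ∈ cylSpan v := by
  have h := Submodule.mul_mem_mul hφ hψ
  rw [cylSpan, Submodule.span_mul_span] at h
  refine Submodule.span_le.2 ?_ h
  rintro _ ⟨_, ⟨p, rfl⟩, _, ⟨q, rfl⟩, rfl⟩
  rcases cylIndicator_mul p q with ⟨l, hl⟩ | hl
  · exact Submodule.subset_span ⟨l, hl.symm⟩
  · change cylIndicator p * cylIndicator q ∈ cylSpan v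
    rw [hl]
    exact zero_mem _

/-- The star subalgebra spanned by the indicator functions of cylinder sets. -/
def cylAlgebra (v : Vertex k) : StarSubalgebra ℂ C(Boundary (Vertex k) v, ℂ) where
  toSubalgebra := (cylSpan v).toSubalgebra (Submodule.subset_span ⟨_, cylIndicator_id⟩)
    fun _ _ => mul_mem_cylSpan
  star_mem' := by
    intro φ hφ
    change star φ ∈ cylSpan v
    induction (show φ ∈ cylSpan v from hφ) using Submodule.span_induction with
    | mem _ h =>
      obtain ⟨p, rfl⟩ := h
      rw [star_cylIndicator]
      exact Submodule.subset_span ⟨p, rfl⟩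
    | zero => simp
    | add _ _ h1 h2 ih1 ih2 =>
      rw [star_add]
      exact add_mem (ih1 h1) (ih2 h2)
    | smul c _ h ih =>
      rw [star_smul]
      exact Submodule.smul_mem _ _ (ih h)

/-- The Stone–Weierstrass theorem: the cylinder sets separate the points, and their indicator
functions span a star subalgebra. -/
theorem mem_closure_cylSpan (φ : C(Boundary (Vertex k) v, ℂ)) :
    φ ∈ closure (cylSpan v : Set C(Boundary (Vertex k) v, ℂ)) := by
  have h := ContinuousMap.starSubalgebra_topologicalClosure_eq_top_of_separatesPoints
    (cylAlgebra v) (by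
      intro x y hxy
      obtain ⟨p, hp⟩ : ∃ p, ¬ (p ∈ x.1.carrier ↔ p ∈ y.1.carrier) := by
        by_contra hall
        push Not at hall
        exact hxy (Subtype.ext (PathSpace.ext (Set.ext hall)))
      refine ⟨cylIndicator p, ⟨cylIndicator p, Submodule.subset_span ⟨p, rfl⟩, rfl⟩, ?_⟩
      change (bdCylinder p).indicator (1 : Boundary (Vertex k) v → ℂ) x ≠
        (bdCylinder p).indicator 1 y
      by_cases hx : x ∈ bdCylinder p
      · have hy : y ∉ bdCylinder p := fun hy => hp ⟨fun _ => hy, fun _ => hx⟩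
        simp [hx, hy]
      · have hy : y ∈ bdCylinder p := by
          by_contra hy
          exact hp ⟨fun h => absurd h hx, fun h => absurd h hy⟩
        simp [hx, hy])
  have h' : φ ∈ (cylAlgebra v).topologicalClosure := by rw [h]; trivial
  exact h'

theorem push_cylIndicator (μ ν : u ⟶ v) (η : v ⟶ w) :
    push μ ν (cylIndicator ⟨w, η⟩) = matUnit (μ ≫ η) (ν ≫ η) := by
  ext a
  by_cases ha : a ∈ range (mkArr μ ν)
  · obtain ⟨z, rfl⟩ := ha
    rw [push_mkArr]
    change (bdCylinder _).indicator 1 z = _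
    by_cases hz : z ∈ bdCylinder ⟨w, η⟩
    · obtain ⟨y, rfl⟩ := exists_eq_bdExtend hz
      rw [indicator_of_mem hz, matUnit_of_mem ⟨y, (mkArr_extend μ ν η y).symm⟩]
      rfl
    · rw [indicator_of_notMem hz, matUnit_of_notMem]
      rintro ⟨y, hy⟩
      rw [← mkArr_extend] at hy
      rw [← mkArr_injective μ ν hy] at hz
      exact hz (bdExtend_mem η y)
  · rw [push_of_notMem _ _ _ ha, matUnit_of_notMem]
    rintro ⟨y, rfl⟩
    exact ha ⟨bdExtend η y, mkArr_extend μ ν η y⟩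

/-- The matrix unit `e(μ, ν)` of the full C*-algebra. -/
def matElt (μ ν : u ⟶ v) : FullCStar (Boundary (Vertex k) u) := toFullCStar (matUnit μ ν)

theorem matElt_mul {v' : Vertex k} (μ : u ⟶ v) {ν : u ⟶ v} {ν' : u ⟶ v'} (κ : u ⟶ v')
    {η : v ⟶ w} {η' : v' ⟶ w} (h : IsLeastSquare ν ν' η η') :
    matElt μ ν * matElt ν' κ = matElt (μ ≫ η) (κ ≫ η') :=
  toFullCStar_mul (convolution_matUnit μ κ h)

theorem matElt_mul_eq_zero {v' : Vertex k} (μ : u ⟶ v) {ν : u ⟶ v} {ν' : u ⟶ v'} (κ : u ⟶ v')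
    (h : ∀ (w : Vertex k) (η : v ⟶ w) (η' : v' ⟶ w), ν ≫ η ≠ ν' ≫ η') :
    matElt μ ν * matElt ν' κ = 0 :=
  (toFullCStar_mul (convolution_matUnit_eq_zero μ κ h)).trans
    (map_zero (toFullCStarₗ (Boundary (Vertex k) u)))

theorem matElt_mul_same (μ ν κ : u ⟶ v) : matElt μ ν * matElt ν κ = matElt μ κ := by
  rw [matElt_mul μ κ (isLeastSquare_self ν), Category.comp_id, Category.comp_id]

theorem star_matElt (μ ν : u ⟶ v) : star (matElt μ ν) = matElt ν μ :=
  toFullCStar_star (involution_matUnit μ ν)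

/-- The index set of the matrix units. -/
abbrev MatIndex (u : Vertex k) : Type := Σ v : Vertex k, (u ⟶ v) × (u ⟶ v)

/-- The span of the matrix units in the product of all representations. -/
def matSpan (u : Vertex k) : Submodule ℂ (RepProduct (Boundary (Vertex k) u)) :=
  Submodule.span ℂ (range fun i : MatIndex u => universalRep (matUnit i.2.1 i.2.2))

theorem matElt_mem_matSpan (μ ν : u ⟶ v) : (matElt μ ν).1 ∈ matSpan u :=
  Submodule.subset_span ⟨⟨v, μ, ν⟩, rfl⟩

theorem mul_mem_matSpan {a b : RepProduct (Boundary (Vertex k) u)} (ha : a ∈ matSpan u)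
    (hb : b ∈ matSpan u) : a * b ∈ matSpan u := by
  induction ha, hb using Submodule.span_induction₂ with
  | mem_mem _ _ h h' =>
    obtain ⟨⟨v, μ, ν⟩, rfl⟩ := h
    obtain ⟨⟨v', ν', κ⟩, rfl⟩ := h'
    change (matElt μ ν * matElt ν' κ).1 ∈ _
    by_cases hex : ∃ (w : Vertex k) (η : v ⟶ w) (η' : v' ⟶ w), ν ≫ η = ν' ≫ η'
    · obtain ⟨w, η, η', h⟩ := hex
      obtain ⟨w, η, η', h⟩ := exists_isLeastSquare h
      rw [matElt_mul μ κ h]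
      exact matElt_mem_matSpan _ _
    · rw [matElt_mul_eq_zero μ κ fun w η η' h => hex ⟨w, η, η', h⟩]
      exact zero_mem _
  | zero_left => rw [zero_mul]; exact zero_mem _
  | zero_right => rw [mul_zero]; exact zero_mem _
  | add_left _ _ _ _ _ _ h1 h2 => rw [add_mul]; exact add_mem h1 h2
  | add_right _ _ _ _ _ _ h1 h2 => rw [mul_add]; exact add_mem h1 h2
  | smul_left c _ _ _ _ h => rw [smul_mul_assoc]; exact Submodule.smul_mem _ _ h
  | smul_right c _ _ _ _ h => rw [mul_smul_comm]; exact Submodule.smul_mem _ _ h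

theorem star_mem_matSpan {a : RepProduct (Boundary (Vertex k) u)} (ha : a ∈ matSpan u) :
    star a ∈ matSpan u := by
  induction ha using Submodule.span_induction with
  | mem _ h =>
    obtain ⟨⟨v, μ, ν⟩, rfl⟩ := h
    change (star (matElt μ ν)).1 ∈ _
    rw [star_matElt]
    exact matElt_mem_matSpan _ _
  | zero => rw [star_zero]; exact zero_mem _
  | add _ _ _ _ h1 h2 => rw [star_add]; exact add_mem h1 h2
  | smul c _ _ h => rw [star_smul]; exact Submodule.smul_mem _ _ h

/-- The *-algebra spanned by the matrix units. -/
def matAlgebra (u : Vertex k) : NonUnitalStarSubalgebra ℂ (RepProduct (Boundary (Vertex k) u)) where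
  __ := matSpan u
  mul_mem' := mul_mem_matSpan
  star_mem' := star_mem_matSpan

/-- On the functions supported on one bisection `[μ, ν, ∂]` the `I`-norm is the supremum norm, so
their images can be approximated by those of combinations of indicator functions. -/
theorem universalRep_mem_closure (f : C_c(Arr (Boundary (Vertex k) u), ℂ)) :
    universalRep f ∈ (matAlgebra u).topologicalClosure := by
  induction f using cc_induction with
  | zero =>
    have : universalRep (0 : C_c(Arr (Boundary (Vertex k) u), ℂ)) = 0 :=
      congrArg Subtype.val (map_zero (toFullCStarₗ (Boundary (Vertex k) u)))
    rw [this]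
    exact zero_mem _
  | add f g hf hg =>
    rw [universalRep_add]
    exact add_mem hf hg
  | push v μ ν φ =>
    let L : C(Boundary (Vertex k) v, ℂ) →ₗ[ℂ] RepProduct (Boundary (Vertex k) u) :=
      { toFun := fun φ => universalRep (push μ ν φ)
        map_add' := fun φ ψ => by rw [push_add, universalRep_add]
        map_smul' := fun c φ => by rw [push_smul, universalRep_smul, RingHom.id_apply] }
    have hL : Continuous L := (L.mkContinuous 1 fun φ => by
      rw [one_mul]
      exact (norm_universalRep_le (iNorm_nonneg _)).trans (iNorm_push_le μ ν φ)).continuous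
    have hmaps : ∀ ψ ∈ cylSpan v, L ψ ∈ matSpan u := by
      intro ψ hψ
      induction hψ using Submodule.span_induction with
      | mem _ h =>
        obtain ⟨⟨w, η⟩, rfl⟩ := h
        change universalRep (push μ ν (cylIndicator ⟨w, η⟩)) ∈ _
        rw [push_cylIndicator]
        exact matElt_mem_matSpan _ _
      | zero => rw [map_zero]; exact zero_mem _
      | add _ _ _ _ h1 h2 => rw [map_add]; exact add_mem h1 h2
      | smul c _ _ h => rw [map_smul]; exact Submodule.smul_mem _ _ h
    have h := map_mem_closure hL (mem_closure_cylSpan φ) hmaps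
    exact h

theorem mem_closure_matSpan (a : FullCStar (Boundary (Vertex k) u)) :
    a.1 ∈ closure (matSpan u : Set (RepProduct (Boundary (Vertex k) u))) := by
  have h : fullCStarSubalgebra (Boundary (Vertex k) u) ≤ (matAlgebra u).topologicalClosure := by
    refine NonUnitalStarSubalgebra.topologicalClosure_minimal _ ?_
      (NonUnitalStarSubalgebra.isClosed_topologicalClosure _)
    refine NonUnitalStarAlgebra.adjoin_le ?_
    rintro _ ⟨f, rfl⟩
    exact universalRep_mem_closure f
  exact h a.2

/-- The matrix units span a dense subspace of the full C*-algebra. -/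
theorem dense_span_matElt :
    Dense (Submodule.span ℂ (range fun i : MatIndex u => matElt i.2.1 i.2.2) :
      Set (FullCStar (Boundary (Vertex k) u))) := by
  intro a
  have h := mem_closure_matSpan a
  have hemb : IsEmbedding (Subtype.val : FullCStar (Boundary (Vertex k) u) → _) :=
    IsEmbedding.subtypeVal
  refine (Set.ext_iff.1 (hemb.closure_eq_preimage_closure_image _) a).2 (closure_mono ?_ h)
  let valₗ : FullCStar (Boundary (Vertex k) u) →ₗ[ℂ] RepProduct (Boundary (Vertex k) u) :=
    { toFun := Subtype.val, map_add' := fun _ _ => rfl, map_smul' := fun _ _ => rfl }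
  have hmap : matSpan u =
      (Submodule.span ℂ (range fun i : MatIndex u => matElt i.2.1 i.2.2)).map valₗ := by
    rw [Submodule.map_span, ← range_comp]
    rfl
  rw [hmap]
  exact Subset.rfl

/-- Continuous linear functionals which agree on the matrix units are equal. -/
theorem fullCStar_ext {S T : FullCStar (Boundary (Vertex k) u) →L[ℂ] ℂ}
    (h : ∀ (v : Vertex k) (μ ν : u ⟶ v), S (matElt μ ν) = T (matElt μ ν)) : S = T :=
  ContinuousLinearMap.ext_on dense_span_matElt (by rintro _ ⟨i, rfl⟩; exact h _ _ _)

end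

section

/-! ### Operators given by matrices with bounded row and column sums -/

section Schur

variable {ι : Type}

/-- The Hilbert space with an orthonormal basis indexed by `ι`. -/
abbrev EllTwo (ι : Type) : Type := lp (fun _ : ι => ℂ) 2

/-- A matrix with finitely many nonzero entries in every row and column, for which all absolute row
sums and column sums are at most `C`. -/
structure IsSchur (K : ι → ι → ℂ) (C : ℝ) : Prop where
  nonneg : 0 ≤ C
  row_finite : ∀ i, {j | K i j ≠ 0}.Finite
  col_finite : ∀ j, {i | K i j ≠ 0}.Finite
  row_le : ∀ i, ∑' j, ‖K i j‖ ≤ C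
  col_le : ∀ j, ∑' i, ‖K i j‖ ≤ C

variable {K : ι → ι → ℂ} {C : ℝ}

theorem IsSchur.summable (hK : IsSchur K C) (ξ : ι → ℂ) (i : ι) :
    Summable fun j => K i j * ξ j :=
  summable_of_hasFiniteSupport ((hK.row_finite i).subset fun j hj h => hj (by
    simp only [h, zero_mul]))

/-- The Schur test. -/
theorem IsSchur.sum_le (hK : IsSchur K C) (ξ : EllTwo ι) (S : Finset ι) :
    ∑ i ∈ S, ‖∑' j, K i j * ξ j‖ ^ (2 : ℝ≥0∞).toReal ≤ (C * ‖ξ‖) ^ (2 : ℝ≥0∞).toReal := by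
  classical
  simp only [ENNReal.toReal_ofNat, Real.rpow_ofNat]
  let R : Finset ι := S.biUnion fun i => (hK.row_finite i).toFinset
  have hrow : ∀ i, ∑ j ∈ R, ‖K i j‖ ≤ C := fun i =>
    (Summable.sum_le_tsum R (fun _ _ => norm_nonneg _) (summable_of_hasFiniteSupport
      ((hK.row_finite i).subset fun j hj => by simpa using hj))).trans (hK.row_le i)
  have hcol : ∀ j, ∑ i ∈ S, ‖K i j‖ ≤ C := fun j =>
    (Summable.sum_le_tsum S (fun _ _ => norm_nonneg _) (summable_of_hasFiniteSupport
      ((hK.col_finite j).subset fun j hj => by simpa using hj))).trans (hK.col_le j)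
  have h1 : ∀ i ∈ S, ‖∑' j, K i j * ξ j‖ ^ 2 ≤ C * ∑ j ∈ R, ‖K i j‖ * ‖ξ j‖ ^ 2 := by
    intro i hi
    rw [tsum_eq_sum (s := R)]
    · calc ‖∑ j ∈ R, K i j * ξ j‖ ^ 2 ≤ (∑ j ∈ R, ‖K i j‖ * ‖ξ j‖) ^ 2 := by
            gcongr
            exact (norm_sum_le _ _).trans (le_of_eq (Finset.sum_congr rfl fun _ _ => norm_mul _ _))
        _ ≤ (∑ j ∈ R, ‖K i j‖) * ∑ j ∈ R, ‖K i j‖ * ‖ξ j‖ ^ 2 :=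
            Finset.sum_sq_le_sum_mul_sum_of_sq_le_mul R (fun _ _ => norm_nonneg _)
              (fun _ _ => by positivity) fun _ _ => le_of_eq (by ring)
        _ ≤ C * ∑ j ∈ R, ‖K i j‖ * ‖ξ j‖ ^ 2 := by
            gcongr
            exact hrow i
    · intro j hj
      have : K i j = 0 := by
        by_contra h
        exact hj (Finset.mem_biUnion.2 ⟨i, hi, by simpa using h⟩)
      rw [this, zero_mul]
  calc ∑ i ∈ S, ‖∑' j, K i j * ξ j‖ ^ 2 ≤ ∑ i ∈ S, C * ∑ j ∈ R, ‖K i j‖ * ‖ξ j‖ ^ 2 :=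
        Finset.sum_le_sum h1
    _ = C * ∑ j ∈ R, (∑ i ∈ S, ‖K i j‖) * ‖ξ j‖ ^ 2 := by
        rw [← Finset.mul_sum, Finset.sum_comm]
        simp only [Finset.sum_mul]
    _ ≤ C * ∑ j ∈ R, C * ‖ξ j‖ ^ 2 := by
        gcongr
        · exact hK.nonneg
        · exact hcol _
    _ = C ^ 2 * ∑ j ∈ R, ‖ξ j‖ ^ 2 := by rw [← Finset.mul_sum]; ring
    _ ≤ C ^ 2 * ‖ξ‖ ^ 2 := by
        gcongr
        simpa using lp.sum_rpow_le_norm_rpow (p := 2) (by simp) ξ R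
    _ = (C * ‖ξ‖) ^ 2 := by ring

/-- The operator on `ℓ²` given by a matrix which satisfies the Schur test. -/
def schurOp (K : ι → ι → ℂ) (C : ℝ) (hK : IsSchur K C) : EllTwo ι →L[ℂ] EllTwo ι :=
  LinearMap.mkContinuous
    { toFun := fun ξ => ⟨fun i => ∑' j, K i j * ξ j, memℓp_gen' (hK.sum_le ξ)⟩
      map_add' := fun ξ η => lp.ext (funext fun i => by
        change ∑' j, K i j * (ξ j + η j) = _
        simp only [mul_add]
        exact (hK.summable ξ i).tsum_add (hK.summable η i))
      map_smul' := fun c ξ => lp.ext (funext fun i => by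
        change ∑' j, K i j * (c * ξ j) = c * ∑' j, K i j * ξ j
        rw [← tsum_mul_left]
        exact tsum_congr fun j => mul_left_comm _ _ _) } C
    fun ξ => lp.norm_le_of_forall_sum_le (by simp) (mul_nonneg hK.nonneg (norm_nonneg _))
      (hK.sum_le ξ)

theorem schurOp_apply (hK : IsSchur K C) (ξ : EllTwo ι) (i : ι) :
    schurOp K C hK ξ i = ∑' j, K i j * ξ j := rfl

theorem norm_schurOp_le (hK : IsSchur K C) : ‖schurOp K C hK‖ ≤ C :=
  LinearMap.mkContinuous_norm_le _ hK.nonneg _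

/-- The vector of the standard basis. -/
def basisVec (j : ι) : EllTwo ι := open Classical in lp.single 2 j (1 : ℂ)

theorem schurOp_basisVec (hK : IsSchur K C) (i j : ι) : schurOp K C hK (basisVec j) i = K i j := by
  classical
  rw [schurOp_apply, tsum_eq_single j]
  · simp [basisVec]
  · intro l hl
    rw [basisVec, lp.single_apply_ne _ _ _ hl, mul_zero]

theorem norm_basisVec (j : ι) : ‖basisVec j‖ = 1 := by
  classical
  rw [basisVec, lp.norm_single (by simp), norm_one]

theorem inner_basisVec_left (i : ι) (ξ : EllTwo ι) : inner ℂ (basisVec i) ξ = ξ i := by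
  classical
  rw [basisVec, lp.inner_single_left]
  simp

/-- Operators are determined by their matrices. -/
theorem ellTwo_ext {S T : EllTwo ι →L[ℂ] EllTwo ι}
    (h : ∀ i j, S (basisVec j) i = T (basisVec j) i) : S = T := by
  classical
  ext1 ξ
  have hξ := lp.hasSum_single (by simp) ξ
  have hS := hξ.map S S.continuous
  have hT := hξ.map T T.continuous
  refine hS.unique (hT.congr_fun fun j => ?_)
  have : lp.single 2 j (ξ j) = ξ j • (basisVec j : EllTwo ι) := by
    rw [basisVec, ← lp.single_smul, smul_eq_mul, mul_one]
  simp only [Function.comp, this, map_smul]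
  rw [lp.ext (funext fun i => h i j)]

theorem star_apply_basisVec (T : EllTwo ι →L[ℂ] EllTwo ι) (i j : ι) :
    (star T) (basisVec j) i = starRingEnd ℂ (T (basisVec i) j) := by
  rw [← inner_basisVec_left, ContinuousLinearMap.star_eq_adjoint,
    ContinuousLinearMap.adjoint_inner_right, ← inner_conj_symm, inner_basisVec_left]

end Schur

/-! ### The regular representations -/

variable {k : ℕ → ℕ} {u v w : Vertex k}

/-- The matrix of the left regular representation on the arrows with source `x`. -/
def regKernel (x : Boundary (Vertex k) u) (f : Arr (Boundary (Vertex k) u) → ℂ)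
    (i j : ArrowsTo x) : ℂ :=
  f ⟨i.1, j.1, i.2 ≫ Groupoid.inv j.2⟩

/-- For an arrow `i` with source `x`, the arrows `ij⁻¹` are the arrows with the same range
as `i`. -/
def divEquivFrom {x : Boundary (Vertex k) u} (i : ArrowsTo x) : ArrowsTo x ≃ ArrowsFrom i.1 where
  toFun j := ⟨j.1, i.2 ≫ Groupoid.inv j.2⟩
  invFun a := ⟨a.1, Groupoid.inv a.2 ≫ i.2⟩
  left_inv j := by simp
  right_inv a := by simp

/-- For an arrow `j` with source `x`, the arrows `ij⁻¹` are the arrows whose source is the range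
of `j`. -/
def divEquivTo {x : Boundary (Vertex k) u} (j : ArrowsTo x) : ArrowsTo x ≃ ArrowsTo j.1 where
  toFun i := ⟨i.1, i.2 ≫ Groupoid.inv j.2⟩
  invFun a := ⟨a.1, a.2 ≫ j.2⟩
  left_inv i := by simp
  right_inv a := by simp

theorem isSchur_regKernel (x : Boundary (Vertex k) u) (f : C_c(Arr (Boundary (Vertex k) u), ℂ)) :
    IsSchur (regKernel x f) (iNorm f) where
  nonneg := iNorm_nonneg f
  row_finite i := (finite_from f i.1).preimage (divEquivFrom i).injective.injOn
  col_finite j := (finite_to f j.1).preimage (divEquivTo j).injective.injOn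
  row_le i := ((divEquivFrom i).tsum_eq fun a : ArrowsFrom i.1 => ‖f ⟨i.1, a.1, a.2⟩‖).trans_le
    (tsum_from_le_iNorm f i.1)
  col_le j := ((divEquivTo j).tsum_eq fun a : ArrowsTo j.1 => ‖f ⟨a.1, j.1, a.2⟩‖).trans_le
    (tsum_to_le_iNorm f j.1)

theorem regKernel_convolution (x : Boundary (Vertex k) u) (f g : Arr (Boundary (Vertex k) u) → ℂ)
    (i j : ArrowsTo x) :
    regKernel x (convolution f g) i j = ∑' l, regKernel x f i l * regKernel x g l j := by
  rw [regKernel, convolution, ← (divEquivFrom i).tsum_eq]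
  refine tsum_congr fun l => ?_
  simp [divEquivFrom, regKernel]

theorem regKernel_involution (x : Boundary (Vertex k) u) (f : Arr (Boundary (Vertex k) u) → ℂ)
    (i j : ArrowsTo x) :
    regKernel x (involution f) i j = starRingEnd ℂ (regKernel x f j i) := by
  simp [regKernel, involution]

/-- The left regular representation on the arrows with source `x`. -/
def regRep (x : Boundary (Vertex k) u) : BoundedRep (Boundary (Vertex k) u) where
  H := EllTwo (ArrowsTo x)
  toLin :=
    { toFun := fun f => schurOp (regKernel x f) (iNorm f) (isSchur_regKernel x f)
      map_add' := fun f g => ellTwo_ext fun i j => by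
        rw [add_apply, lp.coeFn_add, Pi.add_apply]
        simp only [schurOp_basisVec]
        rfl
      map_smul' := fun c f => ellTwo_ext fun i j => by
        rw [RingHom.id_apply, smul_apply, lp.coeFn_smul, Pi.smul_apply]
        simp only [schurOp_basisVec]
        rfl }
  map_convolution f g h e := ellTwo_ext fun i j => by
    change schurOp (regKernel x h) (iNorm h) (isSchur_regKernel x h) _ _ =
      schurOp (regKernel x f) (iNorm f) (isSchur_regKernel x f)
        (schurOp (regKernel x g) (iNorm g) (isSchur_regKernel x g) _) _
    rw [schurOp_basisVec, schurOp_apply, e, regKernel_convolution]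
    simp only [schurOp_basisVec]
  map_involution f h e := ellTwo_ext fun i j => by
    change schurOp (regKernel x h) (iNorm h) (isSchur_regKernel x h) _ _ =
      (star (schurOp (regKernel x f) (iNorm f) (isSchur_regKernel x f))) _ _
    rw [schurOp_basisVec, star_apply_basisVec, schurOp_basisVec, e, regKernel_involution]
  norm_le f := norm_schurOp_le (isSchur_regKernel x f)

/-- The operator of an element of the full C*-algebra in a representation. -/
def evalRep (π : BoundedRep (Boundary (Vertex k) u)) (a : FullCStar (Boundary (Vertex k) u)) :
    π.H →L[ℂ] π.H :=
  (show lp (fun π : BoundedRep (Boundary (Vertex k) u) => (π.H →L[ℂ] π.H)) ∞ from a.1) π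

theorem norm_evalRep_le (π : BoundedRep (Boundary (Vertex k) u))
    (a : FullCStar (Boundary (Vertex k) u)) : ‖evalRep π a‖ ≤ ‖a‖ :=
  lp.norm_apply_le_norm ENNReal.top_ne_zero
    (show lp (fun π : BoundedRep (Boundary (Vertex k) u) => (π.H →L[ℂ] π.H)) ∞ from a.1) π

/-- The basis vector of the regular representation given by the unit `x`. -/
def unitVec (x : Boundary (Vertex k) u) : (regRep x).H :=
  (basisVec ⟨x, 𝟙 x⟩ : EllTwo (ArrowsTo x))

theorem norm_unitVec (x : Boundary (Vertex k) u) : ‖unitVec x‖ = 1 :=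
  norm_basisVec (⟨x, 𝟙 x⟩ : ArrowsTo x)

/-- The vector state of the regular representation given by the unit `x`. -/
def unitState (x : Boundary (Vertex k) u) (a : FullCStar (Boundary (Vertex k) u)) : ℂ :=
  inner ℂ (unitVec x) (evalRep (regRep x) a (unitVec x))

theorem unitState_toFullCStar (x : Boundary (Vertex k) u)
    (f : C_c(Arr (Boundary (Vertex k) u), ℂ)) : unitState x (toFullCStar f) = f (unitArr x) := by
  refine (inner_basisVec_left (⟨x, 𝟙 x⟩ : ArrowsTo x) _).trans ?_
  refine (schurOp_basisVec (isSchur_regKernel x f) _ _).trans ?_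
  simp [regKernel, unitArr]

theorem unitState_add (x : Boundary (Vertex k) u) (a b : FullCStar (Boundary (Vertex k) u)) :
    unitState x (a + b) = unitState x a + unitState x b :=
  inner_add_right _ _ _

theorem unitState_smul (x : Boundary (Vertex k) u) (c : ℂ)
    (a : FullCStar (Boundary (Vertex k) u)) : unitState x (c • a) = c * unitState x a :=
  inner_smul_right _ _ _

theorem norm_unitState_le (x : Boundary (Vertex k) u) (a : FullCStar (Boundary (Vertex k) u)) :
    ‖unitState x a‖ ≤ ‖a‖ := by
  refine (norm_inner_le_norm _ _).trans ?_
  rw [norm_unitVec, one_mul]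
  refine (ContinuousLinearMap.le_opNorm _ _).trans ?_
  rw [norm_unitVec, mul_one]
  exact norm_evalRep_le _ _

theorem unitState_star_mul_self (x : Boundary (Vertex k) u)
    (a : FullCStar (Boundary (Vertex k) u)) : 0 ≤ unitState x (star a * a) := by
  have h : unitState x (star a * a) = inner ℂ (unitVec x)
      (star (evalRep (regRep x) a) (evalRep (regRep x) a (unitVec x))) := rfl
  rw [h, ContinuousLinearMap.star_eq_adjoint, ContinuousLinearMap.adjoint_inner_right]
  rw [inner_self_eq_norm_sq_to_K]
  rw [← RCLike.ofReal_pow]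
  exact RCLike.ofReal_nonneg.2 (sq_nonneg _)

end

section

variable {k : ℕ → ℕ} {u v w : Vertex k}

/-! ### Averages over the paths of a given length -/

/-- The point `α^∞β^∞` of the boundary. -/
def bdGammaFree (v : Vertex k) : Boundary (Vertex k) v :=
  ⟨gammaFree v, subset_closure (isMaximal_gammaFree v)⟩

/-- The point `λγα^∞β^∞` of the boundary. -/
def samplePoint (l : u ⟶ v) (h : 0 < k v.index) : Boundary (Vertex k) u :=
  bdExtend l (bdExtend (edgeγ v ⟨0, h⟩) (bdGammaFree _))

/-- Since `γ` separates, the prefixes of `λγα^∞β^∞` that are not longer than `λ` are the prefixes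
of `λ`. -/
theorem samplePoint_mem_iff {l : u ⟶ w} {h : 0 < k w.index} {μ : u ⟶ v}
    (hv : v.index ≤ w.index) :
    samplePoint l h ∈ bdCylinder ⟨v, μ⟩ ↔ ∃ η : v ⟶ w, μ ≫ η = l := by
  have h0 : (⟨_, l ≫ edgeγ w ⟨0, h⟩⟩ : PathsFrom (Vertex k) u) ∈ (samplePoint l h).1.carrier := by
    rw [samplePoint, ← bdExtend_comp]
    exact bdExtend_mem _ _
  constructor
  · intro hμ
    rcases isPrefix_gamma h0 hμ (l := l.1) (j := 0) rfl with h1 | h1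
    · exact isPrefix_iff.2 (show val (⟨v, μ⟩ : PathsFrom (Vertex k) u) ∣ val ⟨w, l⟩ from h1)
    · have h2 := weight_dvd (fun _ => 1) h1
      change len (l.1 * letter (.γ 0)) ≤ len μ.1 at h2
      have h3 := hom_len l
      have h4 := hom_len μ
      rw [len_mul, len_letter] at h2
      omega
  · rintro ⟨η, rfl⟩
    exact (samplePoint (μ ≫ η) h).1.hereditary _ _ h0
      ⟨η ≫ edgeγ w ⟨0, h⟩, (Category.assoc _ _ _).symm⟩

instance nonempty_hom (i : ℕ) : Nonempty ((⟨0⟩ : Vertex k) ⟶ ⟨i⟩) :=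
  ⟨homMk (letter .α ^ i) (valid_of_countγ (by simp [weight_pow])) (by simp [len, weight_pow])⟩

instance fintype_hom : Fintype (u ⟶ v) := Fintype.ofFinite _

/-- The average of a function over the points `λγα^∞β^∞`, where `λ` runs over all paths with range
`u` and source `w`. -/
def sampleMean (w : Vertex k) (h : 0 < k w.index) (F : Boundary (Vertex k) u → ℂ) : ℂ :=
  (∑ l : u ⟶ w, F (samplePoint l h)) / Fintype.card (u ⟶ w)

theorem norm_sampleMean_le {h : 0 < k w.index} {F : Boundary (Vertex k) u → ℂ} {C : ℝ}
    (hC : 0 ≤ C) (hF : ∀ x, ‖F x‖ ≤ C) : ‖sampleMean w h F‖ ≤ C := by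
  rw [sampleMean, norm_div, Complex.norm_natCast]
  refine div_le_of_le_mul₀ (Nat.cast_nonneg _) hC ?_
  refine (norm_sum_le_of_le _ fun l _ => hF _).trans ?_
  simp [mul_comm]

theorem sampleMean_add (h : 0 < k w.index) (F G : Boundary (Vertex k) u → ℂ) :
    sampleMean w h (fun x => F x + G x) = sampleMean w h F + sampleMean w h G := by
  rw [sampleMean, Finset.sum_add_distrib, add_div]
  rfl

theorem sampleMean_smul (h : 0 < k w.index) (c : ℂ) (F : Boundary (Vertex k) u → ℂ) :
    sampleMean w h (fun x => c * F x) = c * sampleMean w h F := by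
  rw [sampleMean, ← Finset.mul_sum, mul_div_assoc]
  rfl

theorem sampleMean_re (h : 0 < k w.index) (F : Boundary (Vertex k) u → ℂ) :
    (sampleMean w h F).re = (∑ l : u ⟶ w, (F (samplePoint l h)).re) / Fintype.card (u ⟶ w) := by
  rw [sampleMean, ← Complex.ofReal_natCast, Complex.div_ofReal_re, Complex.re_sum]

theorem sampleMean_nonneg {h : 0 < k w.index} {F : Boundary (Vertex k) u → ℂ} (hF : ∀ x, 0 ≤ F x) :
    0 ≤ sampleMean w h F := by
  rw [sampleMean, ← Complex.ofReal_natCast, div_eq_mul_inv, ← Complex.ofReal_inv]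
  exact mul_nonneg (Finset.sum_nonneg fun _ _ => hF _) (Complex.zero_le_real.2 (by positivity))

/-- The average of the indicator function of the cylinder set of `μ` counts the paths that begin
with `μ`, and by left cancellation their number depends only on the source of `μ`. -/
theorem sampleMean_matUnit_self (h : 0 < k w.index) (μ : u ⟶ v) (hv : v.index ≤ w.index) :
    sampleMean w h (fun x => matUnit μ μ (unitArr x)) =
      Fintype.card (v ⟶ w) / Fintype.card (u ⟶ w) := by
  classical
  rw [sampleMean]
  congr 1
  have hval : ∀ l : u ⟶ w, matUnit μ μ (unitArr (samplePoint l h)) =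
      if l ∈ Finset.univ.image (fun η : v ⟶ w => μ ≫ η) then 1 else 0 := by
    intro l
    split_ifs with hl
    · obtain ⟨η, -, hη⟩ := Finset.mem_image.1 hl
      exact matUnit_self_unitArr ((samplePoint_mem_iff hv).2 ⟨η, hη⟩)
    · refine matUnit_self_unitArr_of_notMem fun hmem => hl ?_
      obtain ⟨η, hη⟩ := (samplePoint_mem_iff hv).1 hmem
      exact Finset.mem_image.2 ⟨η, Finset.mem_univ _, hη⟩
  rw [Finset.sum_congr rfl fun l _ => hval l]
  simp only [Finset.sum_ite_mem, Finset.univ_inter, Finset.sum_const, nsmul_eq_mul, mul_one]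
  rw [Finset.card_image_of_injective _ fun η η' => CategoryOfPaths.left_cancel μ η η',
    Finset.card_univ]

/-! ### The limit of the averages -/

/-- A vertex beyond the vertex `n` at which there is an edge `γ`. -/
def gammaVertex (hk : ∀ n : ℕ, ∃ i ≥ n, 0 < k i) (n : ℕ) : Vertex k := ⟨(hk n).choose⟩

theorem le_gammaVertex (hk : ∀ n : ℕ, ∃ i ≥ n, 0 < k i) (n : ℕ) :
    n ≤ (gammaVertex hk n).index := (hk n).choose_spec.1

theorem gammaVertex_pos (hk : ∀ n : ℕ, ∃ i ≥ n, 0 < k i) (n : ℕ) :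
    0 < k (gammaVertex hk n).index := (hk n).choose_spec.2

/-- The averages of the values at `a` of the vector states at the points `λγα^∞β^∞`. -/
def meanSeq (hk : ∀ n : ℕ, ∃ i ≥ n, 0 < k i) (a : FullCStar (UnitSpace k)) (n : ℕ) : ℂ :=
  sampleMean (gammaVertex hk n) (gammaVertex_pos hk n) fun x => unitState x a

theorem tendsto_meanSeq (hk : ∀ n : ℕ, ∃ i ≥ n, 0 < k i) (a : FullCStar (UnitSpace k)) :
    Filter.Tendsto (meanSeq hk a) (Filter.hyperfilter ℕ)
      (𝓝 (Filter.limUnder (Filter.hyperfilter ℕ : Filter ℕ) (meanSeq hk a))) := by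
  have hb : ∀ n, meanSeq hk a n ∈ Metric.closedBall (0 : ℂ) ‖a‖ := fun n => by
    rw [mem_closedBall_zero_iff]
    exact norm_sampleMean_le (norm_nonneg _) fun x => norm_unitState_le x a
  obtain ⟨c, -, hc⟩ := (isCompact_closedBall (0 : ℂ) ‖a‖).ultrafilter_le_nhds
    ((Filter.hyperfilter ℕ).map (meanSeq hk a)) (by
      rw [Filter.le_principal_iff]
      exact Filter.eventually_map.2 (Filter.Eventually.of_forall hb))
  exact tendsto_nhds_limUnder ⟨c, hc⟩

/-- The trace: the limit of the averages of the vector states at the points `λγα^∞β^∞`. It is taken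
along a nonprincipal ultrafilter, so that it exists by compactness of closed discs. -/
def limitTrace (hk : ∀ n : ℕ, ∃ i ≥ n, 0 < k i) : FullCStar (UnitSpace k) →L[ℂ] ℂ :=
  LinearMap.mkContinuous
    { toFun := fun a => Filter.limUnder (Filter.hyperfilter ℕ : Filter ℕ) (meanSeq hk a)
      map_add' := fun a b => by
        refine tendsto_nhds_unique (tendsto_meanSeq hk (a + b)) ?_
        convert (tendsto_meanSeq hk a).add (tendsto_meanSeq hk b) using 2 with n
        simp only [meanSeq, unitState_add, sampleMean_add]
      map_smul' := fun c a => by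
        refine tendsto_nhds_unique (tendsto_meanSeq hk (c • a)) ?_
        convert (tendsto_meanSeq hk a).const_mul c using 2 with n
        · simp only [meanSeq, unitState_smul, sampleMean_smul]
        · rfl } 1 fun a => by
    rw [one_mul]
    exact le_of_tendsto (tendsto_meanSeq hk a).norm (Filter.Eventually.of_forall fun n =>
      norm_sampleMean_le (norm_nonneg _) fun x => norm_unitState_le x a)

variable (hk : ∀ n : ℕ, ∃ i ≥ n, 0 < k i)

theorem tendsto_limitTrace (a : FullCStar (UnitSpace k)) :
    Filter.Tendsto (meanSeq hk a) (Filter.hyperfilter ℕ) (𝓝 (limitTrace hk a)) :=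
  tendsto_meanSeq hk a

theorem limitTrace_nonneg {a : FullCStar (UnitSpace k)} (h : ∀ x, 0 ≤ unitState x a) :
    0 ≤ limitTrace hk a :=
  ge_of_tendsto' (tendsto_limitTrace hk a) fun _ => sampleMean_nonneg h

/-- The averages have positive weights, so their real parts are determined by those of the vector
states. -/
theorem limitTrace_re_congr {a b : FullCStar (UnitSpace k)}
    (h : ∀ x, (unitState x a).re = (unitState x b).re) :
    (limitTrace hk a).re = (limitTrace hk b).re := by
  refine tendsto_nhds_unique
    ((Complex.continuous_re.tendsto _).comp (tendsto_limitTrace hk a)) ?_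
  convert (Complex.continuous_re.tendsto _).comp (tendsto_limitTrace hk b) using 1
  funext n
  simp only [Function.comp, meanSeq, sampleMean_re, h]

theorem limitTrace_matElt_of_ne {μ ν : (⟨0⟩ : Vertex k) ⟶ v} (h : μ ≠ ν) :
    limitTrace hk (matElt μ ν) = 0 := by
  refine tendsto_nhds_unique (tendsto_limitTrace hk _) ?_
  convert tendsto_const_nhds using 1
  funext n
  simp only [meanSeq, matElt, unitState_toFullCStar, matUnit_unitArr_of_ne h]
  simp [sampleMean]

theorem limitTrace_matElt_self (μ ν : (⟨0⟩ : Vertex k) ⟶ v) :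
    limitTrace hk (matElt μ μ) = limitTrace hk (matElt ν ν) := by
  refine tendsto_nhds_unique (tendsto_limitTrace hk _) ((tendsto_limitTrace hk _).congr' ?_)
  refine Nat.hyperfilter_le_atTop (Filter.eventually_atTop.2 ⟨v.index, fun n hn => ?_⟩)
  have := hn.trans (le_gammaVertex hk n)
  simp only [meanSeq, matElt, unitState_toFullCStar]
  rw [sampleMean_matUnit_self _ _ this, sampleMean_matUnit_self _ _ this]

theorem limitTrace_one : limitTrace hk (matElt (𝟙 _) (𝟙 _)) = 1 := by
  refine tendsto_nhds_unique (tendsto_limitTrace hk _) ?_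
  convert tendsto_const_nhds using 1
  funext n
  simp only [meanSeq, matElt, unitState_toFullCStar]
  rw [sampleMean_matUnit_self _ _ (Nat.zero_le _), div_self]
  have : Nonempty ((⟨0⟩ : Vertex k) ⟶ gammaVertex hk n) := nonempty_hom _
  exact Nat.cast_ne_zero.2 Fintype.card_ne_zero

theorem norm_matElt_le (μ ν : u ⟶ v) : ‖matElt μ ν‖ ≤ 1 := by
  refine (norm_universalRep_le (iNorm_nonneg _)).trans ((iNorm_push_le μ ν 1).trans ?_)
  exact (ContinuousMap.norm_le _ zero_le_one).2 fun x => by simp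

theorem norm_limitTrace : ‖limitTrace hk‖ = 1 := by
  refine le_antisymm (LinearMap.mkContinuous_norm_le _ zero_le_one _) ?_
  have h := (limitTrace hk).le_opNorm (matElt (𝟙 _) (𝟙 _))
  rw [limitTrace_one, norm_one] at h
  exact h.trans (mul_le_of_le_one_right (norm_nonneg _) (norm_matElt_le _ _))

/-! ### The trace property -/

/-- A functional which vanishes on the off-diagonal matrix units `e(μ, ν)` and whose value on
`e(μ, μ)` depends only on the source of `μ` is a trace. -/
theorem map_mul_comm_of_diagonal (T : FullCStar (Boundary (Vertex k) u) →L[ℂ] ℂ)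
    (h0 : ∀ (v : Vertex k) (μ ν : u ⟶ v), μ ≠ ν → T (matElt μ ν) = 0)
    (h1 : ∀ (v : Vertex k) (μ ν : u ⟶ v), T (matElt μ μ) = T (matElt ν ν))
    (a b : FullCStar (Boundary (Vertex k) u)) : T (a * b) = T (b * a) := by
  have key : ∀ {v v' w : Vertex k} (μ ν : u ⟶ v) (ν' κ : u ⟶ v') (η : v ⟶ w) (η' : v' ⟶ w),
      IsLeastSquare ν ν' η η' → μ ≫ η = κ ≫ η' →
      T (matElt μ ν * matElt ν' κ) = T (matElt ν' κ * matElt μ ν) := by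
    intro v v' w μ ν ν' κ η η' hs he
    obtain ⟨w', θ', θ, hs'⟩ := exists_isLeastSquare he.symm
    -- Both least common extensions are equal, as each of them extends the other.
    obtain ⟨ω, rfl, rfl⟩ := hs'.least _ _ he.symm
    have he' : ν ≫ θ = ν' ≫ θ' := by
      have := hs.comm
      rw [← Category.assoc, ← Category.assoc] at this
      exact CategoryOfPaths.right_cancel _ _ _ this
    obtain ⟨ω', e1, -⟩ := hs.least _ _ he'
    have hw : w' = w := by
      obtain ⟨i⟩ := w
      obtain ⟨j⟩ := w'
      have k1 := hom_len ω
      have k2 := hom_len ω'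
      simp only at k1 k2
      congr
      omega
    subst hw
    have hω : ω = 𝟙 _ := hom_ext (eq_one_of_len (by have := hom_len ω; omega))
    subst hω
    rw [Category.comp_id, Category.comp_id] at hs he
    rw [matElt_mul μ κ hs, matElt_mul ν' ν hs', he, ← hs.comm]
    exact h1 _ _ _
  have hgen : ∀ (v v' : Vertex k) (μ ν : u ⟶ v) (ν' κ : u ⟶ v'),
      T (matElt μ ν * matElt ν' κ) = T (matElt ν' κ * matElt μ ν) := by
    have hz : ∀ (v v' : Vertex k) (μ ν : u ⟶ v) (ν' κ : u ⟶ v'),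
        (∀ (w : Vertex k) (η : v ⟶ w) (η' : v' ⟶ w), IsLeastSquare ν ν' η η' →
          μ ≫ η ≠ κ ≫ η') → T (matElt μ ν * matElt ν' κ) = 0 := by
      intro v v' μ ν ν' κ hne
      by_cases hex : ∃ (w : Vertex k) (η : v ⟶ w) (η' : v' ⟶ w), ν ≫ η = ν' ≫ η'
      · obtain ⟨w, η, η', h⟩ := hex
        obtain ⟨w, η, η', h⟩ := exists_isLeastSquare h
        rw [matElt_mul μ κ h]
        exact h0 _ _ _ (hne w η η' h)
      · rw [matElt_mul_eq_zero μ κ fun w η η' h => hex ⟨w, η, η', h⟩, map_zero]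
    intro v v' μ ν ν' κ
    by_cases hA : ∃ (w : Vertex k) (η : v ⟶ w) (η' : v' ⟶ w), IsLeastSquare ν ν' η η' ∧
        μ ≫ η = κ ≫ η'
    · obtain ⟨w, η, η', hs, he⟩ := hA
      exact key μ ν ν' κ η η' hs he
    · by_cases hB : ∃ (w : Vertex k) (η' : v' ⟶ w) (η : v ⟶ w), IsLeastSquare κ μ η' η ∧
          ν' ≫ η' = ν ≫ η
      · obtain ⟨w, η', η, hs, he⟩ := hB
        exact (key ν' κ μ ν η' η hs he).symm
      · rw [hz v v' μ ν ν' κ fun w η η' hs he => hA ⟨w, η, η', hs, he⟩,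
          hz v' v ν' κ μ ν fun w η η' hs he => hB ⟨w, η, η', hs, he⟩]
  have h2 : ∀ (v : Vertex k) (μ ν : u ⟶ v) (b : FullCStar (Boundary (Vertex k) u)),
      T (matElt μ ν * b) = T (b * matElt μ ν) := by
    intro v μ ν b
    have : T.comp (ContinuousLinearMap.mul ℂ _ (matElt μ ν)) =
        T.comp ((ContinuousLinearMap.mul ℂ _).flip (matElt μ ν)) :=
      fullCStar_ext fun v' ν' κ => hgen _ _ _ _ _ _
    exact DFunLike.congr_fun this b
  have : T.comp ((ContinuousLinearMap.mul ℂ _).flip b) =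
      T.comp (ContinuousLinearMap.mul ℂ _ b) :=
    fullCStar_ext fun v' ν' κ => h2 _ _ _ _
  exact DFunLike.congr_fun this a

theorem isTracialState_limitTrace : IsTracialState (limitTrace hk) where
  nonneg a := limitTrace_nonneg hk fun x => unitState_star_mul_self x a
  norm_eq_one := norm_limitTrace hk
  tracial := map_mul_comm_of_diagonal _ (fun _ _ _ => limitTrace_matElt_of_ne hk)
    fun _ _ _ => limitTrace_matElt_self hk _ _

end

section

variable {k : ℕ → ℕ} {u v w : Vertex k}

/-! ### The recursion for the weights of cylinder sets -/

/-- The recursion satisfied by the weights `q n` of the cylinder sets of paths of length `n`: such a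
cylinder set is the union of those of its extensions by `α`, by `β` and by the `γ j`, and the first
two intersect in the cylinder set of the extension by `αβ`. -/
def IsWeight (k : ℕ → ℕ) (q : ℕ → ℂ) : Prop :=
  ∀ n, q n + q (n + 2) = (2 + k n) * q (n + 1)

theorem IsWeight.eq_zero {q : ℕ → ℂ} (hq : IsWeight k q) (h0 : q 0 = 0) {C : ℝ}
    (hC : ∀ n, ‖q n‖ ≤ C) (n : ℕ) : q n = 0 := by
  have hstep : ∀ n, 2 * ‖q (n + 1)‖ ≤ ‖q n‖ + ‖q (n + 2)‖ := fun n => by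
    refine le_trans ?_ (norm_add_le _ _)
    rw [hq n, norm_mul]
    refine mul_le_mul_of_nonneg_right ?_ (norm_nonneg _)
    rw [show (2 + k n : ℂ) = ((2 + k n : ℕ) : ℂ) by push_cast; rfl, Complex.norm_natCast]
    push_cast
    linarith [(Nat.cast_nonneg (k n) : (0 : ℝ) ≤ k n)]
  -- The norms form a convex sequence, so they grow at least linearly unless `q 1 = 0`.
  have hconv : ∀ n, ‖q 1‖ ≤ ‖q (n + 1)‖ - ‖q n‖ := by
    intro n
    induction n with
    | zero => simp [h0]
    | succ n ih => linarith [hstep n]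
  have hlin : ∀ n : ℕ, n * ‖q 1‖ ≤ ‖q n‖ := by
    intro n
    induction n with
    | zero => simp
    | succ n ih =>
      push_cast
      linarith [hconv n]
  have h1 : q 1 = 0 := by
    by_contra h
    obtain ⟨n, hn⟩ := Archimedean.arch C (norm_pos_iff.2 h)
    rw [nsmul_eq_mul] at hn
    have h2 := hlin (n + 1)
    push_cast at h2
    linarith [hC (n + 1), norm_pos_iff.2 h]
  induction n using Nat.strong_induction_on with
  | _ n ih =>
    match n, ih with
    | 0, _ => exact h0
    | 1, _ => exact h1
    | n + 2, ih =>
      have := hq n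
      rwa [ih n (by omega), ih (n + 1) (by omega), zero_add, mul_zero] at this

/-- A bounded solution of the recursion is determined by its initial value. -/
theorem IsWeight.eq_mul {p q : ℕ → ℂ} (hp : IsWeight k p) (hq : IsWeight k q) (h0 : p 0 = 1)
    {C C' : ℝ} (hC : ∀ n, ‖p n‖ ≤ C) (hC' : ∀ n, ‖q n‖ ≤ C') (n : ℕ) : q n = q 0 * p n := by
  have h : IsWeight k fun n => q n - q 0 * p n := fun n => by
    linear_combination hq n - q 0 * hp n
  refine sub_eq_zero.1 (h.eq_zero (C := C' + ‖q 0‖ * C) (by simp [h0]) (fun n => ?_) n)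
  refine (norm_sub_le _ _).trans (add_le_add (hC' n) ?_)
  rw [norm_mul]
  exact mul_le_mul_of_nonneg_left (hC n) (norm_nonneg _)

/-- An antitone nonnegative solution of the recursion tends to zero: its decrements `d n` tend to
zero, and `d n - d (n + 1) = k n * p (n + 1)`. -/
theorem tendsto_zero_of_recursion (hk : ∀ n : ℕ, ∃ i ≥ n, 0 < k i) {p : ℕ → ℝ}
    (h : ∀ n, p n + p (n + 2) = (2 + k n) * p (n + 1)) (h0 : ∀ n, 0 ≤ p n) (ha : Antitone p) :
    Filter.Tendsto p Filter.atTop (𝓝 0) := by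
  have hlim := tendsto_atTop_ciInf ha ⟨0, by rintro _ ⟨n, rfl⟩; exact h0 n⟩
  set L := ⨅ n, p n
  have h1 : Filter.Tendsto (fun n => p n + p (n + 2) - 2 * p (n + 1)) Filter.atTop (𝓝 0) := by
    have := (hlim.add (hlim.comp (Filter.tendsto_add_atTop_nat 2))).sub
      ((hlim.comp (Filter.tendsto_add_atTop_nat 1)).const_mul 2)
    rwa [show L + L - 2 * L = 0 by ring] at this
  have hL : L ≤ 0 := by
    refine le_of_forall_pos_le_add fun ε hε => ?_
    obtain ⟨N, hN⟩ := Filter.eventually_atTop.1 (h1.eventually_lt_const hε)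
    obtain ⟨i, hi, hki⟩ := hk N
    have h2 := hN i hi
    have h3 : p (i + 1) ≤ k i * p (i + 1) :=
      le_mul_of_one_le_left (h0 _) (by exact_mod_cast hki)
    have h4 : L ≤ p (i + 1) := ciInf_le ⟨0, by rintro _ ⟨n, rfl⟩; exact h0 n⟩ _
    linarith [h i]
  have hL0 : L = 0 := le_antisymm hL (ge_of_tendsto' hlim h0)
  rwa [hL0] at hlim

/-- The path `α ⋯ α` with range `v₁` and source `v`. -/
def alphaPath (v : Vertex k) : (⟨0⟩ : Vertex k) ⟶ v :=
  homMk (letter .α ^ v.index) (valid_of_countγ (by simp [weight_pow])) (by simp [len, weight_pow])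

/-- A linear functional whose value on the indicator function of the cylinder set of `μ` depends
only on the length of `μ` gives a solution of the recursion. -/
theorem isWeight_of_linear (T : C_c(Arr (UnitSpace k), ℂ) →ₗ[ℂ] ℂ) {q : ℕ → ℂ}
    (h : ∀ (v : Vertex k) (μ : (⟨0⟩ : Vertex k) ⟶ v), T (matUnit μ μ) = q v.index) :
    IsWeight k q := by
  intro n
  have e := congrArg T (matUnit_self_eq (alphaPath (⟨n⟩ : Vertex k)))
  simp only [map_add, map_sub, map_sum, h, Finset.sum_const, Finset.card_univ, Fintype.card_fin,
    nsmul_eq_mul] at e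
  linear_combination e

/-! ### Borel measures on the boundary -/

theorem bdCylinder_id : bdCylinder (⟨u, 𝟙 u⟩ : PathsFrom (Vertex k) u) = univ :=
  eq_univ_of_forall fun x => id_mem x.1

theorem isPiSystem_bdCylinder : IsPiSystem (range (bdCylinder (u := u) (k := k))) := by
  rintro _ ⟨p, rfl⟩ _ ⟨q, rfl⟩ ⟨x, hp, hq⟩
  obtain ⟨c, -, h1, h2⟩ := x.1.directed _ hp _ hq
  obtain ⟨l, h1, h2, h3⟩ := exists_least_extension h1 h2
  refine ⟨l, Subset.antisymm (fun y hy => ⟨y.1.hereditary _ _ hy h1, y.1.hereditary _ _ hy h2⟩) ?_⟩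
  rintro y ⟨hy, hy'⟩
  obtain ⟨d, hd, h4, h5⟩ := y.1.directed _ hy _ hy'
  exact y.1.hereditary _ _ hd (h3 _ h4 h5)

theorem borel_boundary_eq : borel (Boundary (Vertex k) u) =
    MeasurableSpace.generateFrom (range bdCylinder) := by
  refine le_antisymm ?_ ?_
  · have ht : (inferInstance : TopologicalSpace (Boundary (Vertex k) u)) = _ :=
      induced_generateFrom_eq
    rw [borel_eq_generateFrom_of_subbasis ht]
    refine MeasurableSpace.generateFrom_le ?_
    rintro _ ⟨_, ⟨l, F, hF, rfl⟩, rfl⟩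
    have hm : ∀ p : PathsFrom (Vertex k) u,
        MeasurableSet[MeasurableSpace.generateFrom (range bdCylinder)] (bdCylinder p) :=
      fun p => MeasurableSpace.measurableSet_generateFrom ⟨p, rfl⟩
    have e : (Subtype.val ⁻¹' (cylinder l \ ⋃ m ∈ F, cylinder m) : Set (Boundary (Vertex k) u)) =
        bdCylinder l \ ⋃ m ∈ F, bdCylinder m := by
      ext x
      change x.1 ∈ cylinder l \ ⋃ m ∈ F, cylinder m ↔ _
      simp [bdCylinder, cylinder]
    rw [e]
    exact (hm l).diff (MeasurableSet.biUnion hF.countable fun m _ => hm m)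
  · refine MeasurableSpace.generateFrom_le ?_
    rintro _ ⟨p, rfl⟩
    exact (isClopen_bdCylinder p).isOpen.measurableSet

theorem measure_ext_bdCylinder {m m' : Measure (Boundary (Vertex k) u)} [IsFiniteMeasure m]
    (h : ∀ p, m (bdCylinder p) = m' (bdCylinder p)) : m = m' := by
  refine ext_of_generate_finite _ borel_boundary_eq isPiSystem_bdCylinder ?_ ?_
  · rintro _ ⟨p, rfl⟩
    exact h p
  · rw [← bdCylinder_id]
    exact h _

theorem measurableSet_bdCylinder (p : PathsFrom (Vertex k) u) : MeasurableSet (bdCylinder p) :=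
  (isClopen_bdCylinder p).isOpen.measurableSet

theorem continuous_comp_unitArr (f : C_c(Arr (Boundary (Vertex k) u), ℂ)) :
    Continuous fun x => f (unitArr x) := f.continuous.comp continuous_unitArr

theorem integrable_comp_unitArr (m : Measure (Boundary (Vertex k) u)) [IsFiniteMeasure m]
    (f : C_c(Arr (Boundary (Vertex k) u), ℂ)) : Integrable (fun x => f (unitArr x)) m :=
  (continuous_comp_unitArr f).integrable_of_hasCompactSupport (HasCompactSupport.of_compactSpace _)

/-- The functional `f ↦ ∫ f|_{G^(0)} dm`. -/
def unitIntegral (m : Measure (Boundary (Vertex k) u)) [IsFiniteMeasure m] :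
    C_c(Arr (Boundary (Vertex k) u), ℂ) →ₗ[ℂ] ℂ where
  toFun f := ∫ x, f (unitArr x) ∂m
  map_add' f g := integral_add (integrable_comp_unitArr m f) (integrable_comp_unitArr m g)
  map_smul' c _ := integral_const_mul c _

theorem unitIntegral_matUnit (m : Measure (Boundary (Vertex k) u)) [IsFiniteMeasure m]
    (μ : u ⟶ v) : unitIntegral m (matUnit μ μ) = m.real (bdCylinder ⟨v, μ⟩) := by
  have : (fun x => matUnit μ μ (unitArr x)) = (bdCylinder ⟨v, μ⟩).indicator fun _ => (1 : ℂ) := by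
    funext x
    by_cases hx : x ∈ bdCylinder ⟨v, μ⟩
    · rw [matUnit_self_unitArr hx, indicator_of_mem hx]
    · rw [matUnit_self_unitArr_of_notMem hx, indicator_of_notMem hx]
  change ∫ x, matUnit μ μ (unitArr x) ∂m = _
  rw [this, integral_indicator (measurableSet_bdCylinder _)]
  simp

/-! ### The measure of the trace -/

variable (hk : ∀ n : ℕ, ∃ i ≥ n, 0 < k i)

/-- The restriction of the trace to the real functions on the unit space. -/
def traceFunctional : C_c(UnitSpace k, ℝ) →ₚ[ℝ] ℝ :=
  PositiveLinearMap.mk₀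
    { toFun := fun φ => (limitTrace hk (toFullCStar (push (𝟙 _) (𝟙 _)
        ⟨fun x => (φ x : ℂ), Complex.continuous_ofReal.comp φ.continuous⟩))).re
      map_add' := fun φ ψ => by
        rw [← Complex.add_re, ← map_add]
        refine limitTrace_re_congr hk fun x => ?_
        rw [unitState_add]
        simp only [unitState_toFullCStar, unitArr_eq_mkArr, push_mkArr]
        simp
      map_smul' := fun c φ => by
        rw [RingHom.id_apply, smul_eq_mul, ← Complex.re_ofReal_mul, ← smul_eq_mul, ← map_smul]
        refine limitTrace_re_congr hk fun x => ?_
        rw [unitState_smul]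
        simp only [unitState_toFullCStar, unitArr_eq_mkArr, push_mkArr]
        simp }
    fun φ hφ => (Complex.nonneg_iff.1 (limitTrace_nonneg hk fun x => by
      rw [unitState_toFullCStar, unitArr_eq_mkArr, push_mkArr]
      exact Complex.zero_le_real.2 (hφ x))).1

theorem traceFunctional_eq {φ : C_c(UnitSpace k, ℝ)} {f : C_c(Arr (UnitSpace k), ℂ)}
    (h : ∀ x, φ x = (f (unitArr x)).re) :
    traceFunctional hk φ = (limitTrace hk (toFullCStar f)).re := by
  refine limitTrace_re_congr hk fun x => ?_
  rw [unitState_toFullCStar, unitState_toFullCStar, ← h, unitArr_eq_mkArr, push_mkArr]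
  simp

/-- The measure representing the trace. -/
def traceMeasure : Measure (UnitSpace k) := RealRMK.rieszMeasure (traceFunctional hk)

instance isFiniteMeasure_traceMeasure : IsFiniteMeasure (traceMeasure hk) :=
  inferInstanceAs (IsFiniteMeasure (RealRMK.rieszMeasure (traceFunctional hk)))

theorem integral_re_traceMeasure (f : C_c(Arr (UnitSpace k), ℂ)) :
    ∫ x, (f (unitArr x)).re ∂traceMeasure hk = (limitTrace hk (toFullCStar f)).re := by
  let φ : C_c(UnitSpace k, ℝ) := CompactlySupportedContinuousMap.continuousMapEquiv
    ⟨fun x => (f (unitArr x)).re, Complex.continuous_re.comp (continuous_comp_unitArr f)⟩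
  rw [← traceFunctional_eq hk (φ := φ) fun x => rfl]
  exact RealRMK.integral_rieszMeasure (traceFunctional hk) φ

/-- The representation of the trace by the measure, for complex functions. The imaginary part is
obtained from the real part by multiplication with `-i`. -/
theorem limitTrace_toFullCStar (f : C_c(Arr (UnitSpace k), ℂ)) :
    limitTrace hk (toFullCStar f) = ∫ x, f (unitArr x) ∂traceMeasure hk := by
  have him : ∫ x, (f (unitArr x)).im ∂traceMeasure hk = (limitTrace hk (toFullCStar f)).im := by
    have h1 := integral_re_traceMeasure hk (-Complex.I • f)
    have h2 : toFullCStar (-Complex.I • f) = -Complex.I • toFullCStar f :=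
      map_smul (toFullCStarₗ (UnitSpace k)) _ _
    rw [h2, map_smul] at h1
    simpa using h1
  have hre := integral_re_traceMeasure hk f
  have hi := integrable_comp_unitArr (traceMeasure hk) f
  refine Complex.ext ?_ ?_
  · rw [← hre]
    exact integral_re hi
  · rw [← him]
    exact integral_im hi

theorem limitTrace_matElt_eq (μ : (⟨0⟩ : Vertex k) ⟶ v) :
    limitTrace hk (matElt μ μ) = (traceMeasure hk).real (bdCylinder ⟨v, μ⟩) :=
  (limitTrace_toFullCStar hk _).trans (unitIntegral_matUnit (traceMeasure hk) μ)

instance isProbabilityMeasure_traceMeasure : IsProbabilityMeasure (traceMeasure hk) := by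
  have h := limitTrace_matElt_eq hk (𝟙 (⟨0⟩ : Vertex k))
  rw [limitTrace_one] at h
  rw [bdCylinder_id] at h
  have h' : (traceMeasure hk).real univ = 1 := by exact_mod_cast h.symm
  exact ⟨(ENNReal.toReal_eq_one_iff _).1 h'⟩

/-- The measure of the cylinder sets of the paths of length `n`; it does not depend on the path
(`traceMeasure_bdCylinder`). -/
def cylWeight (n : ℕ) : ℝ := (traceMeasure hk).real (bdCylinder ⟨⟨n⟩, alphaPath ⟨n⟩⟩)

theorem traceMeasure_bdCylinder (μ : (⟨0⟩ : Vertex k) ⟶ v) :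
    (traceMeasure hk).real (bdCylinder ⟨v, μ⟩) = cylWeight hk v.index := by
  have := limitTrace_matElt_self hk μ (alphaPath v)
  rw [limitTrace_matElt_eq, limitTrace_matElt_eq] at this
  exact_mod_cast this

theorem isWeight_cylWeight : IsWeight k fun n => (cylWeight hk n : ℂ) :=
  isWeight_of_linear (unitIntegral (traceMeasure hk)) fun v μ => by
    rw [unitIntegral_matUnit, traceMeasure_bdCylinder]

theorem cylWeight_zero : cylWeight hk 0 = 1 := by
  rw [← traceMeasure_bdCylinder hk (𝟙 (⟨0⟩ : Vertex k))]
  rw [bdCylinder_id]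
  simp

theorem norm_cylWeight_le (n : ℕ) : ‖(cylWeight hk n : ℂ)‖ ≤ 1 := by
  rw [Complex.norm_real, cylWeight, Real.norm_of_nonneg measureReal_nonneg]
  exact measureReal_le_one

theorem antitone_cylWeight : Antitone (cylWeight hk) := by
  refine antitone_nat_of_succ_le fun n => ?_
  rw [← traceMeasure_bdCylinder hk (alphaPath ⟨n⟩ ≫ edgeα ⟨n⟩)]
  exact measureReal_mono fun x hx => x.1.hereditary _ _ hx ⟨edgeα ⟨n⟩, rfl⟩

theorem tendsto_cylWeight : Filter.Tendsto (cylWeight hk) Filter.atTop (𝓝 0) :=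
  tendsto_zero_of_recursion hk (fun n => by
    have := isWeight_cylWeight hk n
    simp only at this
    exact_mod_cast this)
    (fun _ => measureReal_nonneg) (antitone_cylWeight hk)

end

section

variable {k : ℕ → ℕ} {u v w : Vertex k}

/-! ### Invariance and uniqueness of the measure -/

/-- If the measures of cylinder sets depend only on the sources of the paths, then the measure of
`μF` does not change if `μ` is replaced by a path `ν` with the same source. -/
theorem measure_bdExtend_image {m : Measure (Boundary (Vertex k) u)} [IsFiniteMeasure m]
    (h : ∀ (v : Vertex k) (μ ν : u ⟶ v), m (bdCylinder ⟨v, μ⟩) = m (bdCylinder ⟨v, ν⟩))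
    (μ ν : u ⟶ v) (F : Set (Boundary (Vertex k) v)) :
    m (bdExtend μ '' F) = m (bdExtend ν '' F) := by
  have hμ : ∀ μ : u ⟶ v, MeasurableEmbedding (bdExtend μ) := fun μ =>
    (isOpenEmbedding_bdExtend μ).measurableEmbedding
  have : IsFiniteMeasure (m.comap (bdExtend μ)) := ⟨by
    rw [(hμ μ).comap_apply]
    exact measure_lt_top _ _⟩
  have e : m.comap (bdExtend μ) = m.comap (bdExtend ν) := by
    refine measure_ext_bdCylinder fun p => ?_
    rw [(hμ μ).comap_apply, (hμ ν).comap_apply]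
    obtain ⟨w, η⟩ := p
    rw [bdExtend_image_bdCylinder, bdExtend_image_bdCylinder]
    exact h _ _ _
  rw [← (hμ μ).comap_apply, e, (hμ ν).comap_apply]

/-- Every open bisection is a disjoint union of countably many sets `[μ, ν, F]`. -/
theorem isInvariant_of_bdCylinder {m : Measure (Boundary (Vertex k) u)} [IsFiniteMeasure m]
    (h : ∀ (v : Vertex k) (μ ν : u ⟶ v), m (bdCylinder ⟨v, μ⟩) = m (bdCylinder ⟨v, ν⟩)) :
    IsInvariant m := by
  intro E hE hr hs
  have : Nonempty (MatIndex u) := ⟨⟨u, 𝟙 u, 𝟙 u⟩⟩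
  obtain ⟨e, he⟩ := exists_surjective_nat (MatIndex u)
  let B : ℕ → Set (Arr (Boundary (Vertex k) u)) := fun n => range (mkArr (e n).2.1 (e n).2.2)
  have hB : ⋃ n, disjointed B n = univ := by
    rw [iUnion_disjointed]
    refine eq_univ_of_forall fun a => ?_
    obtain ⟨v, μ, ν, z, rfl⟩ := exists_mkArr a
    obtain ⟨n, hn⟩ := he ⟨v, μ, ν⟩
    refine mem_iUnion.2 ⟨n, ?_⟩
    change mkArr μ ν z ∈ range (mkArr (e n).2.1 (e n).2.2)
    rw [hn]
    exact ⟨z, rfl⟩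
  have hD : ∀ n, IsOpen (disjointed B n) := fun n =>
    (disjointedRec (p := IsClopen) (fun _ i ht => ht.diff (isClopen_range_mkArr _ _))
      (isClopen_range_mkArr _ _)).isOpen
  let F : ∀ n, Set (Boundary (Vertex k) (e n).1) := fun n =>
    mkArr (e n).2.1 (e n).2.2 ⁻¹' (E ∩ disjointed B n)
  have hF : ∀ n, IsOpen (F n) := fun n => (hE.inter (hD n)).preimage (continuous_mkArr _ _)
  have hEF : ∀ n, E ∩ disjointed B n = mkArr (e n).2.1 (e n).2.2 '' F n := fun n => by
    rw [image_preimage_eq_iff.2]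
    exact inter_subset_right.trans (disjointed_subset _ _)
  have hEn : E = ⋃ n, E ∩ disjointed B n := by rw [← inter_iUnion, hB, inter_univ]
  have hdis : Pairwise fun i j => Disjoint (E ∩ disjointed B i) (E ∩ disjointed B j) :=
    fun i j hij => (disjoint_disjointed B hij).mono inter_subset_right inter_subset_right
  have hsum : ∀ (g : Arr (Boundary (Vertex k) u) → Boundary (Vertex k) u)
      (ρ : ∀ n, u ⟶ (e n).1), (∀ n z, g (mkArr (e n).2.1 (e n).2.2 z) = bdExtend (ρ n) z) →
      InjOn g E → m (g '' E) = ∑' n, m (bdExtend (ρ n) '' F n) := by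
    intro g ρ hg hinj
    have himg : ∀ n, g '' (E ∩ disjointed B n) = bdExtend (ρ n) '' F n := fun n => by
      rw [hEF, image_image]
      simp only [hg]
    conv_lhs => rw [hEn]
    rw [image_iUnion, measure_iUnion]
    · simp only [himg]
    · intro i j hij
      rw [Function.onFun, Set.disjoint_iff_inter_eq_empty,
        ← hinj.image_inter inter_subset_left inter_subset_left, (hdis hij).inter_eq, image_empty]
    · intro n
      rw [himg]
      exact ((isOpenEmbedding_bdExtend _).isOpenMap _ (hF n)).measurableSet
  rw [hsum Arr.s (fun n => (e n).2.2) (fun _ _ => rfl) hs,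
    hsum Arr.r (fun n => (e n).2.1) (fun _ _ => rfl) hr]
  exact tsum_congr fun n => measure_bdExtend_image h _ _ _

theorem IsInvariant.measure_bdCylinder {m : Measure (Boundary (Vertex k) u)} (hm : IsInvariant m)
    (μ ν : u ⟶ v) : m (bdCylinder ⟨v, μ⟩) = m (bdCylinder ⟨v, ν⟩) := by
  have h := hm (range (mkArr ν μ)) (isClopen_range_mkArr _ _).isOpen
    (by rintro _ ⟨z, rfl⟩ _ ⟨z', rfl⟩ e; rw [bdExtend_injective ν e])
    (by rintro _ ⟨z, rfl⟩ _ ⟨z', rfl⟩ e; rw [bdExtend_injective μ e])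
  rw [← range_comp, ← range_comp] at h
  rw [← range_bdExtend, ← range_bdExtend]
  exact h

variable (hk : ∀ n : ℕ, ∃ i ≥ n, 0 < k i)

theorem isInvariant_traceMeasure : IsInvariant (traceMeasure hk) :=
  isInvariant_of_bdCylinder fun v μ ν => by
    rw [← measureReal_eq_measureReal_iff, traceMeasure_bdCylinder, traceMeasure_bdCylinder]

/-- An invariant probability measure has the same values at the cylinder sets as the measure of the
trace, as both satisfy the recursion. -/
theorem eq_traceMeasure {m : Measure (UnitSpace k)} [IsProbabilityMeasure m] (hm : IsInvariant m) :
    m = traceMeasure hk := by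
  have hq : ∀ (v : Vertex k) (μ : (⟨0⟩ : Vertex k) ⟶ v), m.real (bdCylinder ⟨v, μ⟩) =
      m.real (bdCylinder ⟨⟨v.index⟩, alphaPath ⟨v.index⟩⟩) := fun v μ =>
    congrArg ENNReal.toReal (hm.measure_bdCylinder μ (alphaPath v))
  have hw : IsWeight k fun n => (m.real (bdCylinder ⟨⟨n⟩, alphaPath ⟨n⟩⟩) : ℂ) :=
    isWeight_of_linear (unitIntegral m) fun v μ => by rw [unitIntegral_matUnit, hq]
  have h0 : m.real (bdCylinder ⟨⟨0⟩, alphaPath (⟨0⟩ : Vertex k)⟩) = 1 := by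
    rw [← hq ⟨0⟩ (𝟙 _), bdCylinder_id]
    simp
  have h := (isWeight_cylWeight hk).eq_mul hw (by rw [cylWeight_zero, Complex.ofReal_one])
    (norm_cylWeight_le hk) (C' := 1) fun n => by
      rw [Complex.norm_real, Real.norm_of_nonneg measureReal_nonneg]
      exact measureReal_le_one
  refine measure_ext_bdCylinder fun p => ?_
  obtain ⟨v, μ⟩ := p
  rw [← measureReal_eq_measureReal_iff, traceMeasure_bdCylinder, hq]
  have h1 := h v.index
  rw [h0, Complex.ofReal_one, one_mul] at h1
  exact_mod_cast h1

/-! ### Uniqueness of the trace -/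

variable {T : FullCStar (UnitSpace k) →L[ℂ] ℂ}

theorem IsTracialState.matElt_self (hT : IsTracialState T) (μ ν : (⟨0⟩ : Vertex k) ⟶ v) :
    T (matElt μ μ) = T (matElt ν ν) := by
  rw [← matElt_mul_same μ ν μ, hT.tracial, matElt_mul_same]

theorem IsTracialState.norm_matElt_le (hT : IsTracialState T) (μ ν : (⟨0⟩ : Vertex k) ⟶ v) :
    ‖T (matElt μ ν)‖ ≤ 1 := by
  refine (T.le_opNorm _).trans ?_
  rw [hT.norm_eq_one, one_mul]
  exact PathGroupoid.norm_matElt_le _ _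

/-- The value of a tracial state at `e(μ, μ)` is determined by its value at the unit. -/
theorem IsTracialState.matElt_self_eq (hT : IsTracialState T) (μ : (⟨0⟩ : Vertex k) ⟶ v) :
    T (matElt μ μ) = T (matElt (𝟙 _) (𝟙 _)) * cylWeight hk v.index := by
  have hw : IsWeight k fun n => T (matElt (alphaPath ⟨n⟩) (alphaPath ⟨n⟩)) :=
    isWeight_of_linear (T.toLinearMap ∘ₗ toFullCStarₗ (UnitSpace k)) fun v μ =>
      hT.matElt_self μ (alphaPath v)
  have h := (isWeight_cylWeight hk).eq_mul hw (by rw [cylWeight_zero, Complex.ofReal_one])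
    (norm_cylWeight_le hk) (fun n => hT.norm_matElt_le _ _) v.index
  rw [hT.matElt_self μ (alphaPath v), hT.matElt_self (𝟙 _) (alphaPath _)]
  exact h

/-- The Cauchy–Schwarz inequality for the elements `e(μ, μ)` and `e(μ, ν)`. -/
theorem IsTracialState.abs_matElt_le (hT : IsTracialState T) (μ ν : (⟨0⟩ : Vertex k) ⟶ v) :
    |(T (matElt μ ν)).re| ≤ (T (matElt μ μ)).re ∧ |(T (matElt μ ν)).im| ≤ (T (matElt μ μ)).re := by
  -- Positivity at `e(μ, μ) + t e(μ, ν)`, to be used for `t = ±1` and `t = ±i`.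
  have key : ∀ t : ℂ, 0 ≤ T (matElt μ μ) + t * T (matElt μ ν) + starRingEnd ℂ t * T (matElt ν μ) +
      starRingEnd ℂ t * t * T (matElt μ μ) := by
    intro t
    have h := hT.nonneg (matElt μ μ + t • matElt μ ν)
    rw [star_add, star_smul, star_matElt, star_matElt, add_mul, mul_add, mul_add, smul_mul_assoc,
      smul_mul_assoc, mul_smul_comm, mul_smul_comm, matElt_mul_same, matElt_mul_same,
      matElt_mul_same, matElt_mul_same] at h
    simp only [map_add, map_smul, smul_eq_mul] at h
    rw [hT.matElt_self ν μ] at h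
    convert h using 1
    simp only [starRingEnd_apply]
    ring
  have h1 := Complex.nonneg_iff.1 (key 1)
  have h2 := Complex.nonneg_iff.1 (key (-1))
  have h3 := Complex.nonneg_iff.1 (key Complex.I)
  have h4 := Complex.nonneg_iff.1 (key (-Complex.I))
  simp at h1 h2 h3 h4
  constructor <;> rw [abs_le] <;> constructor <;>
    linarith [h1.1, h1.2, h2.1, h2.2, h3.1, h3.2, h4.1, h4.2]

/-- A tracial state takes the same value at an off-diagonal matrix unit as at one given by longer
paths, unless it vanishes there: `e(μ, ν)` may be replaced by
`e(ν, ν) e(μ, ν) = e(νη, νη')`, where `νη = μη'` is the least common extension. -/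
theorem IsTracialState.matElt_step (hT : IsTracialState T) {μ ν : (⟨0⟩ : Vertex k) ⟶ v}
    (h : μ ≠ ν) : T (matElt μ ν) = 0 ∨ ∃ (w : Vertex k) (μ' ν' : (⟨0⟩ : Vertex k) ⟶ w),
      v.index < w.index ∧ μ' ≠ ν' ∧ T (matElt μ ν) = T (matElt μ' ν') := by
  have e : T (matElt μ ν) = T (matElt ν ν * matElt μ ν) := by
    rw [hT.tracial, matElt_mul_same]
  by_cases hex : ∃ (w : Vertex k) (η : v ⟶ w) (η' : v ⟶ w), ν ≫ η = μ ≫ η'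
  · right
    obtain ⟨w, η, η', hη⟩ := hex
    obtain ⟨w, η, η', hη⟩ := exists_isLeastSquare hη
    have hne : η ≠ η' := by
      rintro rfl
      exact h (CategoryOfPaths.right_cancel _ _ _ hη.comm).symm
    refine ⟨w, ν ≫ η, ν ≫ η', ?_, fun hc => hne (CategoryOfPaths.left_cancel _ _ _ hc), ?_⟩
    · by_contra hlt
      have h1 := hom_len η
      have h2 := hom_len η'
      exact hne (hom_ext ((eq_one_of_len (by omega)).trans (eq_one_of_len (by omega)).symm))
    · rw [e, matElt_mul ν ν hη]
  · left
    rw [e, matElt_mul_eq_zero ν ν fun w η η' h => hex ⟨w, η, η', h⟩, map_zero]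

/-- By iteration of `IsTracialState.matElt_step` the value is attained at matrix units of arbitrarily
long paths, where it is bounded by the weights of their cylinder sets. -/
theorem IsTracialState.matElt_of_ne (hk : ∀ n : ℕ, ∃ i ≥ n, 0 < k i)
    (hT : IsTracialState T) {μ ν : (⟨0⟩ : Vertex k) ⟶ v} (h : μ ≠ ν) : T (matElt μ ν) = 0 := by
  by_contra h0
  have hex : ∀ n : ℕ, ∃ (w : Vertex k) (μ' ν' : (⟨0⟩ : Vertex k) ⟶ w),
      n ≤ w.index ∧ μ' ≠ ν' ∧ T (matElt μ ν) = T (matElt μ' ν') := by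
    intro n
    induction n with
    | zero => exact ⟨v, μ, ν, Nat.zero_le _, h, rfl⟩
    | succ n ih =>
      obtain ⟨w, μ', ν', hn, hne, e⟩ := ih
      rcases hT.matElt_step hne with h1 | ⟨w', μ'', ν'', hn', hne', e'⟩
      · exact absurd (e.trans h1) h0
      · exact ⟨w', μ'', ν'', by omega, hne', e.trans e'⟩
  have hle : ∀ n : ℕ, |(T (matElt μ ν)).re| ≤ cylWeight hk n ∧
      |(T (matElt μ ν)).im| ≤ cylWeight hk n := by
    intro n
    obtain ⟨w, μ', ν', hn, -, e⟩ := hex n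
    have h1 := hT.abs_matElt_le μ' ν'
    have h2 : (T (matElt μ' μ')).re ≤ cylWeight hk n := by
      refine le_trans ?_ (antitone_cylWeight hk hn)
      rw [hT.matElt_self_eq hk, Complex.re_mul_ofReal]
      refine mul_le_of_le_one_left measureReal_nonneg ?_
      exact (Complex.re_le_norm _).trans (hT.norm_matElt_le _ _)
    rw [e]
    exact ⟨h1.1.trans h2, h1.2.trans h2⟩
  refine h0 (Complex.ext ?_ ?_)
  · exact abs_nonpos_iff.1 (ge_of_tendsto' (tendsto_cylWeight hk) fun n => (hle n).1)
  · exact abs_nonpos_iff.1 (ge_of_tendsto' (tendsto_cylWeight hk) fun n => (hle n).2)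

theorem IsTracialState.eq_limitTrace (hT : IsTracialState T) : T = limitTrace hk := by
  have e : T = T (matElt (𝟙 _) (𝟙 _)) • limitTrace hk := by
    refine fullCStar_ext fun v μ ν => ?_
    rw [smul_apply, smul_eq_mul]
    by_cases h : μ = ν
    · subst h
      rw [hT.matElt_self_eq hk, limitTrace_matElt_eq, traceMeasure_bdCylinder]
    · rw [hT.matElt_of_ne hk h, limitTrace_matElt_of_ne hk h, mul_zero]
  have hn : ‖T (matElt (𝟙 _) (𝟙 _))‖ = 1 := by
    have := congrArg norm e
    rwa [norm_smul, norm_limitTrace, mul_one, hT.norm_eq_one, eq_comm] at this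
  have h0 : 0 ≤ T (matElt (𝟙 _) (𝟙 _)) := by
    have := hT.nonneg (matElt (𝟙 _) (𝟙 _))
    rwa [star_matElt, matElt_mul_same] at this
  have h1 : T (matElt (𝟙 _) (𝟙 _)) = 1 := by
    rw [Complex.eq_coe_norm_of_nonneg h0, hn, Complex.ofReal_one]
  rw [e, h1, one_smul]

end

section

variable {k : ℕ → ℕ} {u v w : Vertex k}

/-! ### Points with nontrivial isotropy -/

theorem mk_comp_eqToHom {x y y' : Boundary (Vertex k) u} (g : x ⟶ y) (h : y = y') :
    (⟨x, y', g ≫ eqToHom h⟩ : Arr (Boundary (Vertex k) u)) = ⟨x, y, g⟩ := by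
  subst h
  simp

theorem mem_nontrivialIsotropy_iff {x : Boundary (Vertex k) u} :
    x ∈ nontrivialIsotropy (Boundary (Vertex k) u) ↔ ∃ (v : Vertex k) (μ ν : u ⟶ v)
      (z : Boundary (Vertex k) v), μ ≠ ν ∧ x = bdExtend μ z ∧ bdExtend ν z = bdExtend μ z := by
  constructor
  · rintro ⟨g, hg⟩
    obtain ⟨v, μ, ν, z, h⟩ := exists_mkArr (⟨x, x, g⟩ : Arr (Boundary (Vertex k) u))
    have hr : x = bdExtend μ z := congrArg Arr.r h
    have hs : x = bdExtend ν z := congrArg Arr.s h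
    refine ⟨v, μ, ν, z, ?_, hr, hs.symm.trans hr⟩
    rintro rfl
    rw [← unitArr_bdExtend, ← hr] at h
    simp only [unitArr, Arr.mk.injEq, heq_eq_eq, true_and] at h
    exact hg h
  · rintro ⟨v, μ, ν, z, hne, rfl, h⟩
    refine ⟨mkHom μ ν z ≫ eqToHom h, fun h' => ?_⟩
    refine unitArr_ne_mkArr hne (bdExtend μ z) z ?_
    rw [mkArr, ← mk_comp_eqToHom (mkHom μ ν z) h, h']
    rfl

theorem eq_letter_pow (a : Letter) {m : WordMonoid} {c : Letter → ℕ} (hc : ∀ b, b ≠ a → c b ≠ 0)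
    (h : weight c m = 0) : m = letter a ^ len m := by
  induction m using wordMonoid_induction with
  | one => simp
  | mul b m ih =>
    rw [weight_mul, weight_letter] at h
    obtain rfl : b = a := by
      by_contra hb
      exact hc b hb (by omega)
    rw [len_mul, len_letter, pow_add, pow_one, ← ih (by omega)]

/-- A weight is either unbounded on a directed set, or attains its maximum. -/
theorem exists_max_weight (c : Letter → ℕ) (z : PathSpace (Vertex k) v) :
    (∃ p ∈ z.carrier, ∀ q ∈ z.carrier, val p ∣ val q → weight c (val q) ≤ weight c (val p)) ∨
      ∀ n, ∃ p ∈ z.carrier, n ≤ weight c (val p) := by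
  by_contra! h
  obtain ⟨h1, n, hn⟩ := h
  have : ∀ n, ∃ p ∈ z.carrier, n ≤ weight c (val p) := by
    intro n
    induction n with
    | zero => exact ⟨_, id_mem z, Nat.zero_le _⟩
    | succ n ih =>
      obtain ⟨p, hp, hn⟩ := ih
      obtain ⟨q, hq, -, hlt⟩ := h1 p hp
      exact ⟨q, hq, by omega⟩
  obtain ⟨p, hp, hp'⟩ := this n
  exact absurd (hn p hp) (by omega)

theorem exists_mul_eq_of_extend_eq {μ ν : u ⟶ v} {z : PathSpace (Vertex k) v}
    (h : z.extend ν = z.extend μ) {p : PathsFrom (Vertex k) v} (hp : p ∈ z.carrier) :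
    ∃ q ∈ z.carrier, val p ∣ val q ∧ ν.1 * val p ∣ μ.1 * val q := by
  have h1 : prepend ν p ∈ (z.extend μ).carrier := h ▸ prepend_mem_extend.2 hp
  obtain ⟨q, hq, h2⟩ := h1
  obtain ⟨d, hd, h3, h4⟩ := z.directed _ hp _ hq
  rw [isPrefix_iff] at h2 h3 h4
  refine ⟨d, hd, h3, dvd_trans (b := μ.1 * val q) h2 (mul_dvd_mul_left _ h4)⟩

/-- If all extensions in `z` of some path are extensions by powers of one letter, then `μz = νz`
implies `μ = ν`. -/
theorem eq_of_extend_eq {μ ν : u ⟶ v} {z : PathSpace (Vertex k) v} (h : z.extend ν = z.extend μ)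
    (a : Letter) {p : PathsFrom (Vertex k) v} (hp : p ∈ z.carrier)
    (ha : ∀ q ∈ z.carrier, val p ∣ val q → ∃ t, val q = val p * letter a ^ t) : μ = ν := by
  classical
  let c : Letter → ℕ := fun b => if b = a then 0 else 1
  have hpow : ∀ t, weight c (letter a ^ t) = 0 := by simp [weight_pow, c]
  have key : ∀ {μ ν : u ⟶ v}, z.extend ν = z.extend μ → ∃ r t,
      ν.1 * val p * r = μ.1 * (val p * letter a ^ t) := by
    intro μ ν h
    obtain ⟨q, hq, h1, r, hr⟩ := exists_mul_eq_of_extend_eq h hp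
    obtain ⟨t, ht⟩ := ha q hq h1
    exact ⟨r, t, by rw [← hr, ht]⟩
  obtain ⟨r, t, h1⟩ := key h
  obtain ⟨r', t', h2⟩ := key h.symm
  have e1 := congrArg (weight c) h1
  have e2 := congrArg (weight c) h2
  have e3 := congrArg len h1
  simp only [weight_mul, hpow] at e1 e2
  have hr := eq_letter_pow a (c := c) (fun b hb => by simp [c, hb]) (by omega : weight c r = 0)
  have hlen := hom_len μ
  have hlen' := hom_len ν
  have ht : len (letter a ^ t) = t := by simp [len, weight_pow]
  rw [len_mul, len_mul, len_mul, len_mul, ht] at e3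
  have : len r = t := by omega
  rw [hr, this, mul_assoc] at h1
  exact hom_ext (wordMonoid_right_cancel _ _ _ h1).symm

/-- The set `z` consists of paths without edges `γ`, as paths ending in `γ` of the same length with
a common extension are equal, and a path which is not in `z` would bound the number of edges `α` or
`β` in the paths in `z`. -/
theorem eq_gammaFree_of_extend_eq {μ ν : u ⟶ v} {z : PathSpace (Vertex k) v}
    (h : z.extend ν = z.extend μ) (hne : μ ≠ ν) : z = gammaFree v := by
  have hγ : ∀ p ∈ z.carrier, countγ (val p) = 0 := by
    intro p hp
    by_contra hc
    obtain ⟨l, j, r, e⟩ := exists_gamma hc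
    obtain ⟨q, hq, hqp⟩ := exists_path_of_dvd (m := l * letter (.γ j)) p ⟨r, by rw [e, mul_assoc]⟩
    have hqz := z.hereditary _ _ hp hqp
    have h1 : prepend μ q ∈ (z.extend μ).carrier := prepend_mem_extend.2 hqz
    have h2 : prepend ν q ∈ (z.extend μ).carrier := h ▸ prepend_mem_extend.2 hqz
    have e1 : val (prepend μ q) = μ.1 * val q := rfl
    have e2 : val (prepend ν q) = ν.1 * val q := rfl
    have k1 := hom_len μ
    have k2 := hom_len ν
    rcases isPrefix_gamma h1 h2 (l := μ.1 * l) (j := j) (by rw [e1, hq, mul_assoc]) with h3 | h3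
    · have := weight_dvd (fun _ => 1) h3
      change len (val (prepend ν q)) ≤ len (μ.1 * l) at this
      rw [e2, hq, len_mul, len_mul, len_mul, len_letter] at this
      omega
    · have := eq_of_dvd_of_len h3 (by rw [e1, e2, len_mul, len_mul]; omega)
      exact hne (hom_ext (wordMonoid_right_cancel _ _ _ (e1.symm.trans (this.trans e2))))
  -- If the number of edges `α` is maximal at `p`, then all extensions of `p` in `z` are by `β`.
  have hα : ∀ n, ∃ p ∈ z.carrier, n ≤ countα (val p) := by
    refine (exists_max_weight _ z).resolve_left ?_
    rintro ⟨p, hp, hmax⟩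
    refine hne (eq_of_extend_eq h .β hp fun q hq hpq => ?_)
    have h1 := hmax q hq hpq
    obtain ⟨s, hs⟩ := hpq
    have h1 : countα (val p) + countα s ≤ countα (val p) :=
      (weight_mul _ _ _).symm.trans_le (hs ▸ h1)
    have h2 : countγ (val p) + countγ s = 0 := (weight_mul _ _ _).symm.trans (hs ▸ hγ q hq)
    have h3 := eq_pow_mul_pow (m := s) (by omega)
    rw [show countα s = 0 by omega, pow_zero, one_mul] at h3
    exact ⟨_, by rw [hs]; exact congrArg _ h3⟩
  have hβ : ∀ n, ∃ p ∈ z.carrier, n ≤ countβ (val p) := by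
    refine (exists_max_weight _ z).resolve_left ?_
    rintro ⟨p, hp, hmax⟩
    refine hne (eq_of_extend_eq h .α hp fun q hq hpq => ?_)
    have h1 := hmax q hq hpq
    obtain ⟨s, hs⟩ := hpq
    have h1 : countβ (val p) + countβ s ≤ countβ (val p) :=
      (weight_mul _ _ _).symm.trans_le (hs ▸ h1)
    have h2 : countγ (val p) + countγ s = 0 := (weight_mul _ _ _).symm.trans (hs ▸ hγ q hq)
    have h3 := eq_pow_mul_pow (m := s) (by omega)
    rw [show countβ s = 0 by omega, pow_zero, mul_one] at h3
    exact ⟨_, by rw [hs]; exact congrArg _ h3⟩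
  ext p
  refine ⟨fun hp => hγ p hp, fun hp => ?_⟩
  obtain ⟨q, hq, h1⟩ := hα (countα (val p))
  obtain ⟨q', hq', h2⟩ := hβ (countβ (val p))
  obtain ⟨d, hd, h3, h4⟩ := z.directed _ hq _ hq'
  have h5 := h1.trans (weight_dvd _ (isPrefix_iff.1 h3))
  have h6 := h2.trans (weight_dvd _ (isPrefix_iff.1 h4))
  refine z.hereditary _ _ hd (isPrefix_iff.2 ?_)
  rw [eq_pow_mul_pow (hγ d hd), eq_pow_mul_pow (m := val p) hp]
  exact pow_mul_pow_dvd h5 h6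

theorem bdExtend_bdGammaFree (μ : u ⟶ v) (h : countγ μ.1 = 0) :
    bdExtend μ (bdGammaFree v) = bdGammaFree u := by
  obtain ⟨y, hy⟩ := exists_eq_bdExtend (x := bdGammaFree u) (μ := μ) h
  rw [hy]
  congr 1
  refine Subtype.ext (PathSpace.ext (Set.ext fun p => ?_))
  have h1 : p ∈ y.1.carrier ↔ prepend μ p ∈ (bdGammaFree u).1.carrier := by
    rw [hy]
    exact prepend_mem_extend.symm
  rw [h1]
  have h2 : countγ (val (prepend μ p)) = countγ μ.1 + countγ (val p) := weight_mul _ _ _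
  change countγ (val p) = 0 ↔ countγ (val (prepend μ p)) = 0
  rw [h2, h, zero_add]

theorem nontrivialIsotropy_eq :
    nontrivialIsotropy (UnitSpace k) = groupoidOrbit (bdGammaFree (⟨0⟩ : Vertex k)) := by
  ext x
  rw [mem_nontrivialIsotropy_iff]
  constructor
  · rintro ⟨v, μ, ν, z, hne, rfl, h⟩
    obtain rfl : z = bdGammaFree v :=
      Subtype.ext (eq_gammaFree_of_extend_eq (congrArg Subtype.val h) hne)
    have e := bdExtend_bdGammaFree (alphaPath v) (by simp [alphaPath, homMk, weight_pow])
    exact ⟨eqToHom e.symm ≫ mkHom (alphaPath v) μ (bdGammaFree v)⟩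
  · rintro ⟨g⟩
    obtain ⟨v, μ, ν, z, h⟩ := exists_mkArr (⟨_, x, g⟩ : Arr (UnitSpace k))
    have hr : bdGammaFree (⟨0⟩ : Vertex k) = bdExtend μ z := congrArg Arr.r h
    have hs : x = bdExtend ν z := congrArg Arr.s h
    have hμ : countγ μ.1 = 0 := by
      have := bdExtend_mem μ z
      rw [← hr] at this
      exact this
    obtain rfl : z = bdGammaFree v :=
      bdExtend_injective μ (hr.symm.trans (bdExtend_bdGammaFree μ hμ).symm)
    -- The arrow `[να, νβ, α^∞β^∞]` is not a unit.
    have hα := bdExtend_bdGammaFree (edgeα v) (by simp [edgeα, edge, homMk])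
    have hβ := bdExtend_bdGammaFree (edgeβ v) (by simp [edgeβ, edge, homMk])
    refine ⟨_, ν ≫ edgeα v, ν ≫ edgeβ v, bdGammaFree _, fun he => ?_, ?_, ?_⟩
    · have := congrArg countα (congrArg Subtype.val (CategoryOfPaths.left_cancel _ _ _ he))
      simp [edgeα, edgeβ, edge, homMk] at this
    · rw [bdExtend_comp, hα, hs]
    · rw [bdExtend_comp, bdExtend_comp, hα, hβ]

theorem groupoidOrbit_subset_range : groupoidOrbit (bdGammaFree (⟨0⟩ : Vertex k)) ⊆
    range fun p : PathsFrom (Vertex k) ⟨0⟩ => bdExtend p.2 (bdGammaFree p.1) := by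
  rw [← nontrivialIsotropy_eq]
  intro x hx
  obtain ⟨v, μ, ν, z, hne, rfl, h⟩ := mem_nontrivialIsotropy_iff.1 hx
  obtain rfl : z = bdGammaFree v :=
    Subtype.ext (eq_gammaFree_of_extend_eq (congrArg Subtype.val h) hne)
  exact ⟨⟨v, μ⟩, rfl⟩

theorem countable_nontrivialIsotropy : (nontrivialIsotropy (UnitSpace k)).Countable := by
  rw [nontrivialIsotropy_eq]
  exact (countable_range _).mono groupoidOrbit_subset_range

/-- The points `α ⋯ αγα^∞β^∞` are distinct. -/
theorem infinite_nontrivialIsotropy (hk : ∀ n : ℕ, ∃ i ≥ n, 0 < k i) :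
    (nontrivialIsotropy (UnitSpace k)).Infinite := by
  have hinf : {i | 0 < k i}.Infinite := Nat.frequently_atTop_iff_infinite.1
    (Filter.frequently_atTop.2 fun n => by simpa using hk n)
  have : Infinite {i | 0 < k i} := hinf.to_subtype
  refine Set.infinite_of_injective_forall_mem
    (f := fun i : {i | 0 < k i} => samplePoint (alphaPath ⟨i.1⟩) i.2) ?_ fun i => ?_
  · have key : ∀ i j : {i | 0 < k i}, i.1 < j.1 →
        samplePoint (alphaPath ⟨i.1⟩) i.2 ≠ samplePoint (alphaPath ⟨j.1⟩) j.2 := by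
      intro i j hij h
      have h1 : samplePoint (alphaPath ⟨j.1⟩) j.2 ∈
          bdCylinder ⟨_, alphaPath ⟨i.1⟩ ≫ edgeγ ⟨i.1⟩ ⟨0, i.2⟩⟩ := by
        rw [← h, samplePoint, ← bdExtend_comp]
        exact bdExtend_mem _ _
      obtain ⟨η, hη⟩ := (samplePoint_mem_iff (Nat.succ_le_of_lt hij)).1 h1
      have h2 : countγ (letter .α ^ i.1 * letter (.γ 0) * η.1) = countγ (letter .α ^ j.1) :=
        congrArg (fun μ => countγ (Subtype.val μ)) hη
      simp [weight_pow] at h2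
    intro i j h
    rcases lt_trichotomy i.1 j.1 with hlt | heq | hlt
    · exact absurd h (key i j hlt)
    · exact Subtype.ext heq
    · exact absurd h.symm (key j i hlt)
  · rw [nontrivialIsotropy_eq]
    have e := bdExtend_bdGammaFree (alphaPath (⟨i.1 + 1⟩ : Vertex k))
      (by simp [alphaPath, homMk, weight_pow])
    have e' : bdExtend (alphaPath ⟨i.1⟩ ≫ edgeγ ⟨i.1⟩ ⟨0, i.2⟩) (bdGammaFree ⟨i.1 + 1⟩) =
        samplePoint (alphaPath ⟨i.1⟩) i.2 := bdExtend_comp _ _ _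
    exact ⟨eqToHom e.symm ≫ mkHom _ _ _ ≫ eqToHom e'⟩

/-- Each point lies in the cylinder set of a path of length `n`, for every `n`. -/
instance nullSingletonClass_traceMeasure (hk : ∀ n : ℕ, ∃ i ≥ n, 0 < k i) :
    NullSingletonClass (traceMeasure hk) := ⟨fun x => by
  have h : (traceMeasure hk).real {x} ≤ 0 := by
    refine ge_of_tendsto' (tendsto_cylWeight hk) fun n => ?_
    obtain ⟨p, hp, -, hn⟩ := (isUnbounded_boundary x).exists_extension (id_mem x.1) (n := n)
      (by simp)
    have hlen := val_len p
    simp only [zero_add, hn] at hlen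
    rw [hlen, ← traceMeasure_bdCylinder hk p.2]
    exact measureReal_mono (singleton_subset_iff.2 hp)
  exact (measureReal_eq_zero_iff).1 (le_antisymm h measureReal_nonneg)⟩

end

end PathGroupoid

end

theorem mainTheorem6 (k : ℕ → ℕ) (hk : ∀ n : ℕ, ∃ i ≥ n, 0 < k i) :
    ∃ m : MeasureTheory.Measure (UnitSpace k),
      (MeasureTheory.IsProbabilityMeasure m ∧ IsInvariant m) ∧
      (∀ m' : MeasureTheory.Measure (UnitSpace k),
        MeasureTheory.IsProbabilityMeasure m' → IsInvariant m' → m' = m) ∧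
      ((∃ x : UnitSpace k, nontrivialIsotropy (UnitSpace k) = groupoidOrbit x) ∧
        (nontrivialIsotropy (UnitSpace k)).Countable ∧
        (nontrivialIsotropy (UnitSpace k)).Infinite ∧
        m (nontrivialIsotropy (UnitSpace k)) = 0) ∧
      ∃ τ : FullCStar (UnitSpace k) →L[ℂ] ℂ,
        IsTracialState τ ∧
        (∀ f : C_c(Arr (UnitSpace k), ℂ), τ (toFullCStar f) = ∫ x, f (unitArr x) ∂m) ∧
        (∀ τ' : FullCStar (UnitSpace k) →L[ℂ] ℂ, IsTracialState τ' → τ' = τ) := by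
  refine ⟨traceMeasure hk, ⟨inferInstance, isInvariant_traceMeasure hk⟩,
    fun m' _ hm' => eq_traceMeasure hk hm',
    ⟨⟨_, nontrivialIsotropy_eq⟩, countable_nontrivialIsotropy, infinite_nontrivialIsotropy hk,
      countable_nontrivialIsotropy.measure_zero _⟩,
    limitTrace hk, isTracialState_limitTrace hk, limitTrace_toFullCStar hk,
    fun _ hT => hT.eq_limitTrace hk⟩
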